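/- **Setting.** On $\mathbb R^6$ with standard basis $e_0,\dots,e_5$ let $\langle x,y\rangle=-(x^0y^5+x^5y^0)-(x^1y^4+x^4y^1)+x^2y^2+x^3y^3={}^t x\,h\,y$. Let $G$ be the identity component of $\{A\in GL(6,\mathbb R): {}^tAhA=h\}\cong O(4,2)$ and $\mathfrak g=\{X: {}^tXh+hX=0\}$ its Lie algebra. Let $\Lambda$ be the Grassmannian of totally isotropic 2-planes, with the action of $G$, and $\lambda_0=[e_0,e_1]\in\Lambda$, where $[x,y]$ denotes the plane spanned by $x,y$. Let $J\subset\mathbb R$ be a nonempty open interval and $\gamma:J\to\Lambda$ a smooth curve. A *Lie frame field* along $\gamma$ is a smooth map $A:I\to G$, $I\subset J$ open, with $\gamma(t)=A(t)\cdot\lambda_0$; put $\theta=(\theta^i_j)=A^{-1}dA$. The curve $\gamma$ is *transversal* if $\theta^4_0\ne0$ at every point, for every Lie frame field along $\gamma$ (that is, $\gamma$ is transversal to the contact distribution of $\Lambda$). A Lie frame field is of *first order* if $\theta^4_0$ is positive (as a multiple of $dt$) and $\theta^2_0=\theta^2_1=\theta^3_0=\theta^3_1=0$; then a matrix $P$ is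 defined by $\left(\begin{smallmatrix}\theta^2_4&\theta^2_5\\ \theta^3_4&\theta^3_5\end{smallmatrix}\right)=P\,\theta^4_0$. It is of *second order* if moreover $P=I_2$, of *third order* if moreover $\theta^0_0+\theta^1_1=0$, and of *fourth order* if moreover $\theta^0_1+\theta^1_0=0$. For a third order frame field, functions $p,q$ are defined by $\tfrac12(\theta^0_1+\theta^1_0)=p\,\theta^4_0$ and $\theta^1_1=q\,\theta^4_0$. The transversal curve $\gamma$ is *generic* if about every point of $J$ there is a third order frame field along $\gamma$ with $p^2+q^2>0$ at that point. (Such frame fields have $\theta^4_0>0$ and $P=I_2$. The signs of $\theta^4_0$ and, for first order frame fields, of $\det P$ do not depend on the frame field; so $\gamma$ is positively oriented and nondegenerate with $\det P>0$.) The *Lie arclength* $s$ of $\gamma$ is defined, up to an additive constant, by $ds=\theta^4_0$ for any second order frame field. *Lie curvatures* of $\gamma$ are functions $\kappa_1,\dots,\kappa_4:J\to\mathbb R$ such that about every point of $J$ there is a fourth order frame field with $\theta^0_0=\kappa_1ds$, $\theta^1_0=\kappa_2ds$, $\theta^3_2=\kappa_3ds$, $\theta^0_4=\kappa_4ds$;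 they are unique up to a global change of the sign of $\kappa_1$. The curve $\gamma$ is *critical* for $\mathcal L=\int ds$ if $\frac{d}{du}\big|_{u=0}\int_a^b ds_u=0$ for every smooth map $V:J\times(-\varepsilon,\varepsilon)\to\Lambda$, $\varepsilon>0$, with $V(\cdot,0)=\gamma$, such that each $\gamma_u=V(\cdot,u)$ is a generic transversal curve, with Lie arclength $s_u$, and $V(t,u)=\gamma(t)$ for all $u$ and all $t\in J\setminus[a,b]$, where $[a,b]\subset J$ is compact. **Theorem B.** Let $\gamma:J\to\Lambda$ be a generic transversal curve parametrized by Lie arclength $s$. Then $\gamma$ has Lie curvatures $\kappa_1,\kappa_2,\kappa_3,\kappa_4$, and for any choice of them, $\gamma$ is critical for $\mathcal L$ if and only if $\kappa_1,\kappa_2,\kappa_3,\kappa_4$ are constant and $$\kappa_1\neq0,\qquad \kappa_3=0,\qquad \kappa_4=\kappa_1^2-\kappa_2^2 .$$ Moreover, if $\gamma$ is critical, there exist constants $u,v\in\mathbb R$, $u\ne0$, and $A\in G$ such that $\gamma(s)=A\exp(s\,X(u,v))\cdot\lambda_0$ for all $s\in J$, where $$X(u,v)=\begin{pmatrix} uI_{1,1}+vLI_{1,1}&L&(u^2-v^2)I_{1,1}\\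 0&0&I_2\\ I_{1,1}&0&uI_{1,1}-vLI_{1,1}\end{pmatrix}\in\mathfrak g,\qquad L=\begin{pmatrix}0&1\\1&0\end{pmatrix},\quad I_{1,1}=\begin{pmatrix}1&0\\0&-1\end{pmatrix}.$$ -/

import Mathlib

open scoped ContDiff Matrix Topology

noncomputable section

namespace LieSphere

/-- Real `6 × 6` matrices; rows and columns are numbered `0, …, 5`. -/
abbrev Mat : Type := Matrix (Fin 6) (Fin 6) ℝ

/-- The Gram matrix of the form `-(x⁰y⁵ + x⁵y⁰) - (x¹y⁴ + x⁴y¹) + x²y² + x³y³` of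
signature `(4,2)` on `ℝ⁶`. -/
def h : Mat :=
  !![0, 0, 0, 0, 0, -1;
     0, 0, 0, 0, -1, 0;
     0, 0, 1, 0, 0, 0;
     0, 0, 0, 1, 0, 0;
     0, -1, 0, 0, 0, 0;
     -1, 0, 0, 0, 0, 0]

/-- The symmetric bilinear form `⟨x, y⟩ = ᵗx h y`. -/
def form (x y : Fin 6 → ℝ) : ℝ := x ⬝ᵥ (h *ᵥ y)

/-- The group `G`: the identity component of the pseudo-orthogonal group
`{A | ᵗA h A = h} ≅ O(4,2)`, as a set of matrices. -/
def G : Set Mat := connectedComponentIn {A : Mat | Aᵀ * h * A = h} 1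

/-- The Lie algebra of `G`. -/
def lieAlg : Set Mat := {X : Mat | Xᵀ * h + h * X = 0}

/-- The space `Λ` of lines in the Lie quadric, that is, of the totally isotropic 2-planes of
`ℝ^{4,2}`. -/
def Lam : Type :=
  {W : Submodule ℝ (Fin 6 → ℝ) // Module.finrank ℝ W = 2 ∧ ∀ x ∈ W, ∀ y ∈ W, form x y = 0}

/-- The 2-plane underlying a point of `Λ`. -/
def Lam.plane (W : Lam) : Submodule ℝ (Fin 6 → ℝ) := W.1

/-- The linear action of matrices on subspaces of `ℝ⁶`. -/
def act (A : Mat) (W : Submodule ℝ (Fin 6 → ℝ)) : Submodule ℝ (Fin 6 → ℝ) :=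
  W.map A.mulVecLin

/-- The origin `λ₀ = [e₀, e₁]` of `Λ`, as a 2-plane. -/
def origin : Submodule ℝ (Fin 6 → ℝ) :=
  Submodule.span ℝ {Pi.single 0 1, Pi.single 1 1}

/-- A map into the Grassmannian `Λ` is smooth on the open set `U` if, locally in `U`, its values
are spanned by two smooth vector-valued functions. -/
def SmoothInto {E : Type*} [NormedAddCommGroup E] [NormedSpace ℝ E] (f : E → Lam) (U : Set E) :
    Prop :=
  ∀ x ∈ U, ∃ N : Set E, IsOpen N ∧ x ∈ N ∧ N ⊆ U ∧ ∃ a b : E → Fin 6 → ℝ,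
    ContDiffOn ℝ ∞ a N ∧ ContDiffOn ℝ ∞ b N ∧
      ∀ y ∈ N, (f y).plane = Submodule.span ℝ {a y, b y}

/-- `A` is a Lie frame field along `γ` on the open set `I`: a smooth map `I → G` such that
`γ(t) = A(t) · λ₀ = [A₀(t), A₁(t)]`. -/
structure IsFrame (γ : ℝ → Lam) (I : Set ℝ) (A : ℝ → Mat) : Prop where
  isOpen : IsOpen I
  smooth : ∀ i j, ContDiffOn ℝ ∞ (fun t => A t i j) I
  mem : ∀ t ∈ I, A t ∈ G
  proj : ∀ t ∈ I, (γ t).plane = act (A t) origin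

/-- The pullback `θ = A⁻¹ dA` of the Maurer–Cartan form, evaluated on `d/dt`; the entry `θ^i_j`
is `theta A t i j`. -/
def theta (A : ℝ → Mat) (t : ℝ) : Mat :=
  (A t)⁻¹ * Matrix.of (fun i j => deriv (fun s => A s i j) t)

/-- Transversal curve on `J`: a smooth curve on which every local contact form `A^*(ω^4_0)` is
nonzero at every point (in particular the curve is immersed). -/
structure IsTCurve (J : Set ℝ) (γ : ℝ → Lam) : Prop where
  smooth : SmoothInto γ J
  transversal : ∀ I A, IsFrame γ I A → ∀ t ∈ J ∩ I, theta A t 4 0 ≠ 0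

/-- First order frame field: `θ^4_0 > 0` and `θ^2_0 = θ^2_1 = θ^3_0 = θ^3_1 = 0`. The sign of
`θ^4_0` is the same for all frame fields with values in `G`; it is positive after orienting the
curve suitably. -/
structure IsFirstOrder (γ : ℝ → Lam) (I : Set ℝ) (A : ℝ → Mat) : Prop extends
    IsFrame γ I A where
  pos : ∀ t ∈ I, 0 < theta A t 4 0
  zero : ∀ t ∈ I, theta A t 2 0 = 0 ∧ theta A t 2 1 = 0 ∧ theta A t 3 0 = 0 ∧ theta A t 3 1 = 0

/-- The `2 × 2` matrix `P` defined by `(θ^2_4, θ^2_5; θ^3_4, θ^3_5) = P θ^4_0`. -/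
def frameP (A : ℝ → Mat) (t : ℝ) : Matrix (Fin 2) (Fin 2) ℝ :=
  (theta A t 4 0)⁻¹ •
    !![theta A t 2 4, theta A t 2 5;
       theta A t 3 4, theta A t 3 5]

/-- Nondegenerate transversal curve: `det P ≠ 0` at every point, where `P` is computed in a
first order frame field about the point (the condition does not depend on its choice). -/
structure IsNondegenerate (J : Set ℝ) (γ : ℝ → Lam) : Prop extends IsTCurve J γ where
  det_ne : ∀ t ∈ J, ∃ I A, t ∈ I ∧ IsFirstOrder γ I A ∧ (frameP A t).det ≠ 0

/-- Second order frame field: first order with `P = I₂`. -/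
structure IsSecondOrder (γ : ℝ → Lam) (I : Set ℝ) (A : ℝ → Mat) : Prop extends
    IsFirstOrder γ I A where
  P_eq_one : ∀ t ∈ I, frameP A t = 1

/-- The Lie speed `ds/dt` at `t`, where `ds = θ^4_0` in any second order frame field about `t`
(the value does not depend on the choice of the frame field). -/
def lieSpeed (γ : ℝ → Lam) (t : ℝ) : ℝ :=
  Classical.epsilon fun ρ : ℝ =>
    ∃ I A, t ∈ I ∧ IsSecondOrder γ I A ∧ ρ = theta A t 4 0

/-- Third order frame field: second order with `θ^0_0 + θ^1_1 = 0`. -/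
structure IsThirdOrder (γ : ℝ → Lam) (I : Set ℝ) (A : ℝ → Mat) : Prop extends
    IsSecondOrder γ I A where
  trace_zero : ∀ t ∈ I, theta A t 0 0 + theta A t 1 1 = 0

/-- The coefficient `p` in `(θ^0_1 + θ^1_0) / 2 = p θ^4_0`. -/
def coefP (A : ℝ → Mat) (t : ℝ) : ℝ :=
  (theta A t 0 1 + theta A t 1 0) / 2 / theta A t 4 0

/-- The coefficient `q` in `θ^1_1 = q θ^4_0`. -/
def coefQ (A : ℝ → Mat) (t : ℝ) : ℝ := theta A t 1 1 / theta A t 4 0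

/-- Generic transversal curve: nondegenerate with `p² + q² > 0` at every point, where `p`, `q`
are computed in a third order frame field about the point (`p² + q²` does not depend on its
choice). As the sign of `det P` is the same for all first order frame fields, and `P = I₂` in
second order ones, second and third order frame fields exist if and only if `det P > 0`. -/
structure IsGeneric (J : Set ℝ) (γ : ℝ → Lam) : Prop extends IsNondegenerate J γ where
  pq_pos : ∀ t ∈ J, ∃ I A, t ∈ I ∧ IsThirdOrder γ I A ∧ 0 < coefP A t ^ 2 + coefQ A t ^ 2

/-- Fourth order frame field: third order with `p = 0`. -/
structure IsFourthOrder (γ : ℝ → Lam) (I : Set ℝ) (A : ℝ → Mat) : Prop extends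
    IsThirdOrder γ I A where
  p_zero : ∀ t ∈ I, coefP A t = 0

/-- `κ₁, κ₂, κ₃, κ₄ : J → ℝ` are Lie curvatures of `γ`: about every point of `J` there is a
fourth order frame field with `θ^0_0 = κ₁ ds`, `θ^1_0 = κ₂ ds`, `θ^3_2 = κ₃ ds`,
`θ^0_4 = κ₄ ds`, where `ds = θ^4_0`. -/
def IsLieCurvatures (J : Set ℝ) (γ : ℝ → Lam) (κ₁ κ₂ κ₃ κ₄ : ℝ → ℝ) : Prop :=
  ∀ t₀ ∈ J, ∃ I A, t₀ ∈ I ∧ I ⊆ J ∧ IsFourthOrder γ I A ∧ ∀ t ∈ I,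
    theta A t 0 0 = κ₁ t * theta A t 4 0 ∧ theta A t 1 0 = κ₂ t * theta A t 4 0 ∧
    theta A t 3 2 = κ₃ t * theta A t 4 0 ∧ theta A t 0 4 = κ₄ t * theta A t 4 0

/-- `γ` is parametrized by Lie arclength on `J`. -/
def IsArclengthParam (J : Set ℝ) (γ : ℝ → Lam) : Prop := ∀ t ∈ J, lieSpeed γ t = 1

/-- `V(s, u)`, with `s ∈ J` and `u ∈ (-ε, ε)`, is a variation of `γ` through generic transversal
curves that is trivial outside the compact interval `[a, b] ⊆ J`. -/
structure IsVariation (J : Set ℝ) (γ : ℝ → Lam) (a b ε : ℝ) (V : ℝ × ℝ → Lam) : Prop where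
  le : a ≤ b
  subset : Set.Icc a b ⊆ J
  eps_pos : 0 < ε
  smooth : SmoothInto V (J ×ˢ Set.Ioo (-ε) ε)
  generic : ∀ u ∈ Set.Ioo (-ε) ε, IsGeneric J (fun s => V (s, u))
  initial : ∀ s ∈ J, V (s, 0) = γ s
  support : ∀ s ∈ J \ Set.Icc a b, ∀ u ∈ Set.Ioo (-ε) ε, V (s, u) = γ s

/-- Critical curves of the functional `∫ ds`: the derivative at `u = 0` of the Lie arclength
`∫_a^b ds_u` of the variation exists and vanishes for all compactly supported variations through
generic transversal curves. -/
def IsCritical (J : Set ℝ) (γ : ℝ → Lam) : Prop :=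
  ∀ a b ε V, IsVariation J γ a b ε V →
    HasDerivAt (fun u => ∫ s in a..b, lieSpeed (fun t => V (t, u)) s) 0 0

/-- The matrix `X(u, v)`, with blocks
`(u I₁₁ + v L I₁₁, L, (u² - v²) I₁₁; 0, 0, I₂; I₁₁, 0, u I₁₁ - v L I₁₁)`, where
`L = (0, 1; 1, 0)` and `I₁₁ = (1, 0; 0, -1)`. -/
def X (u v : ℝ) : Mat :=
  !![u, -v, 0, 1, u ^ 2 - v ^ 2, 0;
     v, -u, 1, 0, 0, -(u ^ 2 - v ^ 2);
     0, 0, 0, 0, 1, 0;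
     0, 0, 0, 0, 0, 1;
     1, 0, 0, 0, u, v;
     0, -1, 0, 0, -v, -u]

end LieSphere

end

set_option linter.unusedSimpArgs false
set_option linter.unnecessarySeqFocus false

namespace LieSphere

/-! The Lie speed has an explicit formula in terms of vector fields spanning the planes of the
curve, so its first variation can be computed directly. Let `a, b` span the planes, and let `c, d`
be orthonormal and orthogonal to `a, b, a', b'`. Put `τ = -⟨a', b⟩ > 0` and let `K` be the 2 × 2
matrix with rows `⟨c', a'⟩, ⟨c', b'⟩` and `⟨d', a'⟩, ⟨d', b'⟩`. When `det K < 0`, a change of basis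
of the plane produces a third order frame whose speed `σ` satisfies `σ³ τ = -det K` (`adapted_norm`,
`Adapted.isThirdOrder`). This `σ` is the Lie speed, because two second order frames over the same
point differ by a block triangular matrix with rotations on the diagonal and have the same `θ^4_0`
(`IsSecondOrder.isRot`, `IsSecondOrder.lieSpeed_eq`).

Along a fourth order frame field `A` of `γ`, parametrized by arclength, nearby curves are written as
`A(s) chart(ξ(s,u)) λ₀` with five coordinates `ξ_i` vanishing at `u = 0`. There `σ = τ = 1` and `K =
diag(-1, 1)`. Differentiating `σ³ τ = -det K` in `u` and writing `x_i = ∂_u ξ_i` gives `3 ∂_u σ = B'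
+ E(x)` with a boundary term `B` (`RegularDeformation.du_speed`, integrated in `first_variation`).
The operator `E` involves no derivatives of `x` and does not contain `x₄`. Its coefficients at `x₀,
x₃` are `κ₁' ± (κ₁² - (κ₂ + κ₃)² - κ₄)`, those at `x₁, x₂` are `(κ₂ + κ₃)' ± 2 κ₁ κ₃`.

Necessity is the fundamental lemma of the calculus of variations applied to `ξ_i = u g(s) x_i` with
a bump function `g`. All four coefficients vanish, and `κ₁ ≠ 0` by genericity, so `κ₃ = 0`, then
`κ₁' = κ₂' = 0` and `κ₄ = κ₁² - κ₂²` (`IsCritical.eulerLagrange_eq_zero`, `IsCritical.curvatures`).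

Conversely, these curvatures mean `θ = X(κ₁, κ₂)`, so each local frame has the form `C exp(sX)`.
Fourth order frames with the same sign of `θ^0_0` agree up to sign (`IsFourthOrder.eq_or_neg`), so
`C` is the same up to sign over the connected set `J`, which gives the orbit and a frame on all of
`J` (`exists_global_frame`). Relative to this frame an arbitrary variation has unique big-cell
coordinates near `u = 0` (`exists_local_coord`, `coord_eq`). Now `E` vanishes identically, and `B`
vanishes at the ends of `[a, b]` since the variation is trivial outside (`isCritical_of_frame`).

Lie curvatures exist because `(p, q)` turns through twice the angle of a frame rotation and can be
brought to `(0, -r)` with `r > 0` (`exists_rotation`, `IsGeneric.exists_isLieCurvatures`). -/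

theorem form_eq (x y : Fin 6 → ℝ) :
    form x y = -(x 0 * y 5 + x 5 * y 0) - (x 1 * y 4 + x 4 * y 1) + x 2 * y 2 + x 3 * y 3 := by
  simp [form, h, dotProduct, Matrix.mulVec, Fin.sum_univ_six]
  ring

theorem form_comm (x y : Fin 6 → ℝ) : form x y = form y x := by
  rw [form_eq, form_eq]; ring

theorem h_mul_h : h * h = 1 := by
  ext i j
  fin_cases i <;> fin_cases j <;> simp [h, Matrix.mul_apply, Fin.sum_univ_six]

theorem h_transpose : hᵀ = h := by
  ext i j
  fin_cases i <;> fin_cases j <;> simp [h]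

/-! ### The pseudo-orthogonal group, its Lie algebra and frame fields. -/

/-- The pseudo-orthogonal group of `h`. -/
def Oh : Set Mat := {A | Aᵀ * h * A = h}

theorem G_subset : G ⊆ Oh := connectedComponentIn_subset _ _

theorem mem_G_of_isPreconnected {S : Set Mat} (hS : IsPreconnected S) (hO : S ⊆ Oh) {A B : Mat}
    (hA : A ∈ S) (hAG : A ∈ G) (hB : B ∈ S) : B ∈ G := by
  have h1 : G = connectedComponentIn {A : Mat | Aᵀ * h * A = h} A := connectedComponentIn_eq hAG
  rw [h1]
  exact hS.subset_connectedComponentIn hA hO hB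

/-- The identity component is never described by equations. Algebra is done in `Oh`, and membership
in `G` is transported along connected parameter sets from a point where it is known. -/
theorem mem_G_of_continuousOn {X : Type*} [TopologicalSpace X] {K : Set X} (hK : IsPreconnected K)
    {f : X → Mat} (hf : ∀ i j, ContinuousOn (fun x => f x i j) K) (hO : ∀ x ∈ K, f x ∈ Oh) {x y : X}
    (hx : x ∈ K) (hxG : f x ∈ G) (hy : y ∈ K) : f y ∈ G := by
  have hc : ContinuousOn f K := by
    apply continuousOn_pi.2
    intro i
    exact continuousOn_pi.2 fun j => hf i j
  refine mem_G_of_isPreconnected (hK.image f hc) ?_ (Set.mem_image_of_mem f hx) hxG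
    (Set.mem_image_of_mem f hy)
  rintro _ ⟨z, hz, rfl⟩
  exact hO z hz

theorem Oh.inv_mul {A : Mat} (hA : A ∈ Oh) : h * Aᵀ * h * A = 1 := by
  have : Aᵀ * h * A = h := hA
  rw [mul_assoc, mul_assoc, ← mul_assoc Aᵀ, this, h_mul_h]

theorem Oh.mul_inv {A : Mat} (hA : A ∈ Oh) : A * (h * Aᵀ * h) = 1 :=
  mul_eq_one_comm.1 (Oh.inv_mul hA)

theorem Oh.inv_eq {A : Mat} (hA : A ∈ Oh) : A⁻¹ = h * Aᵀ * h :=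
  Matrix.inv_eq_left_inv (Oh.inv_mul hA)

theorem Oh.mul {A B : Mat} (hA : A ∈ Oh) (hB : B ∈ Oh) : A * B ∈ Oh := by
  have h1 : Aᵀ * h * A = h := hA
  have h2 : Bᵀ * h * B = h := hB
  change (A * B)ᵀ * h * (A * B) = h
  rw [Matrix.transpose_mul]
  calc Bᵀ * Aᵀ * h * (A * B) = Bᵀ * (Aᵀ * h * A) * B := by noncomm_ring
    _ = h := by rw [h1, h2]

theorem Oh.inv {A : Mat} (hA : A ∈ Oh) : h * Aᵀ * h ∈ Oh := by
  have h1 := Oh.mul_inv hA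
  change (h * Aᵀ * h)ᵀ * h * (h * Aᵀ * h) = h
  rw [Matrix.transpose_mul, Matrix.transpose_mul, h_transpose, Matrix.transpose_transpose]
  calc h * (A * h) * h * (h * Aᵀ * h) = h * (A * (h * h) * h * Aᵀ * h) := by noncomm_ring
    _ = h * (A * (h * Aᵀ * h)) := by rw [h_mul_h]; noncomm_ring
    _ = h := by rw [h1, mul_one]

theorem Oh.isUnit {A : Mat} (hA : A ∈ Oh) : IsUnit A :=
  ⟨⟨A, h * Aᵀ * h, Oh.mul_inv hA, Oh.inv_mul hA⟩, rfl⟩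

theorem form_mulVec {A : Mat} (hA : A ∈ Oh) (x y : Fin 6 → ℝ) :
    form (A *ᵥ x) (A *ᵥ y) = form x y := by
  have h1 : Aᵀ * h * A = h := hA
  unfold form
  rw [Matrix.mulVec_mulVec, ← Matrix.vecMul_transpose, ← Matrix.dotProduct_mulVec,
    Matrix.mulVec_mulVec, ← mul_assoc, h1]

theorem form_col {A : Mat} (hA : A ∈ Oh) (i j : Fin 6) : form (A.col i) (A.col j) = h i j := by
  rw [← Matrix.mulVec_single_one A i, ← Matrix.mulVec_single_one A j, form_mulVec hA]
  simp [form]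

theorem Oh_iff {A : Mat} : A ∈ Oh ↔ ∀ i j, form (A.col i) (A.col j) = h i j := by
  refine ⟨form_col, fun H => ?_⟩
  change Aᵀ * h * A = h
  ext i j
  rw [← H i j, Matrix.mul_assoc]
  simp [form, Matrix.mul_apply, dotProduct, Matrix.mulVec]

theorem act_origin (A : Mat) : act A origin = Submodule.span ℝ {A.col 0, A.col 1} := by
  simp [act, origin, Submodule.map_span, Set.image_pair]

theorem act_mul (A B : Mat) (W : Submodule ℝ (Fin 6 → ℝ)) : act (A * B) W = act A (act B W) := by
  simp [act, Matrix.mulVecLin_mul, Submodule.map_comp]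

theorem act_neg (A : Mat) (W : Submodule ℝ (Fin 6 → ℝ)) : act (-A) W = act A W := by
  ext x
  simp only [act, Submodule.mem_map, Matrix.mulVecLin_apply, Matrix.neg_mulVec]
  constructor
  · rintro ⟨y, hy, rfl⟩; exact ⟨-y, W.neg_mem hy, by simp [Matrix.mulVec_neg]⟩
  · rintro ⟨y, hy, rfl⟩; exact ⟨-y, W.neg_mem hy, by simp [Matrix.mulVec_neg]⟩

/-- `A'` is the entrywise derivative of the matrix-valued function `A` at `t`. -/
def MDeriv (A : ℝ → Mat) (A' : Mat) (t : ℝ) : Prop :=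
  ∀ i j, HasDerivAt (fun s => A s i j) (A' i j) t

theorem MDeriv.mul {A B : ℝ → Mat} {A' B' : Mat} {t : ℝ} (hA : MDeriv A A' t)
    (hB : MDeriv B B' t) : MDeriv (fun s => A s * B s) (A' * B t + A t * B') t := by
  intro i j
  simp only [Matrix.mul_apply, Matrix.add_apply, ← Finset.sum_add_distrib]
  exact HasDerivAt.fun_sum fun k _ => (hA i k).mul (hB k j)

theorem MDeriv.transpose {A : ℝ → Mat} {A' : Mat} {t : ℝ} (hA : MDeriv A A' t) :
    MDeriv (fun s => (A s)ᵀ) A'ᵀ t := fun i j => hA j i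

theorem MDeriv.const (A : Mat) (t : ℝ) : MDeriv (fun _ => A) 0 t :=
  fun i j => hasDerivAt_const t (A i j)

theorem MDeriv.unique {A : ℝ → Mat} {A' B' : Mat} {t : ℝ} (hA : MDeriv A A' t)
    (hB : MDeriv A B' t) : A' = B' := by
  ext i j; exact (hA i j).unique (hB i j)

theorem MDeriv.congr {A B : ℝ → Mat} {A' : Mat} {t : ℝ} (hA : MDeriv A A' t)
    (hAB : ∀ᶠ s in 𝓝 t, B s = A s) : MDeriv B A' t := fun i j =>
  (hA i j).congr_of_eventuallyEq (hAB.mono fun _ hs => congrFun (congrFun hs i) j)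

theorem theta_eq_of_mderiv {A : ℝ → Mat} {A' : Mat} {t : ℝ} (hA : MDeriv A A' t)
    (hO : A t ∈ Oh) : theta A t = h * (A t)ᵀ * h * A' := by
  have : Matrix.of (fun i j => deriv (fun s => A s i j) t) = A' := by
    ext i j; exact (hA i j).deriv
  rw [theta, this, Oh.inv_eq hO]

theorem mul_theta {A : ℝ → Mat} {A' : Mat} {t : ℝ} (hA : MDeriv A A' t)
    (hO : A t ∈ Oh) : A t * theta A t = A' := by
  rw [theta_eq_of_mderiv hA hO, ← mul_assoc, Oh.mul_inv hO, one_mul]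

theorem mderiv_theta {A : ℝ → Mat} {A' : Mat} {t : ℝ} (hA : MDeriv A A' t)
    (hO : A t ∈ Oh) : MDeriv A (A t * theta A t) t := by
  rwa [mul_theta hA hO]

theorem theta_mem_lieAlg {A : ℝ → Mat} {A' : Mat} {t : ℝ} (hA : MDeriv A A' t)
    (hO : ∀ᶠ s in 𝓝 t, A s ∈ Oh) : theta A t ∈ lieAlg := by
  have hOt := hO.self_of_nhds
  have h1 := mderiv_theta hA hOt
  have h2 : MDeriv (fun s => (A s)ᵀ * h * A s) 0 t :=
    (MDeriv.const h t).congr (hO.mono fun s hs => hs)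
  have h3 := ((h1.transpose.mul (MDeriv.const h t)).mul h1).unique h2
  have h4 : (A t)ᵀ * h * A t = h := hOt
  change (theta A t)ᵀ * h + h * theta A t = 0
  rw [← h3]
  -- Replacing the two copies of `h` on the left by `ᵗA h A` turns that side into the derivative of
  -- `ᵗA h A`, which vanishes.
  nth_rewrite 1 [← h4]
  nth_rewrite 2 [← h4]
  rw [Matrix.transpose_mul]
  noncomm_ring

theorem h_mul_apply (X : Mat) (j : Fin 6) : (h * X) 0 j = -X 5 j ∧ (h * X) 1 j = -X 4 j ∧
    (h * X) 2 j = X 2 j ∧ (h * X) 3 j = X 3 j ∧ (h * X) 4 j = -X 1 j ∧ (h * X) 5 j = -X 0 j := by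
  simp only [Matrix.mul_apply, Fin.sum_univ_six]
  simp [h]

theorem mul_h_apply (X : Mat) (j : Fin 6) : (X * h) j 0 = -X j 5 ∧ (X * h) j 1 = -X j 4 ∧
    (X * h) j 2 = X j 2 ∧ (X * h) j 3 = X j 3 ∧ (X * h) j 4 = -X j 1 ∧ (X * h) j 5 = -X j 0 := by
  simp only [Matrix.mul_apply, Fin.sum_univ_six]
  simp [h]

/-- Relations between the entries of an element of the Lie algebra. -/
theorem lieAlg_entries {X : Mat} (hX : X ∈ lieAlg) :
    X 5 0 = 0 ∧ X 4 1 = 0 ∧ X 1 4 = 0 ∧ X 0 5 = 0 ∧ X 2 2 = 0 ∧ X 3 3 = 0 ∧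
    X 5 1 = - X 4 0 ∧ X 4 4 = - X 1 1 ∧ X 5 5 = - X 0 0 ∧ X 4 5 = - X 0 1 ∧ X 5 4 = - X 1 0 ∧
    X 1 5 = - X 0 4 ∧ X 2 3 = - X 3 2 ∧ X 0 2 = X 2 5 ∧ X 0 3 = X 3 5 ∧ X 1 2 = X 2 4 ∧
    X 1 3 = X 3 4 ∧ X 4 2 = X 2 1 ∧ X 4 3 = X 3 1 ∧ X 5 2 = X 2 0 ∧ X 5 3 = X 3 0 := by
  have H : ∀ i j, (Xᵀ * h) i j + (h * X) i j = 0 := fun i j => by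
    have : Xᵀ * h + h * X = 0 := hX
    rw [← Matrix.add_apply, this]; rfl
  have h1 := fun i => (mul_h_apply Xᵀ i)
  have h2 := fun j => (h_mul_apply X j)
  simp only [Matrix.transpose_apply] at h1
  refine ⟨?_, ?_, ?_, ?_, ?_, ?_, ?_, ?_, ?_, ?_, ?_, ?_, ?_, ?_, ?_, ?_, ?_, ?_, ?_, ?_, ?_⟩
  · linarith [H 0 0, (h1 0).1, (h2 0).1]
  · linarith [H 1 1, (h1 1).2.1, (h2 1).2.1]
  · linarith [H 4 4, (h1 4).2.2.2.2.1, (h2 4).2.2.2.2.1]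
  · linarith [H 5 5, (h1 5).2.2.2.2.2, (h2 5).2.2.2.2.2]
  · linarith [H 2 2, (h1 2).2.2.1, (h2 2).2.2.1]
  · linarith [H 3 3, (h1 3).2.2.2.1, (h2 3).2.2.2.1]
  · linarith [H 0 1, (h1 0).2.1, (h2 1).1]
  · linarith [H 1 4, (h1 1).2.2.2.2.1, (h2 4).2.1]
  · linarith [H 0 5, (h1 0).2.2.2.2.2, (h2 5).1]
  · linarith [H 1 5, (h1 1).2.2.2.2.2, (h2 5).2.1]
  · linarith [H 0 4, (h1 0).2.2.2.2.1, (h2 4).1]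
  · linarith [H 4 5, (h1 4).2.2.2.2.2, (h2 5).2.2.2.2.1]
  · linarith [H 2 3, (h1 2).2.2.2.1, (h2 3).2.2.1]
  · linarith [H 5 2, (h1 5).2.2.1, (h2 2).2.2.2.2.2]
  · linarith [H 5 3, (h1 5).2.2.2.1, (h2 3).2.2.2.2.2]
  · linarith [H 4 2, (h1 4).2.2.1, (h2 2).2.2.2.2.1]
  · linarith [H 4 3, (h1 4).2.2.2.1, (h2 3).2.2.2.2.1]
  · linarith [H 1 2, (h1 1).2.2.1, (h2 2).2.1]
  · linarith [H 1 3, (h1 1).2.2.2.1, (h2 3).2.1]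
  · linarith [H 0 2, (h1 0).2.2.1, (h2 2).1]
  · linarith [H 0 3, (h1 0).2.2.2.1, (h2 3).1]

theorem IsFrame.mem_Oh {γ : ℝ → Lam} {I : Set ℝ} {A : ℝ → Mat} (H : IsFrame γ I A) {t : ℝ}
    (ht : t ∈ I) : A t ∈ Oh := G_subset (H.mem t ht)

theorem IsFrame.mderiv {γ : ℝ → Lam} {I : Set ℝ} {A : ℝ → Mat} (H : IsFrame γ I A) {t : ℝ}
    (ht : t ∈ I) : MDeriv A (A t * theta A t) t := by
  refine mderiv_theta (A' := Matrix.of (fun i j => deriv (fun s => A s i j) t)) ?_ (H.mem_Oh ht)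
  intro i j
  have := ((H.smooth i j).contDiffAt (H.isOpen.mem_nhds ht)).differentiableAt (by simp)
  exact this.hasDerivAt

theorem IsFrame.theta_mem {γ : ℝ → Lam} {I : Set ℝ} {A : ℝ → Mat} (H : IsFrame γ I A) {t : ℝ}
    (ht : t ∈ I) : theta A t ∈ lieAlg :=
  theta_mem_lieAlg (H.mderiv ht)
    (Filter.Eventually.mono (H.isOpen.mem_nhds ht) fun _ hs => H.mem_Oh hs)

theorem IsFrame.contDiffOn_theta {γ : ℝ → Lam} {I : Set ℝ} {A : ℝ → Mat} (H : IsFrame γ I A)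
    (i j : Fin 6) : ContDiffOn ℝ ∞ (fun t => theta A t i j) I := by
  have h1 : ∀ k l, ContDiffOn ℝ ∞ (fun t => deriv (fun s => A s k l) t) I := fun k l =>
    (H.smooth k l).deriv_of_isOpen H.isOpen (by simp)
  have h2 : ContDiffOn ℝ ∞ (fun t => (h * (A t)ᵀ * h *
      Matrix.of (fun i j => deriv (fun s => A s i j) t)) i j) I := by
    simp only [Matrix.mul_apply, Matrix.transpose_apply, Matrix.of_apply]
    have := H.smooth
    fun_prop
  refine h2.congr fun t ht => ?_
  rw [theta, Oh.inv_eq (H.mem_Oh ht)]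

theorem IsFrame.mono {γ : ℝ → Lam} {I I' : Set ℝ} {A : ℝ → Mat} (H : IsFrame γ I A)
    (hI' : IsOpen I') (hs : I' ⊆ I) : IsFrame γ I' A :=
  ⟨hI', fun i j => (H.smooth i j).mono hs, fun t ht => H.mem t (hs ht),
    fun t ht => H.proj t (hs ht)⟩

theorem IsThirdOrder.mono {γ : ℝ → Lam} {I I' : Set ℝ} {A : ℝ → Mat} (H : IsThirdOrder γ I A)
    (hI' : IsOpen I') (hs : I' ⊆ I) : IsThirdOrder γ I' A where
  toIsSecondOrder := {
    toIsFirstOrder := {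
      toIsFrame := H.toIsFrame.mono hI' hs
      pos := fun t ht => H.pos t (hs ht)
      zero := fun t ht => H.zero t (hs ht) }
    P_eq_one := fun t ht => H.P_eq_one t (hs ht) }
  trace_zero := fun t ht => H.trace_zero t (hs ht)

theorem IsFourthOrder.mono {γ : ℝ → Lam} {I I' : Set ℝ} {A : ℝ → Mat} (H : IsFourthOrder γ I A)
    (hI' : IsOpen I') (hs : I' ⊆ I) : IsFourthOrder γ I' A where
  toIsThirdOrder := H.toIsThirdOrder.mono hI' hs
  p_zero := fun t ht => H.p_zero t (hs ht)

theorem IsThirdOrder.congr_curve {γ γ' : ℝ → Lam} {I : Set ℝ} {A : ℝ → Mat}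
    (H : IsThirdOrder γ I A) (hγ : ∀ t ∈ I, γ' t = γ t) : IsThirdOrder γ' I A where
  toIsSecondOrder := {
    toIsFirstOrder := {
      toIsFrame := ⟨H.isOpen, H.smooth, H.mem, fun t ht => by rw [hγ t ht]; exact H.proj t ht⟩
      pos := H.pos
      zero := H.zero }
    P_eq_one := H.P_eq_one }
  trace_zero := H.trace_zero

theorem IsSecondOrder.entries {γ : ℝ → Lam} {I : Set ℝ} {A : ℝ → Mat} (H : IsSecondOrder γ I A)
    {t : ℝ} (ht : t ∈ I) : theta A t 2 4 = theta A t 4 0 ∧ theta A t 2 5 = 0 ∧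
      theta A t 3 4 = 0 ∧ theta A t 3 5 = theta A t 4 0 := by
  have h1 := H.P_eq_one t ht
  have h0 := (H.pos t ht).ne'
  have e := fun i j => congrFun (congrFun h1 i) j
  have e00 := e 0 0
  have e01 := e 0 1
  have e10 := e 1 0
  have e11 := e 1 1
  simp [frameP, h0] at e00 e01 e10 e11
  field_simp at e00 e11
  exact ⟨e00, e01, e10, e11⟩

/-! ### Rigidity: the transition between two adapted frames. -/

theorem mem_origin {x : Fin 6 → ℝ} : x ∈ origin ↔ x 2 = 0 ∧ x 3 = 0 ∧ x 4 = 0 ∧ x 5 = 0 := by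
  rw [origin, Submodule.mem_span_pair]
  constructor
  · rintro ⟨a, b, rfl⟩; simp
  · rintro ⟨h2, h3, h4, h5⟩
    refine ⟨x 0, x 1, ?_⟩
    ext i
    fin_cases i <;> simp [*]

theorem act_inj {A : Mat} (hA : A ∈ Oh) {W W' : Submodule ℝ (Fin 6 → ℝ)}
    (H : act A W = act A W') : W = W' := by
  refine Submodule.map_injective_of_injective ?_ H
  exact Matrix.mulVec_injective_iff_isUnit.2 (Oh.isUnit hA)

/-- The lower left block of a matrix vanishes. -/
def LowerZero (S : Mat) : Prop :=
  S 2 0 = 0 ∧ S 2 1 = 0 ∧ S 3 0 = 0 ∧ S 3 1 = 0 ∧ S 4 0 = 0 ∧ S 4 1 = 0 ∧ S 5 0 = 0 ∧ S 5 1 = 0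

theorem lowerZero_of_act_eq {S : Mat} (H : act S origin = origin) : LowerZero S := by
  rw [act_origin] at H
  have h0 : S.col 0 ∈ origin := by rw [← H]; exact Submodule.subset_span (by simp)
  have h1 : S.col 1 ∈ origin := by rw [← H]; exact Submodule.subset_span (by simp)
  rw [mem_origin] at h0 h1
  simp only [Matrix.col_apply] at h0 h1
  exact ⟨h0.1, h1.1, h0.2.1, h1.2.1, h0.2.2.1, h1.2.2.1, h0.2.2.2, h1.2.2.2⟩

/-- The transition matrix `A⁻¹ B` between two pseudo-orthogonal frames. -/
def trans (A B : ℝ → Mat) (t : ℝ) : Mat := h * (A t)ᵀ * h * B t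

theorem mul_trans {A B : ℝ → Mat} {t : ℝ} (hA : A t ∈ Oh) : A t * trans A B t = B t := by
  rw [trans, ← mul_assoc, Oh.mul_inv hA, one_mul]

theorem trans_mem {A B : ℝ → Mat} {t : ℝ} (hA : A t ∈ Oh) (hB : B t ∈ Oh) :
    trans A B t ∈ Oh := Oh.mul (Oh.inv hA) hB

variable {γ : ℝ → Lam} {I I' : Set ℝ} {A B : ℝ → Mat} {t : ℝ}

theorem IsFrame.lowerZero (HA : IsFrame γ I A) (HB : IsFrame γ I' B) (ht : t ∈ I) (ht' : t ∈ I') :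
    LowerZero (trans A B t) := by
  apply lowerZero_of_act_eq
  apply act_inj (HA.mem_Oh ht)
  rw [← act_mul, mul_trans (HA.mem_Oh ht), ← HB.proj t ht', HA.proj t ht]

/-- This is the gauge law `S' = SΨ - ΘS` for `S = A⁻¹B`. The rigidity statements below come from
reading it at entries where `S` is identically zero or satisfies a fixed relation. -/
theorem IsFrame.mderiv_trans (HA : IsFrame γ I A) (HB : IsFrame γ I' B) (ht : t ∈ I)
    (ht' : t ∈ I') :
    MDeriv (trans A B) (trans A B t * theta B t - theta A t * trans A B t) t := by
  have h1 := (((MDeriv.const h t).mul (HA.mderiv ht).transpose).mul (MDeriv.const h t)).mul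
    (HB.mderiv ht')
  have h2 : (theta A t)ᵀ * h = - (h * theta A t) := eq_neg_of_add_eq_zero_left (HA.theta_mem ht)
  suffices e : trans A B t * theta B t - theta A t * trans A B t =
      ((0 * (A t)ᵀ + h * (A t * theta A t)ᵀ) * h + h * (A t)ᵀ * 0) * B t +
        h * (A t)ᵀ * h * (B t * theta B t) by rw [e]; exact h1
  simp only [Matrix.transpose_mul, zero_mul, zero_add, mul_zero, add_zero, trans]
  calc h * (A t)ᵀ * h * B t * theta B t - theta A t * (h * (A t)ᵀ * h * B t)
      = - ((h * h) * theta A t * h * (A t)ᵀ * h * B t) + h * (A t)ᵀ * h * (B t * theta B t) := by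
        rw [h_mul_h]; noncomm_ring
    _ = - (h * (h * theta A t) * (h * (A t)ᵀ * h * B t)) + h * (A t)ᵀ * h * (B t * theta B t) := by
        noncomm_ring
    _ = h * ((theta A t)ᵀ * h) * (h * (A t)ᵀ * h * B t) + h * (A t)ᵀ * h * (B t * theta B t) := by
        rw [h2]; noncomm_ring
    _ = h * (theta A t)ᵀ * (h * h) * (A t)ᵀ * h * B t + h * (A t)ᵀ * h * (B t * theta B t) := by
        noncomm_ring
    _ = _ := by rw [h_mul_h]; noncomm_ring

theorem eventually_mem_inter (HA : IsOpen I) (HB : IsOpen I') (ht : t ∈ I) (ht' : t ∈ I') :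
    ∀ᶠ s in 𝓝 t, s ∈ I ∧ s ∈ I' :=
  Filter.Eventually.and (HA.mem_nhds ht) (HB.mem_nhds ht')

theorem MDeriv.eq_zero {S : ℝ → Mat} {T : Mat} (H : MDeriv S T t) {i j : Fin 6}
    (h0 : ∀ᶠ s in 𝓝 t, S s i j = 0) : T i j = 0 :=
  (H i j).unique ((hasDerivAt_const t (0 : ℝ)).congr_of_eventuallyEq h0)

/-- Consequences of pseudo-orthogonality for a matrix with vanishing lower left block. -/
theorem Oh.block {S : Mat} (hS : S ∈ Oh) (hl : LowerZero S) :
    (S 0 0 * S 5 4 + S 1 0 * S 4 4 = 0 ∧ S 0 1 * S 5 4 + S 1 1 * S 4 4 = 1 ∧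
    S 0 0 * S 5 5 + S 1 0 * S 4 5 = 1 ∧ S 0 1 * S 5 5 + S 1 1 * S 4 5 = 0) ∧
    (S 4 2 = 0 ∧ S 4 3 = 0 ∧ S 5 2 = 0 ∧ S 5 3 = 0) ∧
    (S 2 2 ^ 2 + S 3 2 ^ 2 = 1 ∧ S 2 2 * S 2 3 + S 3 2 * S 3 3 = 0 ∧
      S 2 3 ^ 2 + S 3 3 ^ 2 = 1) := by
  obtain ⟨l20, l21, l30, l31, l40, l41, l50, l51⟩ := hl
  have H := form_col hS
  simp only [form_eq, Matrix.col_apply] at H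
  have h04 := H 0 4
  have h14 := H 1 4
  have h05 := H 0 5
  have h15 := H 1 5
  have h02 := H 0 2
  have h12 := H 1 2
  have h03 := H 0 3
  have h13 := H 1 3
  simp only [l20, l21, l30, l31, l40, l41, l50, l51, h] at h04 h14 h05 h15 h02 h12 h03 h13
  simp at h04 h14 h05 h15 h02 h12 h03 h13
  have a1 : S 0 0 * S 5 4 + S 1 0 * S 4 4 = 0 := by linarith
  have a2 : S 0 1 * S 5 4 + S 1 1 * S 4 4 = 1 := by linarith
  have a3 : S 0 0 * S 5 5 + S 1 0 * S 4 5 = 1 := by linarith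
  have a4 : S 0 1 * S 5 5 + S 1 1 * S 4 5 = 0 := by linarith
  -- Up to reordering, the lower right block is inverse transpose to the upper left one, so the
  -- determinants are reciprocal. Invertibility of the upper left block then forces the middle
  -- entries of the last two rows to vanish, by Cramer's rule.
  have d : (S 0 0 * S 1 1 - S 0 1 * S 1 0) * (S 5 5 * S 4 4 - S 5 4 * S 4 5) = 1 := by
    linear_combination (S 1 1 * S 4 4 + S 0 1 * S 5 4) * a3 + a2 -
      (S 0 1 * S 5 5 + S 1 1 * S 4 5) * a1
  have d0 : S 0 0 * S 1 1 - S 0 1 * S 1 0 ≠ 0 := left_ne_zero_of_mul_eq_one d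
  have b1 : S 4 2 = 0 := mul_left_cancel₀ d0 (by linear_combination S 0 1 * h02 - S 0 0 * h12)
  have b2 : S 4 3 = 0 := mul_left_cancel₀ d0 (by linear_combination S 0 1 * h03 - S 0 0 * h13)
  have b3 : S 5 2 = 0 := mul_left_cancel₀ d0 (by linear_combination S 1 0 * h12 - S 1 1 * h02)
  have b4 : S 5 3 = 0 := mul_left_cancel₀ d0 (by linear_combination S 1 0 * h13 - S 1 1 * h03)
  have h22 := H 2 2
  have h23 := H 2 3
  have h33 := H 3 3
  simp only [b1, b2, b3, b4, h] at h22 h23 h33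
  simp at h22 h23 h33
  exact ⟨⟨a1, a2, a3, a4⟩, ⟨b1, b2, b3, b4⟩, by linarith, by linarith, by linarith⟩

theorem tangent_entries (S Θ Ψ : Mat) (i j : Fin 6) : (S * Ψ - Θ * S) i j =
    S i 0 * Ψ 0 j + S i 1 * Ψ 1 j + S i 2 * Ψ 2 j + S i 3 * Ψ 3 j + S i 4 * Ψ 4 j + S i 5 * Ψ 5 j -
    (Θ i 0 * S 0 j + Θ i 1 * S 1 j + Θ i 2 * S 2 j + Θ i 3 * S 3 j + Θ i 4 * S 4 j +
      Θ i 5 * S 5 j) := by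
  simp only [Matrix.sub_apply, Matrix.mul_apply, Fin.sum_univ_six]

/-- The last two rows of the vanishing block of `SΨ - ΘS` retain only the contact components, and so
tie the upper left block of `S` to the lower right one. -/
theorem block_contact {S Θ Ψ : Mat} (hS : S ∈ Oh) (hl : LowerZero S) (hΘ : Θ ∈ lieAlg)
    (hΨ : Ψ ∈ lieAlg) (hT : LowerZero (S * Ψ - Θ * S)) :
    S 4 4 * Ψ 4 0 = Θ 4 0 * S 0 0 ∧ S 4 5 * Ψ 4 0 = - (Θ 4 0 * S 0 1) ∧
    S 5 4 * Ψ 4 0 = - (Θ 4 0 * S 1 0) ∧ S 5 5 * Ψ 4 0 = Θ 4 0 * S 1 1 := by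
  obtain ⟨-, ⟨b1, b2, b3, b4⟩, -⟩ := Oh.block hS hl
  obtain ⟨l20, l21, l30, l31, l40, l41, l50, l51⟩ := hl
  obtain ⟨-, -, -, -, t40, t41, t50, t51⟩ := hT
  obtain ⟨x50, x41, -, -, -, -, x51, -⟩ := lieAlg_entries hΘ
  obtain ⟨y50, y41, -, -, -, -, y51, -⟩ := lieAlg_entries hΨ
  rw [tangent_entries] at t40 t41 t50 t51
  simp only [b1, b2, b3, b4, l20, l21, l30, l31, l40, l41, l50, l51, x50, x41, x51, y50, y41,
    y51] at t40 t41 t50 t51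
  exact ⟨by linarith, by linarith, by linarith, by linarith⟩

theorem LowerZero.tangent {S : ℝ → Mat} {T : Mat} (H : MDeriv S T t)
    (h0 : ∀ᶠ s in 𝓝 t, LowerZero (S s)) : LowerZero T :=
  ⟨H.eq_zero (h0.mono fun _ h => h.1), H.eq_zero (h0.mono fun _ h => h.2.1),
    H.eq_zero (h0.mono fun _ h => h.2.2.1), H.eq_zero (h0.mono fun _ h => h.2.2.2.1),
    H.eq_zero (h0.mono fun _ h => h.2.2.2.2.1), H.eq_zero (h0.mono fun _ h => h.2.2.2.2.2.1),
    H.eq_zero (h0.mono fun _ h => h.2.2.2.2.2.2.1), H.eq_zero (h0.mono fun _ h => h.2.2.2.2.2.2.2)⟩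

theorem IsFrame.lowerZero_tangent (HA : IsFrame γ I A) (HB : IsFrame γ I' B) (ht : t ∈ I)
    (ht' : t ∈ I') :
    LowerZero (trans A B t * theta B t - theta A t * trans A B t) :=
  LowerZero.tangent (HA.mderiv_trans HB ht ht')
    ((eventually_mem_inter HA.isOpen HB.isOpen ht ht').mono fun _ hs => HA.lowerZero HB hs.1 hs.2)

/-- Transversality does not depend on the frame field. -/
theorem IsFrame.transversal_of (HA : IsFrame γ I A) (HB : IsFrame γ I' B) (ht : t ∈ I)
    (ht' : t ∈ I') (h0 : theta A t 4 0 ≠ 0) : theta B t 4 0 ≠ 0 := by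
  intro hB
  have hS := trans_mem (HA.mem_Oh ht) (HB.mem_Oh ht')
  have hl := HA.lowerZero HB ht ht'
  have h1 := block_contact hS hl (HA.theta_mem ht)
    (HB.theta_mem ht') (HA.lowerZero_tangent HB ht ht')
  rw [hB] at h1
  obtain ⟨⟨-, -, a3, -⟩, -⟩ := Oh.block hS hl
  have e1 : trans A B t 0 0 = 0 := mul_left_cancel₀ h0 (by linarith [h1.1])
  have e2 : trans A B t 1 0 = 0 := mul_left_cancel₀ h0 (by linarith [h1.2.2.1])
  rw [e1, e2] at a3
  simp at a3

/-- The vanishing of the middle right block. -/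
def MidZero (S : Mat) : Prop := S 2 4 = 0 ∧ S 2 5 = 0 ∧ S 3 4 = 0 ∧ S 3 5 = 0

/-- In the two middle rows and first two columns, the first order conditions reduce `SΨ - ΘS` to
single entries of `S` times `± Ψ 4 0`, which is nonzero. -/
theorem IsFirstOrder.midZero (HA : IsFirstOrder γ I A) (HB : IsFirstOrder γ I' B) (ht : t ∈ I)
    (ht' : t ∈ I') : MidZero (trans A B t) := by
  have hS := trans_mem (HA.mem_Oh ht) (HB.mem_Oh ht')
  have hl := HA.toIsFrame.lowerZero HB.toIsFrame ht ht'
  have hT := HA.toIsFrame.lowerZero_tangent HB.toIsFrame ht ht'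
  obtain ⟨l20, l21, l30, l31, l40, l41, l50, l51⟩ := hl
  obtain ⟨t20, t21, t30, t31, -⟩ := hT
  obtain ⟨x50, x41, -, -, -, -, x51, -⟩ := lieAlg_entries (HA.theta_mem ht)
  obtain ⟨y50, y41, -, -, -, -, y51, -⟩ := lieAlg_entries (HB.theta_mem ht')
  obtain ⟨p1, p2, p3, p4⟩ := HA.zero t ht
  obtain ⟨q1, q2, q3, q4⟩ := HB.zero t ht'
  have hp := (HB.pos t ht').ne'
  rw [tangent_entries] at t20 t21 t30 t31
  simp only [l20, l21, l30, l31, l40, l41, l50, l51, x50, x41, x51, y50, y41, y51, p1, p2, p3, p4,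
    q1, q2, q3, q4] at t20 t21 t30 t31
  exact ⟨mul_right_cancel₀ hp (by linarith), mul_right_cancel₀ hp (by linarith),
    mul_right_cancel₀ hp (by linarith), mul_right_cancel₀ hp (by linarith)⟩

/-- `S` is block upper triangular with rotations on the diagonal. -/
structure IsRot (S : Mat) (c s : ℝ) : Prop where
  sq : c ^ 2 + s ^ 2 = 1
  s00 : S 0 0 = c
  s01 : S 0 1 = s
  s10 : S 1 0 = -s
  s11 : S 1 1 = c
  s22 : S 2 2 = c
  s23 : S 2 3 = -s
  s32 : S 3 2 = s
  s33 : S 3 3 = c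
  s44 : S 4 4 = c
  s45 : S 4 5 = -s
  s54 : S 5 4 = s
  s55 : S 5 5 = c
  s02 : S 0 2 = 0
  s03 : S 0 3 = 0
  s12 : S 1 2 = 0
  s13 : S 1 3 = 0

/-- Put `ψ = ρθ`. The lower right entries are `ρ` times, and the upper left ones up to sign `ρ²`
times, entries of the orthogonal block `(a, b; c, d)`. The duality `a3` becomes `ρ³ (ad - bc) = 1`
with `ad - bc = ±1`. Positivity of `ρ` forces `ρ = 1` and a proper rotation; this is why arclength
is well defined. -/
theorem rotation_aux {θ ψ a b c d s00 s01 s10 s11 s44 s45 s54 s55 : ℝ} (hθ : 0 < θ) (hψ : 0 < ψ)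
    (c1 : s44 * ψ = θ * s00) (c2 : s45 * ψ = -(θ * s01)) (c3 : s54 * ψ = -(θ * s10))
    (c4 : s55 * ψ = θ * s11) (e1 : a * ψ = θ * s44) (e2 : b * ψ = θ * s45) (e3 : c * ψ = θ * s54)
    (e4 : d * ψ = θ * s55) (a3 : s00 * s55 + s10 * s45 = 1) (r1 : a ^ 2 + c ^ 2 = 1)
    (r2 : a * b + c * d = 0) (r3 : b ^ 2 + d ^ 2 = 1) :
    θ = ψ ∧ d = a ∧ b = -c ∧ s44 = a ∧ s45 = -c ∧ s54 = c ∧ s55 = a ∧ s00 = a ∧ s01 = c ∧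
      s10 = -c ∧ s11 = a := by
  have hθ0 := hθ.ne'
  obtain ⟨ρ, rfl⟩ : ∃ ρ, ψ = ρ * θ := ⟨ψ / θ, by field_simp⟩
  have hρ : 0 < ρ := pos_of_mul_pos_left hψ hθ.le
  obtain rfl : s44 = ρ * a := mul_left_cancel₀ hθ0 (by linarith)
  obtain rfl : s45 = ρ * b := mul_left_cancel₀ hθ0 (by linarith)
  obtain rfl : s54 = ρ * c := mul_left_cancel₀ hθ0 (by linarith)
  obtain rfl : s55 = ρ * d := mul_left_cancel₀ hθ0 (by linarith)
  obtain rfl : s00 = ρ ^ 2 * a := mul_left_cancel₀ hθ0 (by linarith)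
  obtain rfl : s01 = -(ρ ^ 2 * b) := mul_left_cancel₀ hθ0 (by linarith)
  obtain rfl : s10 = -(ρ ^ 2 * c) := mul_left_cancel₀ hθ0 (by linarith)
  obtain rfl : s11 = ρ ^ 2 * d := mul_left_cancel₀ hθ0 (by linarith)
  have key : ρ ^ 3 * (a * d - c * b) = 1 := by linarith
  have dd : (a * d - c * b) ^ 2 = 1 := by
    linear_combination (b ^ 2 + d ^ 2) * r1 + r3 - (a * b + c * d) * r2
  have hρ3 : 0 < ρ ^ 3 := by positivity
  have d1 : a * d - c * b = 1 := by
    rcases (sq_eq_one_iff.1 dd) with h | h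
    · exact h
    · rw [h] at key; linarith
  rw [d1, mul_one] at key
  obtain rfl : ρ = 1 := (pow_eq_one_iff_of_nonneg hρ.le (by norm_num)).1 key
  obtain rfl : d = a := by linear_combination - d * r1 + a * d1 + c * r2
  obtain rfl : b = -c := by linear_combination - b * r1 - c * d1 + d * r2
  simp

/-- Orthogonality leaves one parameter in the upper right block, namely `r (c, -s; -s, -c)`.
Contracting the gauge law with the rotation cancels both traces and leaves `ψ r = 0`. Once `r = 0`,
the gauge law rotates the symmetric traceless part of the upper left block of `θ` through twice the
angle. -/
theorem third_order_aux {c s ψ x00 x01 x10 x11 y00 y01 y10 y11 s04 s05 s14 s15 t00 t01 t10 t11 : ℝ}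
    (hψ : ψ ≠ 0) (hsq : c ^ 2 + s ^ 2 = 1) (h44 : s04 * s + s14 * c = 0)
    (h55 : s05 * c - s15 * s = 0) (h45 : s04 * c + s * s05 - s14 * s + c * s15 = 0)
    (hx : x00 + x11 = 0) (hy : y00 + y11 = 0)
    (e00 : t00 = c * y00 + s * y10 + s04 * ψ - (x00 * c - x01 * s))
    (e01 : t01 = c * y01 + s * y11 - s05 * ψ - (x00 * s + x01 * c))
    (e10 : t10 = -s * y00 + c * y10 + s14 * ψ - (x10 * c - x11 * s))
    (e11 : t11 = -s * y01 + c * y11 - s15 * ψ - (x10 * s + x11 * c))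
    (e1 : t11 = t00) (e2 : t10 = -t01) (e3 : c * t00 + s * t01 = 0) :
    (s04 = 0 ∧ s05 = 0 ∧ s14 = 0 ∧ s15 = 0) ∧
    y11 = (c ^ 2 - s ^ 2) * x11 + c * s * (x01 + x10) ∧
    y01 + y10 = (c ^ 2 - s ^ 2) * (x01 + x10) - 4 * c * s * x11 := by
  obtain ⟨r, hr⟩ : ∃ r, r = c * s04 - s * s14 := ⟨_, rfl⟩
  have k04 : s04 = r * c := by rw [hr]; linear_combination - s04 * hsq + s * h44
  have k14 : s14 = - r * s := by rw [hr]; linear_combination - s14 * hsq + c * h44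
  have k05 : s05 = - r * s := by rw [hr]; linear_combination - s05 * hsq + s * h45 + c * h55
  have k15 : s15 = - r * c := by rw [hr]; linear_combination - s15 * hsq + c * h45 - s * h55
  have E : c * t00 - s * t10 + s * t01 + c * t11 =
      ψ * (c * s04 - s * s14 - s * s05 - c * s15) := by
    rw [e00, e01, e10, e11]
    linear_combination (c ^ 2 + s ^ 2) * hy - (c ^ 2 + s ^ 2) * hx
  have E2 : c * s04 - s * s14 - s * s05 - c * s15 = 2 * r := by
    rw [k04, k14, k05, k15]; linear_combination 2 * r * hsq
  have E3 : ψ * r = 0 := by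
    rw [E2, e1, e2] at E; linear_combination e3 - E / 2
  have r0 : r = 0 := by simpa [hψ] using E3
  subst r0
  simp only [neg_zero, zero_mul] at k04 k05 k14 k15
  subst k04 k05 k14 k15
  refine ⟨⟨rfl, rfl, rfl, rfl⟩, ?_, ?_⟩
  · linear_combination - y11 * hsq + e3 - s * e01 - c * e11 + c * e1 + s ^ 2 * hx
  · linear_combination - (y01 + y10) * hsq - c * e01 + s * e11 - s * e00 - c * e10 - s * e1 +
      c * e2 + 2 * c * s * hx

/-- The zero block found in `IsFirstOrder.midZero` is differentiated once more. With `P = I₂` in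
both frames this links the middle block of `S` to the lower right one, which is the input of
`rotation_aux`; the remaining zeros follow from orthogonality of the columns. -/
theorem IsSecondOrder.isRot (HA : IsSecondOrder γ I A) (HB : IsSecondOrder γ I' B) (ht : t ∈ I)
    (ht' : t ∈ I') : theta A t 4 0 = theta B t 4 0 ∧
      IsRot (trans A B t) (trans A B t 0 0) (trans A B t 0 1) := by
  have hS := trans_mem (HA.mem_Oh ht) (HB.mem_Oh ht')
  have hl := HA.toIsFrame.lowerZero HB.toIsFrame ht ht'
  have hc := block_contact hS hl (HA.theta_mem ht)
    (HB.theta_mem ht') (HA.toIsFrame.lowerZero_tangent HB.toIsFrame ht ht')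
  have hm : ∀ᶠ s in 𝓝 t, MidZero (trans A B s) :=
    (eventually_mem_inter HA.isOpen HB.isOpen ht ht').mono fun _ hs =>
      HA.toIsFirstOrder.midZero HB.toIsFirstOrder hs.1 hs.2
  have hd := HA.toIsFrame.mderiv_trans HB.toIsFrame ht ht'
  have t24 := hd.eq_zero (hm.mono fun _ h => h.1)
  have t25 := hd.eq_zero (hm.mono fun _ h => h.2.1)
  have t34 := hd.eq_zero (hm.mono fun _ h => h.2.2.1)
  have t35 := hd.eq_zero (hm.mono fun _ h => h.2.2.2)
  obtain ⟨m1, m2, m3, m4⟩ := hm.self_of_nhds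
  obtain ⟨⟨a1, a2, a3, a4⟩, ⟨b1, b2, b3, b4⟩, r1, r2, r3⟩ := Oh.block hS hl
  obtain ⟨l20, l21, l30, l31, l40, l41, l50, l51⟩ := hl
  obtain ⟨p1, p2, p3, p4⟩ := HA.zero t ht
  obtain ⟨e1, e2, e3, e4⟩ := HA.entries ht
  obtain ⟨f1, f2, f3, f4⟩ := HB.entries ht'
  have hθ := HA.pos t ht
  have hψ := HB.pos t ht'
  have H := form_col hS
  simp only [form_eq, Matrix.col_apply] at H
  have h24 := H 2 4
  have h25 := H 2 5
  have h34 := H 3 4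
  have h35 := H 3 5
  rw [tangent_entries] at t24 t25 t34 t35
  generalize trans A B t = S at *
  generalize theta A t = Θ at *
  generalize theta B t = Ψ at *
  simp only [l20, l21, l30, l31, l40, l41, l50, l51, p1, p2, p3, p4, m1, m2, m3, m4, e1, e2, e3, e4,
    f1, f2, f3, f4] at t24 t25 t34 t35
  obtain ⟨c1, c2, c3, c4⟩ := hc
  obtain ⟨k1, k2, k3, k4, k5, k6, k7, k8, k9, k10, k11⟩ := rotation_aux hθ hψ c1 c2 c3 c4
    (a := S 2 2) (b := S 2 3) (c := S 3 2) (d := S 3 3)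
    (by linarith) (by linarith) (by linarith) (by linarith) a3 r1 r2 r3
  simp only [k4, k5, k6, k7, b1, b2, b3, b4, m1, m2, m3, m4, h] at h24 h25 h34 h35
  simp at h24 h25 h34 h35
  have g02 : S 0 2 = 0 := by linear_combination - S 0 2 * r1 - S 3 2 * h24 - S 2 2 * h25
  have g12 : S 1 2 = 0 := by linear_combination - S 1 2 * r1 - S 2 2 * h24 + S 3 2 * h25
  have g03 : S 0 3 = 0 := by linear_combination - S 0 3 * r1 - S 3 2 * h34 - S 2 2 * h35
  have g13 : S 1 3 = 0 := by linear_combination - S 1 3 * r1 - S 2 2 * h34 + S 3 2 * h35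
  rw [k8, k9]
  exact ⟨k1, r1, k8, k9, k10, k11, rfl, k3, rfl, k2, k4, k5, k6, k7, g02, g03, g12, g13⟩

theorem IsSecondOrder.theta_eq (HA : IsSecondOrder γ I A) (HB : IsSecondOrder γ I' B) (ht : t ∈ I)
    (ht' : t ∈ I') : theta A t 4 0 = theta B t 4 0 := (HA.isRot HB ht ht').1

/-- The choice operator returns the value of some second order frame, and all of them agree. -/
theorem IsSecondOrder.lieSpeed_eq (HA : IsSecondOrder γ I A) (ht : t ∈ I) :
    lieSpeed γ t = theta A t 4 0 := by
  have h1 : ∃ ρ : ℝ, ∃ I A, t ∈ I ∧ IsSecondOrder γ I A ∧ ρ = theta A t 4 0 :=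
    ⟨_, I, A, ht, HA, rfl⟩
  obtain ⟨I', B, ht', HB, hB⟩ := Classical.epsilon_spec h1
  rw [lieSpeed, hB]
  exact HB.theta_eq HA ht' ht

/-- The transition is a rotation at all nearby points, so the relations `S₁₁ = S₀₀`, `S₁₀ = -S₀₁`
and `c² + s² = 1` may be differentiated; the results `e1`, `e2`, `e3` feed `third_order_aux`. -/
theorem IsThirdOrder.trans_eq (HA : IsThirdOrder γ I A) (HB : IsThirdOrder γ I' B) (ht : t ∈ I)
    (ht' : t ∈ I') :
    (trans A B t 0 4 = 0 ∧ trans A B t 0 5 = 0 ∧ trans A B t 1 4 = 0 ∧ trans A B t 1 5 = 0) ∧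
    theta B t 1 1 = (trans A B t 0 0 ^ 2 - trans A B t 0 1 ^ 2) * theta A t 1 1 +
      trans A B t 0 0 * trans A B t 0 1 * (theta A t 0 1 + theta A t 1 0) ∧
    theta B t 0 1 + theta B t 1 0 =
      (trans A B t 0 0 ^ 2 - trans A B t 0 1 ^ 2) * (theta A t 0 1 + theta A t 1 0) -
      4 * trans A B t 0 0 * trans A B t 0 1 * theta A t 1 1 := by
  have hS := trans_mem (HA.mem_Oh ht) (HB.mem_Oh ht')
  have hd := HA.toIsFrame.mderiv_trans HB.toIsFrame ht ht'
  have hm := HA.toIsFirstOrder.midZero HB.toIsFirstOrder ht ht'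
  have hr : ∀ᶠ s in 𝓝 t, IsRot (trans A B s) (trans A B s 0 0) (trans A B s 0 1) :=
    (eventually_mem_inter HA.isOpen HB.isOpen ht ht').mono fun _ hs =>
      (HA.toIsSecondOrder.isRot HB.toIsSecondOrder hs.1 hs.2).2
  have hθ := HA.theta_eq HB.toIsSecondOrder ht ht'
  have e1 : (trans A B t * theta B t - theta A t * trans A B t) 1 1 =
      (trans A B t * theta B t - theta A t * trans A B t) 0 0 :=
    (hd 1 1).unique ((hd 0 0).congr_of_eventuallyEq (hr.mono fun s hs => hs.s11))
  have e2 : (trans A B t * theta B t - theta A t * trans A B t) 1 0 =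
      - (trans A B t * theta B t - theta A t * trans A B t) 0 1 :=
    (hd 1 0).unique ((hd 0 1).neg.congr_of_eventuallyEq (hr.mono fun s hs => hs.s10))
  have e3 : trans A B t 0 0 * (trans A B t * theta B t - theta A t * trans A B t) 0 0 +
      trans A B t 0 1 * (trans A B t * theta B t - theta A t * trans A B t) 0 1 = 0 := by
    have h1 := (((hd 0 0).pow 2).add ((hd 0 1).pow 2)).unique
      ((hasDerivAt_const t (1 : ℝ)).congr_of_eventuallyEq (hr.mono fun s hs => hs.sq))
    simp only [Nat.cast_ofNat, Nat.add_one_sub_one, pow_one] at h1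
    linarith
  have hr := hr.self_of_nhds
  obtain ⟨⟨a1, a2, a3, a4⟩, ⟨b1, b2, b3, b4⟩, -⟩ :=
    Oh.block hS (HA.toIsFrame.lowerZero HB.toIsFrame ht ht')
  obtain ⟨l20, l21, l30, l31, l40, l41, l50, l51⟩ := HA.toIsFrame.lowerZero HB.toIsFrame ht ht'
  obtain ⟨m1, m2, m3, m4⟩ := hm
  obtain ⟨p1, p2, p3, p4⟩ := HA.zero t ht
  obtain ⟨q1, q2, q3, q4⟩ := HB.zero t ht'
  obtain ⟨x50, x41, -, -, -, -, x51, -⟩ := lieAlg_entries (HA.theta_mem ht)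
  obtain ⟨y50, y41, -, -, -, -, y51, -⟩ := lieAlg_entries (HB.theta_mem ht')
  have trA := HA.trace_zero t ht
  have trB := HB.trace_zero t ht'
  have hψ := (HB.pos t ht').ne'
  have H := form_col hS
  simp only [form_eq, Matrix.col_apply] at H
  have h44 := H 4 4
  have h45 := H 4 5
  have h55 := H 5 5
  have t00 := tangent_entries (trans A B t) (theta A t) (theta B t) 0 0
  have t01 := tangent_entries (trans A B t) (theta A t) (theta B t) 0 1
  have t10 := tangent_entries (trans A B t) (theta A t) (theta B t) 1 0
  have t11 := tangent_entries (trans A B t) (theta A t) (theta B t) 1 1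
  generalize (trans A B t * theta B t - theta A t * trans A B t) = T at *
  generalize trans A B t = S at *
  generalize theta A t = Θ at *
  generalize theta B t = Ψ at *
  obtain ⟨hsq, s00, s01, s10, s11, s22, s23, s32, s33, s44, s45, s54, s55, s02, s03, s12, s13⟩ := hr
  simp only [s10, s11, s44, s45, s54, s55, m1, m2, m3, m4, h] at h44 h45 h55
  simp at h44 h45 h55
  simp only [s10, s11, s02, s03, s12, s13, l20, l21, l30, l31, l40, l41, l50, l51,
    y50, y41, y51, q1, q2, q3, q4] at t00 t01 t10 t11
  exact third_order_aux (t00 := T 0 0) (t01 := T 0 1) (t10 := T 1 0) (t11 := T 1 1) hψ hsq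
    (by linarith) (by linarith) (by linarith) trA trB (by rw [t00]; ring) (by rw [t01]; ring)
    (by rw [t10]; ring) (by rw [t11]; ring) e1 e2 e3

/-- The vector `(p, q)` is rotated through the double angle, so its length is invariant and
genericity can be tested in any third order frame. -/
theorem IsThirdOrder.coef_eq (HA : IsThirdOrder γ I A) (HB : IsThirdOrder γ I' B) (ht : t ∈ I)
    (ht' : t ∈ I') : coefP A t ^ 2 + coefQ A t ^ 2 = coefP B t ^ 2 + coefQ B t ^ 2 := by
  obtain ⟨-, h1, h2⟩ := HA.trans_eq HB ht ht'
  have hθ := HA.theta_eq HB.toIsSecondOrder ht ht'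
  have hsq := (HA.toIsSecondOrder.isRot HB.toIsSecondOrder ht ht').2.sq
  have h0 := (HB.pos t ht').ne'
  simp only [coefP, coefQ, hθ, h1, h2]
  generalize trans A B t 0 0 = c at *
  generalize trans A B t 0 1 = s at *
  field_simp
  linear_combination (- (c ^ 2 + s ^ 2) - 1) * ((theta A t 0 1 + theta A t 1 0) ^ 2 +
    2 ^ 2 * theta A t 1 1 ^ 2) * hsq

theorem IsFourthOrder.sum_zero (HA : IsFourthOrder γ I A) (ht : t ∈ I) :
    theta A t 0 1 + theta A t 1 0 = 0 := by
  have h1 := HA.p_zero t ht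
  have h0 := (HA.pos t ht).ne'
  simpa [coefP, h0] using h1

theorem eq_one_or_eq_neg_one_aux {c s : ℝ} (hcs : c * s = 0) (hd : 0 < c ^ 2 - s ^ 2)
    (hsq : c ^ 2 + s ^ 2 = 1) : s = 0 ∧ (c = 1 ∨ c = -1) := by
  have hs : s = 0 := by
    rcases mul_eq_zero.1 hcs with h0 | h0
    · rw [h0] at hd; nlinarith [sq_nonneg s]
    · exact h0
  refine ⟨hs, sq_eq_one_iff.1 ?_⟩
  simpa [hs] using hsq

/-- With `p = 0` on both sides and `q ≠ 0`, the double angle has sine zero. The sign hypothesis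
makes its cosine positive, which excludes the quarter turns that reverse the sign of `κ₁`. -/
theorem IsFourthOrder.trans_eq_one (HA : IsFourthOrder γ I A) (HB : IsFourthOrder γ I' B)
    (ht : t ∈ I) (ht' : t ∈ I') (hpos : 0 < theta A t 0 0 * theta B t 0 0) :
    trans A B t = 1 ∨ trans A B t = -1 := by
  obtain ⟨⟨r1, r2, r3, r4⟩, h1, h2⟩ := HA.toIsThirdOrder.trans_eq HB.toIsThirdOrder ht ht'
  have hr := (HA.toIsSecondOrder.isRot HB.toIsSecondOrder ht ht').2
  have hm := HA.toIsFirstOrder.midZero HB.toIsFirstOrder ht ht'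
  have hl := HA.toIsFrame.lowerZero HB.toIsFrame ht ht'
  obtain ⟨-, ⟨b1, b2, b3, b4⟩, -⟩ := Oh.block (trans_mem (HA.mem_Oh ht) (HB.mem_Oh ht')) hl
  rw [HA.sum_zero ht] at h1 h2
  rw [HB.sum_zero ht'] at h2
  have hA := HA.trace_zero t ht
  have hB := HB.trace_zero t ht'
  generalize trans A B t = S at *
  obtain ⟨l20, l21, l30, l31, l40, l41, l50, l51⟩ := hl
  obtain ⟨m1, m2, m3, m4⟩ := hm
  obtain ⟨hsq, s00, s01, s10, s11, s22, s23, s32, s33, s44, s45, s54, s55, s02, s03, s12, s13⟩ := hr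
  have ha : theta A t 0 0 = - theta A t 1 1 := by linarith
  have hb : theta B t 0 0 = - theta B t 1 1 := by linarith
  have hne : theta A t 1 1 ≠ 0 := by rintro h0; rw [ha, h0] at hpos; simp at hpos
  have hp2 : 0 < theta A t 1 1 ^ 2 := by positivity
  have hcs : S 0 0 * S 0 1 = 0 := by
    have : 4 * S 0 0 * S 0 1 * theta A t 1 1 = 0 := by linarith
    simpa [hne] using this
  have hpos' : 0 < (S 0 0 ^ 2 - S 0 1 ^ 2) * theta A t 1 1 ^ 2 := by
    rw [ha, hb, h1] at hpos; linarith
  have hd : 0 < S 0 0 ^ 2 - S 0 1 ^ 2 := pos_of_mul_pos_left hpos' hp2.le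
  obtain ⟨hs0, hc⟩ := eq_one_or_eq_neg_one_aux hcs hd hsq
  rcases hc with hc | hc
  all_goals
    simp only [hc, hs0, neg_zero] at s10 s11 s22 s23 s32 s33 s44 s45 s54 s55
  · left
    ext i j
    fin_cases i <;> fin_cases j <;> simp [hc, hs0, s10, s11, s22, s23, s32, s33, s44, s45, s54, s55,
      s02, s03, s12, s13, l20, l21, l30, l31, l40, l41, l50, l51, m1, m2, m3, m4, b1, b2, b3, b4, r1,
      r2, r3, r4]
  · right
    ext i j
    fin_cases i <;> fin_cases j <;> simp [hc, hs0, s10, s11, s22, s23, s32, s33, s44, s45, s54, s55,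
      s02, s03, s12, s13, l20, l21, l30, l31, l40, l41, l50, l51, m1, m2, m3, m4, b1, b2, b3, b4, r1,
      r2, r3, r4]

theorem IsFourthOrder.eq_or_neg (HA : IsFourthOrder γ I A) (HB : IsFourthOrder γ I' B)
    (ht : t ∈ I) (ht' : t ∈ I') (hpos : 0 < theta A t 0 0 * theta B t 0 0) :
    B t = A t ∨ B t = -A t := by
  rw [← mul_trans (A := A) (B := B) (HA.mem_Oh ht)]
  rcases HA.trans_eq_one HB ht ht' hpos with h | h <;> simp [h]

theorem IsFourthOrder.theta_eq (HA : IsFourthOrder γ I A) (HB : IsFourthOrder γ I' B)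
    (ht : t ∈ I) (ht' : t ∈ I') (hpos : 0 < theta A t 0 0 * theta B t 0 0) :
    theta B t = theta A t := by
  have hd := HA.toIsFrame.mderiv_trans HB.toIsFrame ht ht'
  have hev : ∀ᶠ s in 𝓝 t, s ∈ I ∧ s ∈ I' ∧ 0 < theta A s 0 0 * theta B s 0 0 := by
    have h1 := ((HA.toIsFrame.contDiffOn_theta 0 0).continuousOn.continuousAt
      (HA.isOpen.mem_nhds ht)).mul ((HB.toIsFrame.contDiffOn_theta 0 0).continuousOn.continuousAt
      (HB.isOpen.mem_nhds ht'))
    filter_upwards [eventually_mem_inter HA.isOpen HB.isOpen ht ht', h1.eventually (lt_mem_nhds hpos)]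
      with s hs hs' using ⟨hs.1, hs.2, hs'⟩
  have hone : ∀ᶠ s in 𝓝 t, trans A B s = 1 ∨ trans A B s = -1 :=
    hev.mono fun s hs => HA.trans_eq_one HB hs.1 hs.2.1 hs.2.2
  -- The sign of the transition need not be tracked: off-diagonal entries are zero, and the squares
  -- of the diagonal entries are constant, so `2 S S' = 0` there with `S = ±1`.
  have hT : trans A B t * theta B t - theta A t * trans A B t = 0 := by
    ext i j
    have h1 := ((hd i j).pow 2).unique
      ((hasDerivAt_const t (((1 : Mat) i j) ^ 2)).congr_of_eventuallyEq
        (hone.mono fun s hs => by rcases hs with h | h <;> simp [h]))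
    by_cases hij : i = j
    · subst hij
      rcases hone.self_of_nhds with h | h <;> rw [h] at h1 ⊢ <;> simpa using h1
    · refine hd.eq_zero (hone.mono fun s hs => ?_)
      rcases hs with h | h <;> simp [h, hij]
  rcases hone.self_of_nhds with h | h <;> rw [h] at hT
  · simpa [sub_eq_zero] using hT
  · have : theta A t - theta B t = 0 := by rw [← hT]; noncomm_ring
    exact (sub_eq_zero.1 this).symm

/-! ### Existence of fourth order frames and of Lie curvatures. -/

theorem act_origin_of_lowerZero {S : Mat} (hS : S ∈ Oh) (hl : LowerZero S) :
    act S origin = origin := by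
  obtain ⟨l20, l21, l30, l31, l40, l41, l50, l51⟩ := hl
  refine Submodule.eq_of_le_of_finrank_eq ?_ ?_
  · rw [act_origin, Submodule.span_le]
    rintro x (rfl | rfl)
    · exact mem_origin.2 ⟨l20, l30, l40, l50⟩
    · exact mem_origin.2 ⟨l21, l31, l41, l51⟩
  · exact (LinearEquiv.finrank_eq (Submodule.equivMapOfInjective S.mulVecLin
      (Matrix.mulVec_injective_iff_isUnit.2 (Oh.isUnit hS)) origin)).symm

theorem theta_mul {A n : ℝ → Mat} {A' n' : Mat} {t : ℝ} (hA : A t ∈ Oh) (hn : n t ∈ Oh)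
    (dA : MDeriv A A' t) (dn : MDeriv n n' t) :
    theta (fun s => A s * n s) t = h * (n t)ᵀ * h * (theta A t * n t + n') := by
  rw [theta_eq_of_mderiv ((mderiv_theta dA hA).mul dn) (Oh.mul hA hn), Matrix.transpose_mul]
  have h1 := Oh.inv_mul hA
  calc h * ((n t)ᵀ * (A t)ᵀ) * h * (A t * theta A t * n t + A t * n')
      = h * (n t)ᵀ * (1 * ((A t)ᵀ * h * A t)) * (theta A t * n t + n') := by noncomm_ring
    _ = h * (n t)ᵀ * h * (h * (A t)ᵀ * h * A t) * (theta A t * n t + n') := by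
        rw [← h_mul_h]; noncomm_ring
    _ = _ := by rw [h1, mul_one]

/-- The rotation in the stabilizer of the origin that preserves third order frames. -/
def rot (c s : ℝ) : Mat :=
  !![c, s, 0, 0, 0, 0;
     -s, c, 0, 0, 0, 0;
     0, 0, c, -s, 0, 0;
     0, 0, s, c, 0, 0;
     0, 0, 0, 0, c, -s;
     0, 0, 0, 0, s, c]

theorem rot_conj (c s : ℝ) : h * (rot c s)ᵀ * h = rot c (-s) := by
  ext i j
  fin_cases i <;> fin_cases j <;> simp [Matrix.mul_apply, Fin.sum_univ_six] <;> simp [h, rot]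

theorem rot_mem {c s : ℝ} (hcs : c ^ 2 + s ^ 2 = 1) : rot c s ∈ Oh := by
  have h1 : rot c (-s) * rot c s = 1 := by
    ext i j
    fin_cases i <;> fin_cases j <;> simp [Matrix.mul_apply, Fin.sum_univ_six] <;> simp [rot] <;>
      first | ring1 | linear_combination hcs
  change (rot c s)ᵀ * h * rot c s = h
  have h2 : h * ((rot c s)ᵀ * h * rot c s) = 1 := by
    rw [← mul_assoc, ← mul_assoc, rot_conj, h1]
  calc (rot c s)ᵀ * h * rot c s = h * h * ((rot c s)ᵀ * h * rot c s) := by rw [h_mul_h, one_mul]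
    _ = h := by rw [mul_assoc, h2, mul_one]

theorem rot_lowerZero (c s : ℝ) : LowerZero (rot c s) := by
  simp [LowerZero, rot]

theorem continuous_rot {X : Type*} [TopologicalSpace X] {c s : X → ℝ} (hc : Continuous c)
    (hs : Continuous s) (i j : Fin 6) : Continuous fun x => rot (c x) (s x) i j := by
  fin_cases i <;> fin_cases j <;> simp [rot] <;> fun_prop

theorem contDiffOn_rot {c s : ℝ → ℝ} {I : Set ℝ} (hc : ContDiffOn ℝ ∞ c I)
    (hs : ContDiffOn ℝ ∞ s I) (i j : Fin 6) : ContDiffOn ℝ ∞ (fun x => rot (c x) (s x) i j) I := by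
  fin_cases i <;> fin_cases j <;> simp [rot] <;> fun_prop

theorem mderiv_rot {c s : ℝ → ℝ} {c' s' t : ℝ} (hc : HasDerivAt c c' t) (hs : HasDerivAt s s' t) :
    MDeriv (fun x => rot (c x) (s x)) (rot c' s') t := by
  intro i j
  have h0 := hasDerivAt_const t (0 : ℝ)
  have hs' := hs.fun_neg
  fin_cases i <;> fin_cases j <;> simp [rot] <;> assumption

/-- The rotation is joined to the identity by letting its angle run to zero. -/
theorem mul_rot_mem_G {A : Mat} (hA : A ∈ G) {c s : ℝ} (hcs : c ^ 2 + s ^ 2 = 1) :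
    A * rot c s ∈ G := by
  obtain ⟨φ, rfl, rfl⟩ : ∃ φ, c = Real.cos φ ∧ s = Real.sin φ := by
    refine ⟨Complex.arg ⟨c, s⟩, ?_, ?_⟩
    · rw [Complex.cos_arg]
      · simp [Complex.norm_def, Complex.normSq_apply, ← sq, hcs]
      · intro h0; rw [Complex.ext_iff] at h0; simp at h0; rw [h0.1, h0.2] at hcs; simp at hcs
    · rw [Complex.sin_arg]
      simp [Complex.norm_def, Complex.normSq_apply, ← sq, hcs]
  have key := mem_G_of_continuousOn (K := Set.univ) (x := (0 : ℝ)) (y := φ) isPreconnected_univ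
    (f := fun τ => A * rot (Real.cos τ) (Real.sin τ)) ?_ ?_ trivial ?_ trivial
  · exact key
  · intro i j
    simp only [Matrix.mul_apply, Fin.sum_univ_six]
    have := fun i j => continuous_rot Real.continuous_cos Real.continuous_sin i j
    fun_prop
  · intro τ _
    exact Oh.mul (G_subset hA) (rot_mem (Real.cos_sq_add_sin_sq τ))
  · have : rot 1 0 = 1 := by
      ext i j
      fin_cases i <;> fin_cases j <;> simp [rot]
    simpa [this] using hA

theorem rot_entries {Θ : Mat} (hΘ : Θ ∈ lieAlg) {c s c' s' : ℝ} (hcs : c ^ 2 + s ^ 2 = 1)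
    (hcs' : c * c' + s * s' = 0)
    (h20 : Θ 2 0 = 0) (h21 : Θ 2 1 = 0) (h30 : Θ 3 0 = 0) (h31 : Θ 3 1 = 0)
    (h25 : Θ 2 5 = 0) (h34 : Θ 3 4 = 0) (h24 : Θ 2 4 = Θ 4 0) (h35 : Θ 3 5 = Θ 4 0)
    (htr : Θ 0 0 + Θ 1 1 = 0) {W : Mat} (hW : W = rot c (-s) * (Θ * rot c s + rot c' s')) :
    W 4 0 = Θ 4 0 ∧ W 2 0 = 0 ∧ W 2 1 = 0 ∧ W 3 0 = 0 ∧ W 3 1 = 0 ∧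
    W 2 4 = Θ 4 0 ∧ W 2 5 = 0 ∧ W 3 4 = 0 ∧ W 3 5 = Θ 4 0 ∧ W 0 0 + W 1 1 = 0 ∧
    W 0 1 + W 1 0 = (c ^ 2 - s ^ 2) * (Θ 0 1 + Θ 1 0) - 4 * c * s * Θ 1 1 ∧
    W 1 1 = (c ^ 2 - s ^ 2) * Θ 1 1 + c * s * (Θ 0 1 + Θ 1 0) := by
  obtain ⟨x50, x41, -, -, -, -, x51, -⟩ := lieAlg_entries hΘ
  have h00 : Θ 0 0 = - Θ 1 1 := by linarith
  subst hW
  refine ⟨?_, ?_, ?_, ?_, ?_, ?_, ?_, ?_, ?_, ?_, ?_, ?_⟩ <;>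
  simp only [Matrix.mul_apply, Fin.sum_univ_six, Matrix.add_apply] <;>
  simp [rot, h20, h21, h30, h31, h25, h34, h24, h35, x50, x41, x51, h00]
  · linear_combination Θ 4 0 * hcs
  · linear_combination Θ 4 0 * hcs
  · ring
  · ring
  · linear_combination Θ 4 0 * hcs
  · linear_combination 2 * hcs'
  · ring
  · linear_combination hcs'

theorem IsThirdOrder.rotate {γ : ℝ → Lam} {I I' : Set ℝ} {A : ℝ → Mat} (HA : IsThirdOrder γ I A)
    (hI' : IsOpen I') (hsub : I' ⊆ I) {c s : ℝ → ℝ} (hc : ContDiffOn ℝ ∞ c I')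
    (hs : ContDiffOn ℝ ∞ s I') (hcs : ∀ t ∈ I', c t ^ 2 + s t ^ 2 = 1)
    (h0 : ∀ t ∈ I', (c t ^ 2 - s t ^ 2) * coefP A t - 2 * c t * s t * coefQ A t = 0) :
    IsFourthOrder γ I' (fun t => A t * rot (c t) (s t)) ∧ ∀ t ∈ I',
      theta (fun t => A t * rot (c t) (s t)) t 1 1 =
        ((c t ^ 2 - s t ^ 2) * coefQ A t + 2 * c t * s t * coefP A t) * theta A t 4 0 := by
  have E : ∀ t ∈ I', ∀ W, W = theta (fun t => A t * rot (c t) (s t)) t →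
      W 4 0 = theta A t 4 0 ∧ W 2 0 = 0 ∧ W 2 1 = 0 ∧ W 3 0 = 0 ∧ W 3 1 = 0 ∧
      W 2 4 = theta A t 4 0 ∧ W 2 5 = 0 ∧ W 3 4 = 0 ∧ W 3 5 = theta A t 4 0 ∧
      W 0 0 + W 1 1 = 0 ∧
      W 0 1 + W 1 0 = (c t ^ 2 - s t ^ 2) * (theta A t 0 1 + theta A t 1 0) -
        4 * c t * s t * theta A t 1 1 ∧
      W 1 1 = (c t ^ 2 - s t ^ 2) * theta A t 1 1 +
        c t * s t * (theta A t 0 1 + theta A t 1 0) := fun t ht W hW => by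
    have hci := ((hc.contDiffAt (hI'.mem_nhds ht)).differentiableAt (by simp)).hasDerivAt
    have hsi := ((hs.contDiffAt (hI'.mem_nhds ht)).differentiableAt (by simp)).hasDerivAt
    have hz := ((hci.pow 2).add (hsi.pow 2)).unique
      ((hasDerivAt_const t (1 : ℝ)).congr_of_eventuallyEq
        (Filter.Eventually.mono (hI'.mem_nhds ht) fun x hx => hcs x hx))
    have hth := theta_mul (n := fun t => rot (c t) (s t)) (HA.mem_Oh (hsub ht))
      (rot_mem (hcs t ht)) (HA.mderiv (hsub ht))
      (mderiv_rot hci hsi)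
    rw [rot_conj] at hth
    obtain ⟨z1, z2, z3, z4⟩ := HA.zero t (hsub ht)
    obtain ⟨f1, f2, f3, f4⟩ := HA.entries (hsub ht)
    refine rot_entries (HA.theta_mem (hsub ht)) (hcs t ht) ?_ z1 z2 z3 z4 f2 f3 f1 f4
      (HA.trace_zero t (hsub ht)) (hW.trans hth)
    simp at hz
    linarith
  refine ⟨⟨⟨⟨⟨⟨hI', ?_, ?_, ?_⟩, ?_, ?_⟩, ?_⟩, ?_⟩, ?_⟩, ?_⟩
  · intro i j
    simp only [Matrix.mul_apply, Fin.sum_univ_six]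
    have h1 := contDiffOn_rot hc hs
    have h2 := fun i j => (HA.smooth i j).mono hsub
    fun_prop
  · intro t ht
    exact mul_rot_mem_G (HA.mem t (hsub ht)) (hcs t ht)
  · intro t ht
    rw [act_mul, act_origin_of_lowerZero (rot_mem (hcs t ht)) (rot_lowerZero _ _)]
    exact HA.proj t (hsub ht)
  · intro t ht
    rw [(E t ht _ rfl).1]
    exact HA.pos t (hsub ht)
  · intro t ht
    obtain ⟨-, e1, e2, e3, e4, -⟩ := E t ht _ rfl
    exact ⟨e1, e2, e3, e4⟩
  · intro t ht
    obtain ⟨e0, -, -, -, -, e1, e2, e3, e4, -⟩ := E t ht _ rfl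
    have := (HA.pos t (hsub ht)).ne'
    rw [frameP, e0, e1, e2, e3, e4]
    ext i j
    fin_cases i <;> fin_cases j <;> simp [this]
  · intro t ht
    obtain ⟨e0, -, -, -, -, -, -, -, -, e1, -⟩ := E t ht _ rfl
    exact e1
  · intro t ht
    obtain ⟨e0, -, -, -, -, -, -, -, -, -, e1, -⟩ := E t ht _ rfl
    have h1 := h0 t ht
    have := (HA.pos t (hsub ht)).ne'
    simp only [coefP, coefQ] at h1 ⊢
    rw [e0, e1]
    field_simp at h1 ⊢
    linarith
  · intro t ht
    obtain ⟨e0, -, -, -, -, -, -, -, -, -, -, e1⟩ := E t ht _ rfl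
    have := (HA.pos t (hsub ht)).ne'
    simp only [coefP, coefQ]
    rw [e1]
    field_simp

/-- The conditions are homogeneous of degree two in `(X, Y)`, so an unnormalized solution suffices;
the strict inequality guarantees that it is nonzero and can be normalized smoothly. -/
theorem exists_rotation_aux {p q X Y : ℝ → ℝ} {I : Set ℝ}
    (hX : ContDiffOn ℝ ∞ X I) (hY : ContDiffOn ℝ ∞ Y I)
    (h1 : ∀ t ∈ I, (X t ^ 2 - Y t ^ 2) * p t - 2 * X t * Y t * q t = 0)
    (h2 : ∀ t ∈ I, (X t ^ 2 - Y t ^ 2) * q t + 2 * X t * Y t * p t < 0) :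
    ∃ c s : ℝ → ℝ, ContDiffOn ℝ ∞ c I ∧ ContDiffOn ℝ ∞ s I ∧ ∀ t ∈ I,
      c t ^ 2 + s t ^ 2 = 1 ∧ (c t ^ 2 - s t ^ 2) * p t - 2 * c t * s t * q t = 0 ∧
        (c t ^ 2 - s t ^ 2) * q t + 2 * c t * s t * p t < 0 := by
  have hpos : ∀ t ∈ I, 0 < X t ^ 2 + Y t ^ 2 := fun t ht => by
    by_contra hcon
    have hx : X t = 0 := by nlinarith [sq_nonneg (X t), sq_nonneg (Y t)]
    have hy : Y t = 0 := by nlinarith [sq_nonneg (X t), sq_nonneg (Y t)]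
    have := h2 t ht
    rw [hx, hy] at this
    simp at this
  have hN : ContDiffOn ℝ ∞ (fun t => √(X t ^ 2 + Y t ^ 2)) I :=
    ContDiffOn.sqrt (by fun_prop) fun t ht => (hpos t ht).ne'
  have hN0 : ∀ t ∈ I, √(X t ^ 2 + Y t ^ 2) ≠ 0 := fun t ht =>
    (Real.sqrt_pos.2 (hpos t ht)).ne'
  refine ⟨fun t => X t / √(X t ^ 2 + Y t ^ 2), fun t => Y t / √(X t ^ 2 + Y t ^ 2),
    hX.div hN hN0, hY.div hN hN0, fun t ht => ?_⟩
  have e := Real.sq_sqrt (hpos t ht).le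
  have hN0 := hN0 t ht
  have h2 := h2 t ht
  have h1 := h1 t ht
  have hpos := hpos t ht
  beta_reduce
  generalize √(X t ^ 2 + Y t ^ 2) = N at *
  have hN2 : 0 < N ^ 2 := by positivity
  refine ⟨?_, ?_, ?_⟩
  · field_simp; linarith
  · field_simp; linarith
  · have : ((X t / N) ^ 2 - (Y t / N) ^ 2) * q t + 2 * (X t / N) * (Y t / N) * p t =
        ((X t ^ 2 - Y t ^ 2) * q t + 2 * X t * Y t * p t) / N ^ 2 := by field_simp
    rw [this]
    exact div_neg_of_neg_of_pos h2 hN2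

/-- The target is `(0, -r)` with `r = √(p² + q²)`; the minus sign makes `θ^0_0 = -θ^1_1` positive.
The required half angle is given by the direction `(r - q, -p)` or `(-p, r + q)`. Each degenerates
on one ray, so the choice depends on the sign of `q` at `t₀`, and the interval is shrunk to keep `r
- q` or `r + q` positive. -/
theorem exists_rotation {p q : ℝ → ℝ} {I : Set ℝ} (hI : IsOpen I) (hp : ContDiffOn ℝ ∞ p I)
    (hq : ContDiffOn ℝ ∞ q I) {t₀ : ℝ} (ht₀ : t₀ ∈ I) (h0 : 0 < p t₀ ^ 2 + q t₀ ^ 2) :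
    ∃ I', IsOpen I' ∧ I' ⊆ I ∧ t₀ ∈ I' ∧ ∃ c s : ℝ → ℝ,
      ContDiffOn ℝ ∞ c I' ∧ ContDiffOn ℝ ∞ s I' ∧ ∀ t ∈ I',
      c t ^ 2 + s t ^ 2 = 1 ∧ (c t ^ 2 - s t ^ 2) * p t - 2 * c t * s t * q t = 0 ∧
        (c t ^ 2 - s t ^ 2) * q t + 2 * c t * s t * p t < 0 := by
  obtain ⟨I₁, hI₁, hsub₁, ht₁, hpos⟩ : ∃ I₁, IsOpen I₁ ∧ I₁ ⊆ I ∧ t₀ ∈ I₁ ∧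
      ∀ t ∈ I₁, 0 < p t ^ 2 + q t ^ 2 := by
    have hc : ContinuousOn (fun t => p t ^ 2 + q t ^ 2) I := by
      have := hp.continuousOn
      have := hq.continuousOn
      fun_prop
    exact ⟨_, hc.isOpen_inter_preimage hI isOpen_Ioi, Set.inter_subset_left, ⟨ht₀, h0⟩,
      fun t ht => ht.2⟩
  have hp := hp.mono hsub₁
  have hq := hq.mono hsub₁
  have hr : ContDiffOn ℝ ∞ (fun t => √(p t ^ 2 + q t ^ 2)) I₁ :=
    ContDiffOn.sqrt (by fun_prop) fun t ht => (hpos t ht).ne'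
  rcases le_total (q t₀) 0 with hq0 | hq0
  · have ho : IsOpen (I₁ ∩ (fun t => √(p t ^ 2 + q t ^ 2) - q t) ⁻¹' Set.Ioi 0) :=
      (hr.sub hq).continuousOn.isOpen_inter_preimage hI₁ isOpen_Ioi
    refine ⟨_, ho, Set.inter_subset_left.trans hsub₁, ⟨ht₁, ?_⟩, ?_⟩
    · have := Real.sqrt_pos.2 h0
      simp only [Set.mem_preimage, Set.mem_Ioi]; linarith
    · refine exists_rotation_aux (X := fun t => √(p t ^ 2 + q t ^ 2) - q t) (Y := fun t => - p t)
        ((hr.sub hq).mono Set.inter_subset_left) (hp.neg.mono Set.inter_subset_left) ?_ ?_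
      · rintro t ⟨ht, ht'⟩
        have e := Real.sq_sqrt (hpos t ht).le
        linear_combination p t * e
      · rintro t ⟨ht, ht'⟩
        have e := Real.sq_sqrt (hpos t ht).le
        have h3 := Real.sqrt_pos.2 (hpos t ht)
        simp only [Set.mem_preimage, Set.mem_Ioi] at ht'
        generalize √(p t ^ 2 + q t ^ 2) = r at *
        have : ((r - q t) ^ 2 - (-p t) ^ 2) * q t + 2 * (r - q t) * (-p t) * p t =
          - (2 * r ^ 2 * (r - q t)) := by linear_combination (q t - 2 * (q t - r)) * e
        rw [this]
        have : 0 < 2 * r ^ 2 * (r - q t) := by positivity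
        linarith
  · have ho : IsOpen (I₁ ∩ (fun t => √(p t ^ 2 + q t ^ 2) + q t) ⁻¹' Set.Ioi 0) :=
      (hr.add hq).continuousOn.isOpen_inter_preimage hI₁ isOpen_Ioi
    refine ⟨_, ho, Set.inter_subset_left.trans hsub₁, ⟨ht₁, ?_⟩, ?_⟩
    · have := Real.sqrt_pos.2 h0
      simp only [Set.mem_preimage, Set.mem_Ioi]; linarith
    · refine exists_rotation_aux (Y := fun t => √(p t ^ 2 + q t ^ 2) + q t) (X := fun t => - p t)
        (hp.neg.mono Set.inter_subset_left) ((hr.add hq).mono Set.inter_subset_left) ?_ ?_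
      · rintro t ⟨ht, ht'⟩
        have e := Real.sq_sqrt (hpos t ht).le
        linear_combination - p t * e
      · rintro t ⟨ht, ht'⟩
        have e := Real.sq_sqrt (hpos t ht).le
        have h3 := Real.sqrt_pos.2 (hpos t ht)
        simp only [Set.mem_preimage, Set.mem_Ioi] at ht'
        generalize √(p t ^ 2 + q t ^ 2) = r at *
        have : ((-p t) ^ 2 - (r + q t) ^ 2) * q t + 2 * (-p t) * (r + q t) * p t =
          - (2 * r ^ 2 * (r + q t)) := by linear_combination (q t + 2 * r) * e
        rw [this]
        have : 0 < 2 * r ^ 2 * (r + q t) := by positivity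
        linarith

theorem IsThirdOrder.contDiffOn_coef {γ : ℝ → Lam} {I : Set ℝ} {A : ℝ → Mat}
    (HA : IsThirdOrder γ I A) : ContDiffOn ℝ ∞ (coefP A) I ∧ ContDiffOn ℝ ∞ (coefQ A) I := by
  have h1 := HA.toIsFrame.contDiffOn_theta
  have h0 : ∀ t ∈ I, theta A t 4 0 ≠ 0 := fun t ht => (HA.pos t ht).ne'
  constructor
  · exact (((h1 0 1).add (h1 1 0)).div_const 2).div (h1 4 0) h0
  · exact (h1 1 1).div (h1 4 0) h0

/-- Near a point with `p ^ 2 + q ^ 2 > 0` there is a fourth order frame field with `θ^0_0 > 0`. -/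
theorem IsThirdOrder.exists_fourthOrder {γ : ℝ → Lam} {I : Set ℝ} {A : ℝ → Mat}
    (HA : IsThirdOrder γ I A) {t₀ : ℝ} (ht₀ : t₀ ∈ I)
    (h0 : 0 < coefP A t₀ ^ 2 + coefQ A t₀ ^ 2) :
    ∃ I' B, I' ⊆ I ∧ t₀ ∈ I' ∧ IsFourthOrder γ I' B ∧ ∀ t ∈ I', 0 < theta B t 0 0 := by
  obtain ⟨hp, hq⟩ := HA.contDiffOn_coef
  obtain ⟨I', hI', hsub, ht', c, s, hc, hs, hcs⟩ := exists_rotation HA.isOpen hp hq ht₀ h0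
  obtain ⟨H1, H2⟩ := HA.rotate hI' hsub hc hs (fun t ht => (hcs t ht).1) fun t ht => (hcs t ht).2.1
  refine ⟨I', _, hsub, ht', H1, fun t ht => ?_⟩
  have h1 := H1.trace_zero t ht
  have h2 := H2 t ht
  have h3 := mul_neg_of_neg_of_pos (hcs t ht).2.2 (HA.pos t (hsub ht))
  linarith

theorem IsGeneric.exists_fourthOrder {J : Set ℝ} (hJ : IsOpen J) {γ : ℝ → Lam}
    (hγ : IsGeneric J γ) {t₀ : ℝ} (ht₀ : t₀ ∈ J) :
    ∃ I B, I ⊆ J ∧ t₀ ∈ I ∧ IsFourthOrder γ I B ∧ ∀ t ∈ I, 0 < theta B t 0 0 := by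
  obtain ⟨I, A, ht, HA, hpq⟩ := hγ.pq_pos t₀ ht₀
  obtain ⟨I', B, h1, h2, h3, h4⟩ := (HA.mono (HA.isOpen.inter hJ)
    Set.inter_subset_left).exists_fourthOrder ⟨ht, ht₀⟩ hpq
  exact ⟨I', B, h1.trans Set.inter_subset_right, h2, h3, h4⟩

/-- A frame is chosen near each point with `θ^0_0 > 0`. This normalization makes the form `θ` of two
such frames equal wherever both are defined, so curvatures read at `t` from the frame chosen for `t`
agree with those of neighbouring frames. -/
theorem IsGeneric.exists_isLieCurvatures {J : Set ℝ} (hJ : IsOpen J) {γ : ℝ → Lam}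
    (hγ : IsGeneric J γ) : ∃ κ₁ κ₂ κ₃ κ₄ : ℝ → ℝ, IsLieCurvatures J γ κ₁ κ₂ κ₃ κ₄ := by
  choose! I B hsub hmem H4 hpos using fun t ht => hγ.exists_fourthOrder hJ (t₀ := t) ht
  have key : ∀ t₀ ∈ J, ∀ t ∈ I t₀, theta (B t₀) t = theta (B t) t := fun t₀ h0 t ht => by
    have htJ := hsub t₀ h0 ht
    exact (H4 t htJ).theta_eq (H4 t₀ h0) (hmem t htJ) ht
      (mul_pos (hpos t htJ t (hmem t htJ)) (hpos t₀ h0 t ht))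
  refine ⟨fun t => theta (B t) t 0 0 / theta (B t) t 4 0,
    fun t => theta (B t) t 1 0 / theta (B t) t 4 0, fun t => theta (B t) t 3 2 / theta (B t) t 4 0,
    fun t => theta (B t) t 0 4 / theta (B t) t 4 0, fun t₀ h0 =>
    ⟨I t₀, B t₀, hmem t₀ h0, hsub t₀ h0, H4 t₀ h0, fun t ht => ?_⟩⟩
  have hθ := ((H4 t₀ h0).pos t ht).ne'
  rw [key t₀ h0 t ht] at hθ ⊢
  refine ⟨?_, ?_, ?_, ?_⟩ <;> field_simp

/-! ### Partial derivatives in `(s, u)` and differentiation under the integral. -/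

section Calculus

variable {E : Type*} [NormedAddCommGroup E] [NormedSpace ℝ E]

/-- The partial derivative in the first variable. -/
noncomputable def ds (v : ℝ × ℝ → E) (p : ℝ × ℝ) : E := deriv (fun s => v (s, p.2)) p.1

/-- The partial derivative in the second variable. -/
noncomputable def du (v : ℝ × ℝ → E) (p : ℝ × ℝ) : E := deriv (fun u => v (p.1, u)) p.2

variable {v w : ℝ × ℝ → E} {N : Set (ℝ × ℝ)} {p : ℝ × ℝ}

theorem hasDerivAt_fst (hN : IsOpen N) (hv : ContDiffOn ℝ ∞ v N) (hp : p ∈ N) :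
    HasDerivAt (fun s => v (s, p.2)) (fderiv ℝ v p (1, 0)) p.1 := by
  have h1 : HasFDerivAt v (fderiv ℝ v p) (p.1, p.2) :=
    ((hv.contDiffAt (hN.mem_nhds hp)).differentiableAt (by simp)).hasFDerivAt
  exact h1.comp_hasDerivAt p.1 ((hasDerivAt_id p.1).prodMk (hasDerivAt_const p.1 p.2))

theorem hasDerivAt_snd (hN : IsOpen N) (hv : ContDiffOn ℝ ∞ v N) (hp : p ∈ N) :
    HasDerivAt (fun u => v (p.1, u)) (fderiv ℝ v p (0, 1)) p.2 := by
  have h1 : HasFDerivAt v (fderiv ℝ v p) (p.1, p.2) :=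
    ((hv.contDiffAt (hN.mem_nhds hp)).differentiableAt (by simp)).hasFDerivAt
  exact h1.comp_hasDerivAt p.2 ((hasDerivAt_const p.2 p.1).prodMk (hasDerivAt_id p.2))

theorem ds_eq (hN : IsOpen N) (hv : ContDiffOn ℝ ∞ v N) (hp : p ∈ N) :
    ds v p = fderiv ℝ v p (1, 0) := (hasDerivAt_fst hN hv hp).deriv

theorem du_eq (hN : IsOpen N) (hv : ContDiffOn ℝ ∞ v N) (hp : p ∈ N) :
    du v p = fderiv ℝ v p (0, 1) := (hasDerivAt_snd hN hv hp).deriv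

theorem hasDerivAt_ds (hN : IsOpen N) (hv : ContDiffOn ℝ ∞ v N) (hp : p ∈ N) :
    HasDerivAt (fun s => v (s, p.2)) (ds v p) p.1 := by
  rw [ds_eq hN hv hp]; exact hasDerivAt_fst hN hv hp

theorem hasDerivAt_du (hN : IsOpen N) (hv : ContDiffOn ℝ ∞ v N) (hp : p ∈ N) :
    HasDerivAt (fun u => v (p.1, u)) (du v p) p.2 := by
  rw [du_eq hN hv hp]; exact hasDerivAt_snd hN hv hp

theorem contDiffOn_fderiv_apply (hN : IsOpen N) (hv : ContDiffOn ℝ ∞ v N) (e : ℝ × ℝ) :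
    ContDiffOn ℝ ∞ (fun q => fderiv ℝ v q e) N :=
  (hv.fderiv_of_isOpen hN (by simp)).clm_apply contDiffOn_const

theorem contDiffOn_ds (hN : IsOpen N) (hv : ContDiffOn ℝ ∞ v N) : ContDiffOn ℝ ∞ (ds v) N :=
  (contDiffOn_fderiv_apply hN hv (1, 0)).congr fun _ hq => ds_eq hN hv hq

theorem contDiffOn_du (hN : IsOpen N) (hv : ContDiffOn ℝ ∞ v N) : ContDiffOn ℝ ∞ (du v) N :=
  (contDiffOn_fderiv_apply hN hv (0, 1)).congr fun _ hq => du_eq hN hv hq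

theorem eventually_slice_fst (hN : IsOpen N) (hp : p ∈ N) : ∀ᶠ s in 𝓝 p.1, (s, p.2) ∈ N := by
  have : Continuous fun s : ℝ => (s, p.2) := by fun_prop
  exact this.continuousAt.eventually_mem (hN.mem_nhds (by simpa using hp))

theorem eventually_slice_snd (hN : IsOpen N) (hp : p ∈ N) : ∀ᶠ u in 𝓝 p.2, (p.1, u) ∈ N := by
  have : Continuous fun u : ℝ => (p.1, u) := by fun_prop
  exact this.continuousAt.eventually_mem (hN.mem_nhds (by simpa using hp))

theorem ds_congr (hN : IsOpen N) (hvw : ∀ q ∈ N, v q = w q) (hp : p ∈ N) : ds v p = ds w p :=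
  Filter.EventuallyEq.deriv_eq ((eventually_slice_fst hN hp).mono fun _ hs => hvw _ hs)

theorem du_congr (hN : IsOpen N) (hvw : ∀ q ∈ N, v q = w q) (hp : p ∈ N) : du v p = du w p :=
  Filter.EventuallyEq.deriv_eq ((eventually_slice_snd hN hp).mono fun _ hs => hvw _ hs)

theorem du_ds_comm (hN : IsOpen N) (hv : ContDiffOn ℝ ∞ v N) (hp : p ∈ N) :
    du (ds v) p = ds (du v) p := by
  have hd : DifferentiableAt ℝ (fderiv ℝ v) p :=
    ((hv.fderiv_of_isOpen (m := ∞) hN (by simp)).contDiffAt (hN.mem_nhds hp)).differentiableAt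
      (by simp)
  have key : ∀ e : ℝ × ℝ, fderiv ℝ (fun q => fderiv ℝ v q e) p =
      (fderiv ℝ (fderiv ℝ v) p).flip e := fun e => by
    have := (hd.hasFDerivAt.clm_apply (hasFDerivAt_const e p)).fderiv
    rw [this]; ext <;> simp
  have hsymm : IsSymmSndFDerivAt ℝ v p :=
    (hv.contDiffAt (hN.mem_nhds hp)).isSymmSndFDerivAt (by
      rw [minSmoothness_of_isRCLikeNormedField]
      exact WithTop.coe_le_coe.2 le_top)
  rw [du_congr hN (fun q hq => ds_eq hN hv hq) hp, ds_congr hN (fun q hq => du_eq hN hv hq) hp,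
    du_eq hN (contDiffOn_fderiv_apply hN hv _) hp, ds_eq hN (contDiffOn_fderiv_apply hN hv _) hp,
    key, key]
  exact hsymm.eq _ _

theorem contDiffOn_slice_fst {U : Set ℝ} {u : ℝ} (hv : ContDiffOn ℝ ∞ v N)
    (hU : ∀ s ∈ U, (s, u) ∈ N) : ContDiffOn ℝ ∞ (fun s => v (s, u)) U :=
  hv.comp (by fun_prop) hU

end Calculus

/-- Differentiation under the integral sign for integrands that are smooth near `[a, b] × {0}`. -/
theorem hasDerivAt_integral_of_smooth {a b : ℝ} (hab : a ≤ b) {F : ℝ × ℝ → ℝ}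
    (hF : ∀ s ∈ Set.Icc a b, ∃ N, IsOpen N ∧ (s, (0 : ℝ)) ∈ N ∧ ContDiffOn ℝ ∞ F N) :
    HasDerivAt (fun u => ∫ s in a..b, F (s, u)) (∫ s in a..b, du F (s, 0)) 0 := by
  obtain ⟨N, hN, hsub, hFN⟩ : ∃ N, IsOpen N ∧ Set.Icc a b ×ˢ {(0 : ℝ)} ⊆ N ∧
      ContDiffOn ℝ ∞ F N := by
    choose! N hN hm hF using hF
    refine ⟨⋃ s ∈ Set.Icc a b, N s, isOpen_biUnion hN, ?_, ?_⟩
    · rintro ⟨s, u⟩ ⟨hs, hu⟩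
      obtain rfl : u = 0 := hu
      exact Set.mem_biUnion hs (hm s hs)
    · intro q hq
      obtain ⟨s, hs, hq⟩ := Set.mem_iUnion₂.1 hq
      exact ((hF s hs).contDiffAt ((hN s hs).mem_nhds hq)).contDiffWithinAt
  -- The tube lemma yields a closed box around `[a, b] × {0}` inside `N`; the bound of the
  -- `u`-derivative on this compact box dominates the difference quotients.
  obtain ⟨U, W, -, hW, hU, h0, hUW⟩ := generalized_tube_lemma isCompact_Icc isCompact_singleton
    hN hsub
  obtain ⟨δ, hδ, hball⟩ := Metric.isOpen_iff.1 hW 0 (h0 rfl)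
  have hδ' : Metric.closedBall (0 : ℝ) (δ / 2) ⊆ W :=
    (Metric.closedBall_subset_ball (by linarith)).trans hball
  have hK : Set.Icc a b ×ˢ Metric.closedBall (0 : ℝ) (δ / 2) ⊆ N :=
    (Set.prod_mono hU hδ').trans hUW
  have hcd := (contDiffOn_du hN hFN).continuousOn
  obtain ⟨C, hC⟩ := (isCompact_Icc.prod (isCompact_closedBall (0 : ℝ) (δ / 2))).exists_bound_of_continuousOn
    (hcd.mono hK)
  have hIoc : Set.uIoc a b ⊆ Set.Icc a b := by
    rw [Set.uIoc_of_le hab]; exact Set.Ioc_subset_Icc_self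
  have hslice : ∀ {f : ℝ × ℝ → ℝ}, ContinuousOn f N → ∀ u ∈ Metric.closedBall (0 : ℝ) (δ / 2),
      ContinuousOn (fun s => f (s, u)) (Set.Icc a b) := fun hf u hu =>
    hf.comp (by fun_prop) fun s hs => hK ⟨hs, hu⟩
  have h0' : (0 : ℝ) ∈ Metric.closedBall (0 : ℝ) (δ / 2) := by simp; linarith
  refine (intervalIntegral.hasDerivAt_integral_of_dominated_loc_of_deriv_le
    (F := fun u s => F (s, u)) (F' := fun u s => du F (s, u)) (bound := fun _ => C)
    (s := Metric.ball (0 : ℝ) (δ / 2)) (Metric.ball_mem_nhds 0 (by linarith)) ?_ ?_ ?_ ?_ ?_ ?_).2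
  · filter_upwards [Metric.ball_mem_nhds (0 : ℝ) (half_pos hδ)] with u hu
    exact ((hslice hFN.continuousOn u (Metric.ball_subset_closedBall hu)).mono
      hIoc).aestronglyMeasurable measurableSet_uIoc
  · exact (ContinuousOn.intervalIntegrable_of_Icc hab (hslice hFN.continuousOn 0 h0'))
  · exact ((hslice hcd 0 h0').mono hIoc).aestronglyMeasurable measurableSet_uIoc
  · exact Filter.Eventually.of_forall fun s hs u hu =>
      hC (s, u) ⟨hIoc hs, Metric.ball_subset_closedBall hu⟩
  · exact intervalIntegrable_const
  · exact Filter.Eventually.of_forall fun s hs u hu =>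
      hasDerivAt_du (p := (s, u)) hN hFN (hK ⟨hIoc hs, Metric.ball_subset_closedBall hu⟩)

/-! ### Explicit frames built from spanning vector fields. -/

section Form

variable (x y z : Fin 6 → ℝ) (c : ℝ)

theorem form_add_left : form (x + y) z = form x z + form y z := by
  simp only [form_eq, Pi.add_apply]; ring

theorem form_add_right : form z (x + y) = form z x + form z y := by
  simp only [form_eq, Pi.add_apply]; ring

theorem form_sub_left : form (x - y) z = form x z - form y z := by
  simp only [form_eq, Pi.sub_apply]; ring

theorem form_sub_right : form z (x - y) = form z x - form z y := by
  simp only [form_eq, Pi.sub_apply]; ring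

theorem form_smul_left : form (c • x) z = c * form x z := by
  simp only [form_eq, Pi.smul_apply, smul_eq_mul]; ring

theorem form_smul_right : form z (c • x) = c * form z x := by
  simp only [form_eq, Pi.smul_apply, smul_eq_mul]; ring

end Form

theorem hasDerivAt_form {v w : ℝ → Fin 6 → ℝ} {v' w' : Fin 6 → ℝ} {t : ℝ}
    (hv : HasDerivAt v v' t) (hw : HasDerivAt w w' t) :
    HasDerivAt (fun t => form (v t) (w t)) (form v' (w t) + form (v t) w') t := by
  have h1 := hasDerivAt_pi.1 hv
  have h2 := hasDerivAt_pi.1 hw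
  simp only [form_eq]
  refine HasDerivAt.congr_deriv ((((((h1 0).mul (h2 5)).add ((h1 5).mul (h2 0))).neg.sub
    (((h1 1).mul (h2 4)).add ((h1 4).mul (h2 1)))).add ((h1 2).mul (h2 2))).add
    ((h1 3).mul (h2 3))) ?_
  ring

theorem contDiffOn_form {v w : ℝ × ℝ → Fin 6 → ℝ} {N : Set (ℝ × ℝ)} (hv : ContDiffOn ℝ ∞ v N)
    (hw : ContDiffOn ℝ ∞ w N) : ContDiffOn ℝ ∞ (fun p => form (v p) (w p)) N := by
  have h1 := contDiffOn_pi.1 hv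
  have h2 := contDiffOn_pi.1 hw
  simp only [form_eq]
  fun_prop

section

variable {N : Set (ℝ × ℝ)} {p : ℝ × ℝ} {v w : ℝ × ℝ → Fin 6 → ℝ}

theorem ds_form (hN : IsOpen N) (hv : ContDiffOn ℝ ∞ v N) (hw : ContDiffOn ℝ ∞ w N) (hp : p ∈ N) :
    ds (fun p => form (v p) (w p)) p = form (ds v p) (w p) + form (v p) (ds w p) :=
  (hasDerivAt_form (hasDerivAt_ds hN hv hp) (hasDerivAt_ds hN hw hp)).deriv

theorem form_ds_of_const (hN : IsOpen N) (hv : ContDiffOn ℝ ∞ v N) (hw : ContDiffOn ℝ ∞ w N)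
    (hp : p ∈ N) {k : ℝ} (hk : ∀ q ∈ N, form (v q) (w q) = k) :
    form (ds v p) (w p) + form (v p) (ds w p) = 0 := by
  rw [← ds_form hN hv hw hp, ds_congr (w := fun _ => k) hN hk hp]
  simp [ds]

theorem ds_smul {m : ℝ × ℝ → ℝ} (hN : IsOpen N) (hm : ContDiffOn ℝ ∞ m N)
    (hv : ContDiffOn ℝ ∞ v N) (hp : p ∈ N) :
    ds (fun q => m q • v q) p = m p • ds v p + ds m p • v p :=
  ((hasDerivAt_ds hN hm hp).smul (hasDerivAt_ds hN hv hp)).deriv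

theorem ds_add (hN : IsOpen N) (hv : ContDiffOn ℝ ∞ v N) (hw : ContDiffOn ℝ ∞ w N) (hp : p ∈ N) :
    ds (fun q => v q + w q) p = ds v p + ds w p :=
  ((hasDerivAt_ds hN hv hp).add (hasDerivAt_ds hN hw hp)).deriv

end

theorem h_conj_apply (A D : Mat) (j : Fin 6) :
    (h * Aᵀ * h * D) 0 j = - form (A.col 5) (D.col j) ∧
    (h * Aᵀ * h * D) 1 j = - form (A.col 4) (D.col j) ∧
    (h * Aᵀ * h * D) 2 j = form (A.col 2) (D.col j) ∧
    (h * Aᵀ * h * D) 3 j = form (A.col 3) (D.col j) ∧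
    (h * Aᵀ * h * D) 4 j = - form (A.col 1) (D.col j) ∧
    (h * Aᵀ * h * D) 5 j = - form (A.col 0) (D.col j) := by
  have e : ∀ i, (Aᵀ * (h * D)) i j = form (A.col i) (D.col j) := fun i => by
    simp [form, Matrix.mul_apply, dotProduct, Matrix.mulVec]
  have := h_mul_apply (Aᵀ * (h * D)) j
  rw [mul_assoc, mul_assoc]
  simpa only [e] using this

/-- The frame with first columns `a, b, c, d` adapted to the derivatives `a', b'` of `a, b`. -/
noncomputable def mkFrame (a b c d a' b' : Fin 6 → ℝ) : Mat :=
  (Matrix.of ![a, b, c, d,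
    (-form a' b)⁻¹ • (a' - (form a' b' / (2 * -form a' b)) • a +
      (form a' a' / (2 * -form a' b)) • b),
    (form a' b)⁻¹ • (b' - (form b' b' / (2 * -form a' b)) • a +
      (form a' b' / (2 * -form a' b)) • b)])ᵀ

section MkFrame

variable {a b c d a' b' : Fin 6 → ℝ}

theorem mkFrame_col : (mkFrame a b c d a' b').col 0 = a ∧ (mkFrame a b c d a' b').col 1 = b ∧
    (mkFrame a b c d a' b').col 2 = c ∧ (mkFrame a b c d a' b').col 3 = d ∧
    (mkFrame a b c d a' b').col 4 = (-form a' b)⁻¹ • (a' - (form a' b' / (2 * -form a' b)) • a +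
      (form a' a' / (2 * -form a' b)) • b) ∧
    (mkFrame a b c d a' b').col 5 = (form a' b)⁻¹ • (b' - (form b' b' / (2 * -form a' b)) • a +
      (form a' b' / (2 * -form a' b)) • b) := ⟨rfl, rfl, rfl, rfl, rfl, rfl⟩

/-- The last two columns are rescaled derivatives, corrected by `a` and `b` to be isotropic and
mutually orthogonal. The term `⟨a', b'⟩` could be distributed between them in a one-parameter family
of ways; the equal split is the one that later gives `θ^0_0 + θ^1_1 = 0`. -/
theorem mkFrame_mem (aa : form a a = 0) (ab : form a b = 0) (bb : form b b = 0)
    (cc : form c c = 1) (cd : form c d = 0) (dd : form d d = 1) (ca : form c a = 0)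
    (cb : form c b = 0) (da : form d a = 0) (db : form d b = 0) (ca' : form c a' = 0)
    (cb' : form c b' = 0) (da' : form d a' = 0) (db' : form d b' = 0) (aa' : form a' a = 0)
    (bb' : form b' b = 0) (ab' : form b' a = - form a' b) (h0 : form a' b ≠ 0) :
    mkFrame a b c d a' b' ∈ Oh := by
  obtain ⟨e0, e1, e2, e3, e4, e5⟩ := mkFrame_col (a := a) (b := b) (c := c) (d := d) (a' := a')
    (b' := b')
  have hle : ∀ i j : Fin 6, i ≤ j → form ((mkFrame a b c d a' b').col i)
      ((mkFrame a b c d a' b').col j) = h i j := by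
    intro i j hij
    fin_cases i <;> fin_cases j <;> first | (exfalso; revert hij; decide) | skip
    all_goals
      simp only [Fin.zero_eta, Fin.mk_one, Fin.reduceFinMk, e0, e1, e2, e3, e4, e5,
        form_smul_left, form_smul_right, form_add_left,
        form_add_right, form_sub_left, form_sub_right, form_comm b a, form_comm a c, form_comm a d,
        form_comm b c, form_comm b d, form_comm d c, form_comm a' c, form_comm b' c, form_comm a' d,
        form_comm b' d, form_comm a a', form_comm b b', form_comm a b', form_comm b a',
        form_comm b' a',
        aa, ab, bb, cc, cd, dd, ca, cb, da, db, ca', cb', da', db', aa', bb', ab']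
      simp [h]
    all_goals field_simp
    all_goals first | ring1 | (right; ring1)
  rw [Oh_iff]
  intro i j
  rcases le_total i j with hij | hij
  · exact hle i j hij
  · rw [form_comm, hle j i hij]
    exact congrFun (congrFun h_transpose i) j

end MkFrame

/-! ### Families of frames and the conditions for first and third order. -/

section Family

variable {N : Set (ℝ × ℝ)} {A : ℝ × ℝ → Mat}

theorem contDiffOn_col (hA : ∀ i j, ContDiffOn ℝ ∞ (fun p => A p i j) N) (j : Fin 6) :
    ContDiffOn ℝ ∞ (fun p => (A p).col j) N :=
  contDiffOn_pi.2 fun i => hA i j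

theorem mderiv_slice (hN : IsOpen N) (hA : ∀ i j, ContDiffOn ℝ ∞ (fun p => A p i j) N)
    {p : ℝ × ℝ} (hp : p ∈ N) :
    MDeriv (fun s => A (s, p.2)) (Matrix.of fun i j => ds (fun q => A q i j) p) p.1 :=
  fun i j => hasDerivAt_ds hN (hA i j) hp

theorem theta_slice (hN : IsOpen N) (hA : ∀ i j, ContDiffOn ℝ ∞ (fun p => A p i j) N)
    (hO : ∀ p ∈ N, A p ∈ Oh) {p : ℝ × ℝ} (hp : p ∈ N) :
    theta (fun s => A (s, p.2)) p.1 =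
      h * (A p)ᵀ * h * Matrix.of fun i j => ds (fun q => A q i j) p :=
  theta_eq_of_mderiv (mderiv_slice hN hA hp) (hO _ hp)

theorem theta_slice_mem (hN : IsOpen N) (hA : ∀ i j, ContDiffOn ℝ ∞ (fun p => A p i j) N)
    (hO : ∀ p ∈ N, A p ∈ Oh) {p : ℝ × ℝ} (hp : p ∈ N) :
    theta (fun s => A (s, p.2)) p.1 ∈ lieAlg :=
  theta_mem_lieAlg (mderiv_slice hN hA hp)
    ((eventually_slice_fst hN hp).mono fun _ hs => hO _ hs)

theorem contDiffOn_theta_slice (hN : IsOpen N) (hA : ∀ i j, ContDiffOn ℝ ∞ (fun p => A p i j) N)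
    (hO : ∀ p ∈ N, A p ∈ Oh) (i j : Fin 6) :
    ContDiffOn ℝ ∞ (fun p : ℝ × ℝ => theta (fun s => A (s, p.2)) p.1 i j) N := by
  have h1 : ContDiffOn ℝ ∞ (fun p => (h * (A p)ᵀ * h *
      Matrix.of fun i j => ds (fun q => A q i j) p) i j) N := by
    simp only [Matrix.mul_apply, Matrix.transpose_apply, Matrix.of_apply, Fin.sum_univ_six]
    have := fun i j => contDiffOn_ds hN (hA i j)
    fun_prop
  exact h1.congr fun p hp => by rw [theta_slice hN hA hO hp]

theorem ds_col (hN : IsOpen N) (hA : ∀ i j, ContDiffOn ℝ ∞ (fun p => A p i j) N)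
    {p : ℝ × ℝ} (hp : p ∈ N) (j : Fin 6) :
    (Matrix.of fun i j => ds (fun q => A q i j) p).col j = ds (fun q => (A q).col j) p := by
  have h1 := (hasDerivAt_pi (φ := fun s i => A (s, p.2) i j)).2
    (fun i => hasDerivAt_ds hN (hA i j) hp)
  exact h1.deriv.symm

/-- The entries of `θ` for a family of frames. -/
theorem theta_slice_entries (hN : IsOpen N) (hA : ∀ i j, ContDiffOn ℝ ∞ (fun p => A p i j) N)
    (hO : ∀ p ∈ N, A p ∈ Oh) {p : ℝ × ℝ} (hp : p ∈ N) (j : Fin 6) :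
    theta (fun s => A (s, p.2)) p.1 0 j = - form ((A p).col 5) (ds (fun q => (A q).col j) p) ∧
    theta (fun s => A (s, p.2)) p.1 1 j = - form ((A p).col 4) (ds (fun q => (A q).col j) p) ∧
    theta (fun s => A (s, p.2)) p.1 2 j = form ((A p).col 2) (ds (fun q => (A q).col j) p) ∧
    theta (fun s => A (s, p.2)) p.1 3 j = form ((A p).col 3) (ds (fun q => (A q).col j) p) ∧
    theta (fun s => A (s, p.2)) p.1 4 j = - form ((A p).col 1) (ds (fun q => (A q).col j) p) ∧
    theta (fun s => A (s, p.2)) p.1 5 j = - form ((A p).col 0) (ds (fun q => (A q).col j) p) := by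
  rw [theta_slice hN hA hO hp, ← ds_col hN hA hp]
  exact h_conj_apply _ _ _

end Family

/-- The conditions under which `mkFrame` produces a family of first order frames. -/
structure PreAdapted (N : Set (ℝ × ℝ)) (a b c d : ℝ × ℝ → Fin 6 → ℝ) : Prop where
  isOpen : IsOpen N
  sa : ContDiffOn ℝ ∞ a N
  sb : ContDiffOn ℝ ∞ b N
  sc : ContDiffOn ℝ ∞ c N
  sd : ContDiffOn ℝ ∞ d N
  aa : ∀ p ∈ N, form (a p) (a p) = 0
  ab : ∀ p ∈ N, form (a p) (b p) = 0
  bb : ∀ p ∈ N, form (b p) (b p) = 0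
  cc : ∀ p ∈ N, form (c p) (c p) = 1
  cd : ∀ p ∈ N, form (c p) (d p) = 0
  dd : ∀ p ∈ N, form (d p) (d p) = 1
  ca : ∀ p ∈ N, form (c p) (a p) = 0
  cb : ∀ p ∈ N, form (c p) (b p) = 0
  da : ∀ p ∈ N, form (d p) (a p) = 0
  db : ∀ p ∈ N, form (d p) (b p) = 0
  ca' : ∀ p ∈ N, form (c p) (ds a p) = 0
  cb' : ∀ p ∈ N, form (c p) (ds b p) = 0
  da' : ∀ p ∈ N, form (d p) (ds a p) = 0
  db' : ∀ p ∈ N, form (d p) (ds b p) = 0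
  neg : ∀ p ∈ N, form (ds a p) (b p) < 0

/-- The conditions under which `mkFrame` produces a family of third order frames. -/
structure Adapted (N : Set (ℝ × ℝ)) (a b c d : ℝ × ℝ → Fin 6 → ℝ) : Prop extends
    PreAdapted N a b c d where
  c'a' : ∀ p ∈ N, form (ds c p) (ds a p) = - form (ds a p) (b p) ^ 2
  c'b' : ∀ p ∈ N, form (ds c p) (ds b p) = 0
  d'a' : ∀ p ∈ N, form (ds d p) (ds a p) = 0
  d'b' : ∀ p ∈ N, form (ds d p) (ds b p) = form (ds a p) (b p) ^ 2

section

variable {N : Set (ℝ × ℝ)} {a b c d : ℝ × ℝ → Fin 6 → ℝ}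

/-- The frame family built from adapted vector fields. -/
noncomputable def frameFam (a b c d : ℝ × ℝ → Fin 6 → ℝ) (p : ℝ × ℝ) : Mat :=
  mkFrame (a p) (b p) (c p) (d p) (ds a p) (ds b p)

theorem PreAdapted.aux (H : PreAdapted N a b c d) {p : ℝ × ℝ} (hp : p ∈ N) :
    form (ds a p) (a p) = 0 ∧ form (ds b p) (b p) = 0 ∧
      form (ds b p) (a p) = - form (ds a p) (b p) := by
  have h1 := form_ds_of_const H.isOpen H.sa H.sa hp H.aa
  have h2 := form_ds_of_const H.isOpen H.sb H.sb hp H.bb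
  have h3 := form_ds_of_const H.isOpen H.sa H.sb hp H.ab
  rw [form_comm (a p) (ds a p)] at h1
  rw [form_comm (b p) (ds b p)] at h2
  rw [form_comm (a p) (ds b p)] at h3
  exact ⟨by linarith, by linarith, by linarith⟩

theorem PreAdapted.mem_Oh (H : PreAdapted N a b c d) {p : ℝ × ℝ} (hp : p ∈ N) :
    frameFam a b c d p ∈ Oh := by
  obtain ⟨h1, h2, h3⟩ := H.aux hp
  exact mkFrame_mem (H.aa p hp) (H.ab p hp) (H.bb p hp) (H.cc p hp) (H.cd p hp) (H.dd p hp)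
    (H.ca p hp) (H.cb p hp) (H.da p hp) (H.db p hp) (H.ca' p hp) (H.cb' p hp) (H.da' p hp)
    (H.db' p hp) h1 h2 h3 (H.neg p hp).ne

theorem PreAdapted.smooth (H : PreAdapted N a b c d) (i j : Fin 6) :
    ContDiffOn ℝ ∞ (fun p => frameFam a b c d p i j) N := by
  have ha' := contDiffOn_ds H.isOpen H.sa
  have hb' := contDiffOn_ds H.isOpen H.sb
  have h1 := contDiffOn_pi.1 H.sa
  have h2 := contDiffOn_pi.1 H.sb
  have h3 := contDiffOn_pi.1 H.sc
  have h4 := contDiffOn_pi.1 H.sd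
  have h5 := contDiffOn_pi.1 ha'
  have h6 := contDiffOn_pi.1 hb'
  have f1 := contDiffOn_form ha' H.sb
  have f2 := contDiffOn_form ha' hb'
  have f3 := contDiffOn_form ha' ha'
  have f4 := contDiffOn_form hb' hb'
  have n0 : ∀ p ∈ N, form (ds a p) (b p) ≠ 0 := fun p hp => (H.neg p hp).ne
  have n1 : ∀ p ∈ N, -form (ds a p) (b p) ≠ 0 := fun p hp => neg_ne_zero.2 (n0 p hp)
  have n2 : ∀ p ∈ N, 2 * -form (ds a p) (b p) ≠ 0 := fun p hp =>
    mul_ne_zero two_ne_zero (n1 p hp)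
  have g1 : ContDiffOn ℝ ∞ (fun p => (form (ds a p) (b p))⁻¹) N := f1.inv n0
  have g2 : ContDiffOn ℝ ∞ (fun p => (-form (ds a p) (b p))⁻¹) N := f1.neg.inv n1
  have g3 : ContDiffOn ℝ ∞ (fun p => 2 * -form (ds a p) (b p)) N := contDiffOn_const.mul f1.neg
  have g4 := f2.div g3 n2
  have g5 := f3.div g3 n2
  have g6 := f4.div g3 n2
  fin_cases j
  · exact h1 i
  · exact h2 i
  · exact h3 i
  · exact h4 i
  · exact g2.mul (((h5 i).sub (g4.mul (h1 i))).add (g5.mul (h2 i)))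
  · exact g1.mul (((h6 i).sub (g6.mul (h1 i))).add (g4.mul (h2 i)))

theorem PreAdapted.theta_four_zero (H : PreAdapted N a b c d) {p : ℝ × ℝ} (hp : p ∈ N) :
    theta (fun s => frameFam a b c d (s, p.2)) p.1 4 0 = - form (ds a p) (b p) := by
  rw [(theta_slice_entries H.isOpen H.smooth (fun p hp => H.mem_Oh hp) hp 0).2.2.2.2.1, form_comm]
  rfl

/-- Since `θ^2_4 = θ^1_2` and so on in the Lie algebra, `P` is read off from the derivatives of `c`
and `d`, and the complicated last two columns need not be differentiated. The trace condition comes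
from the equal split in `mkFrame`. -/
theorem Adapted.isThirdOrder (H : Adapted N a b c d) {V : ℝ × ℝ → Lam}
    (hV : ∀ p ∈ N, (V p).plane = Submodule.span ℝ {a p, b p})
    (hG : ∀ p ∈ N, frameFam a b c d p ∈ G) {U : Set ℝ} (hU : IsOpen U) {u : ℝ}
    (hUN : ∀ s ∈ U, (s, u) ∈ N) :
    IsThirdOrder (fun s => V (s, u)) U (fun s => frameFam a b c d (s, u)) := by
  have hent := fun (s : ℝ) (hs : s ∈ U) (j : Fin 6) =>
    theta_slice_entries H.isOpen H.smooth (fun p hp => H.mem_Oh hp) (hUN s hs) j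
  have h40 := fun (s : ℝ) (hs : s ∈ U) => H.theta_four_zero (hUN s hs)
  have hcol : ∀ p, _ := fun p => mkFrame_col (a := a p) (b := b p) (c := c p) (d := d p)
    (a' := ds a p) (b' := ds b p)
  have hmem := fun (s : ℝ) (hs : s ∈ U) =>
    theta_slice_mem H.isOpen H.smooth (fun p hp => H.mem_Oh hp) (hUN s hs)
  refine ⟨⟨⟨⟨hU, ?_, ?_, ?_⟩, ?_, ?_⟩, ?_⟩, ?_⟩
  · intro i j
    exact contDiffOn_slice_fst (H.smooth i j) hUN
  · intro s hs
    exact hG _ (hUN s hs)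
  · intro s hs
    rw [hV _ (hUN s hs), act_origin]
    rfl
  · intro s hs
    rw [h40 s hs]
    have := H.neg _ (hUN s hs)
    linarith
  · intro s hs
    refine ⟨(hent s hs 0).2.2.1.trans ?_, (hent s hs 1).2.2.1.trans ?_,
      (hent s hs 0).2.2.2.1.trans ?_, (hent s hs 1).2.2.2.1.trans ?_⟩
    · exact H.ca' _ (hUN s hs)
    · exact H.cb' _ (hUN s hs)
    · exact H.da' _ (hUN s hs)
    · exact H.db' _ (hUN s hs)
  · intro s hs
    have hp := hUN s hs
    have hn := (H.neg _ hp).ne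
    have hk := lieAlg_entries (hmem s hs)
    obtain ⟨-, -, -, -, -, -, -, -, -, -, -, -, -, k02, k03, k12, k13, -⟩ := hk
    have c1 := form_ds_of_const H.isOpen H.sc H.sa hp H.ca
    have c2 := form_ds_of_const H.isOpen H.sc H.sb hp H.cb
    have c3 := form_ds_of_const H.isOpen H.sd H.sa hp H.da
    have c4 := form_ds_of_const H.isOpen H.sd H.sb hp H.db
    rw [H.ca' _ hp, add_zero] at c1
    rw [H.cb' _ hp, add_zero] at c2
    rw [H.da' _ hp, add_zero] at c3
    rw [H.db' _ hp, add_zero] at c4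
    obtain ⟨-, -, -, -, e4, e5⟩ := hcol (s, u)
    have t12 := (hent s hs 2).2.1
    have t13 := (hent s hs 3).2.1
    have t02 := (hent s hs 2).1
    have t03 := (hent s hs 3).1
    change _ = - form _ (ds c (s, u)) at t12 t02
    change _ = - form _ (ds d (s, u)) at t13 t03
    rw [frameFam, form_comm] at t12 t13 t02 t03
    rw [e4] at t12 t13
    rw [e5] at t02 t03
    simp only [form_smul_right, form_add_right, form_sub_right, c1, c2, c3, c4, H.c'a' _ hp,
      H.c'b' _ hp, H.d'a' _ hp, H.d'b' _ hp] at t12 t13 t02 t03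
    have f40 := h40 s hs
    simp only at f40
    rw [frameP, f40, ← k02, ← k03, ← k12, ← k13, t12, t13, t02, t03]
    ext i j
    fin_cases i <;> fin_cases j <;> simp <;> field_simp
  · intro s hs
    have hp := hUN s hs
    obtain ⟨a1, a2, a3⟩ := H.aux hp
    have hn := (H.neg _ hp).ne
    obtain ⟨-, -, -, -, e4, e5⟩ := hcol (s, u)
    have t0 := (hent s hs 0).1
    have t1 := (hent s hs 1).2.1
    change _ = - form _ (ds a (s, u)) at t0
    change _ = - form _ (ds b (s, u)) at t1
    rw [frameFam, form_comm] at t0 t1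
    rw [e5] at t0
    rw [e4] at t1
    rw [t0, t1]
    simp only [form_smul_right, form_add_right, form_sub_right, a1, a2, a3,
      form_comm (ds b (s, u)) (ds a (s, u))]
    field_simp
    ring

end

/-! ### Normalization to third order and the cube root formula for the speed. -/

section Normalize

variable {N : Set (ℝ × ℝ)} {a b c d : ℝ × ℝ → Fin 6 → ℝ}

/-- The determinant `det K` of the second fundamental form of adapted vector fields. -/
noncomputable def detK (a b c d : ℝ × ℝ → Fin 6 → ℝ) (p : ℝ × ℝ) : ℝ :=
  form (ds c p) (ds a p) * form (ds d p) (ds b p) - form (ds c p) (ds b p) * form (ds d p) (ds a p)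

/-- The factor `μ` with `μ³ θ⁴ = - det K`. -/
noncomputable def normMu (a b c d : ℝ × ℝ → Fin 6 → ℝ) (p : ℝ × ℝ) : ℝ :=
  (-detK a b c d p / form (ds a p) (b p) ^ 4) ^ (1 / 3 : ℝ)

/-- The coefficient `1 / (θ² μ)` of the normalization. -/
noncomputable def normCoef (a b c d : ℝ × ℝ → Fin 6 → ℝ) (p : ℝ × ℝ) : ℝ :=
  (form (ds a p) (b p) ^ 2 * normMu a b c d p)⁻¹

/-- The first normalized vector field. -/
noncomputable def normA (a b c d : ℝ × ℝ → Fin 6 → ℝ) (p : ℝ × ℝ) : Fin 6 → ℝ :=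
  (normCoef a b c d p * form (ds d p) (ds b p)) • a p +
    (-(normCoef a b c d p * form (ds d p) (ds a p))) • b p

/-- The second normalized vector field. -/
noncomputable def normB (a b c d : ℝ × ℝ → Fin 6 → ℝ) (p : ℝ × ℝ) : Fin 6 → ℝ :=
  (normCoef a b c d p * form (ds c p) (ds b p)) • a p +
    (-(normCoef a b c d p * form (ds c p) (ds a p))) • b p

theorem contDiffOn_detK (H : PreAdapted N a b c d) : ContDiffOn ℝ ∞ (detK a b c d) N := by
  have ha := contDiffOn_ds H.isOpen H.sa
  have hb := contDiffOn_ds H.isOpen H.sb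
  have hc := contDiffOn_ds H.isOpen H.sc
  have hd := contDiffOn_ds H.isOpen H.sd
  exact ((contDiffOn_form hc ha).mul (contDiffOn_form hd hb)).sub
    ((contDiffOn_form hc hb).mul (contDiffOn_form hd ha))

variable (H : PreAdapted N a b c d) (hK : ∀ p ∈ N, detK a b c d p < 0)
include H hK

theorem normMu_spec {p : ℝ × ℝ} (hp : p ∈ N) : 0 < normMu a b c d p ∧
    normMu a b c d p ^ 3 * form (ds a p) (b p) ^ 4 = - detK a b c d p := by
  have h1 := (H.neg p hp).ne
  have h2 := hK p hp
  have h4 : 0 < form (ds a p) (b p) ^ 4 := by positivity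
  have h3 : 0 < -detK a b c d p / form (ds a p) (b p) ^ 4 := div_pos (by linarith) h4
  refine ⟨Real.rpow_pos_of_pos h3 _, ?_⟩
  rw [normMu, ← Real.rpow_natCast, ← Real.rpow_mul h3.le]
  norm_num
  field_simp

theorem contDiffOn_normMu : ContDiffOn ℝ ∞ (normMu a b c d) N := by
  have hth := contDiffOn_form (contDiffOn_ds H.isOpen H.sa) H.sb
  have h4 : ∀ p ∈ N, form (ds a p) (b p) ^ 4 ≠ 0 := fun p hp => pow_ne_zero _ (H.neg p hp).ne
  refine ((contDiffOn_detK H).neg.div (hth.pow 4) h4).rpow_const_of_ne fun p hp => ?_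
  exact div_ne_zero (neg_ne_zero.2 (hK p hp).ne) (h4 p hp)

theorem contDiffOn_normCoef : ContDiffOn ℝ ∞ (normCoef a b c d) N := by
  have hth := contDiffOn_form (contDiffOn_ds H.isOpen H.sa) H.sb
  exact ((hth.pow 2).mul (contDiffOn_normMu H hK)).inv fun p hp =>
    mul_ne_zero (pow_ne_zero _ (H.neg p hp).ne) (normMu_spec H hK hp).1.ne'

omit hK in
theorem ds_form_combination {m n : ℝ × ℝ → ℝ} (hm : ContDiffOn ℝ ∞ m N) (hn : ContDiffOn ℝ ∞ n N)
    {p : ℝ × ℝ} (hp : p ∈ N) :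
    ds (fun q => m q • a q + n q • b q) p =
      m p • ds a p + ds m p • a p + (n p • ds b p + ds n p • b p) := by
  rw [← ds_smul H.isOpen hm H.sa hp, ← ds_smul H.isOpen hn H.sb hp]
  exact ds_add H.isOpen (hm.smul H.sa) (hn.smul H.sb) hp

/-- The new basis is, up to signs, the old one multiplied by `k` times the adjugate of `K`, where
`k` is `normCoef`. This makes `K` diagonal. The determinant of the change of basis is `-k² det K`,
and it scales `ϑ = ⟨a', b⟩` by `μ` as soon as `k² det K = -μ`. The condition `P = I₂` requires `k
det K = -(μϑ)²`. Both hold with `k = 1/(ϑ²μ)` exactly when `μ³ϑ⁴ = -det K`, whence the cube root and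
the condition `det K < 0`. Since `μ ≠ 0`, the plane is unchanged. -/
theorem adapted_norm : Adapted N (normA a b c d) (normB a b c d) c d ∧
    (∀ p ∈ N, form (ds (normA a b c d) p) (normB a b c d p) =
      normMu a b c d p * form (ds a p) (b p)) ∧
    ∀ p ∈ N, Submodule.span ℝ {normA a b c d p, normB a b c d p} =
      Submodule.span ℝ {a p, b p} := by
  have ha := contDiffOn_ds H.isOpen H.sa
  have hb := contDiffOn_ds H.isOpen H.sb
  have hc := contDiffOn_ds H.isOpen H.sc
  have hd := contDiffOn_ds H.isOpen H.sd
  have hk := contDiffOn_normCoef H hK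
  have m1 := hk.mul (contDiffOn_form hd hb)
  have n1 := (hk.mul (contDiffOn_form hd ha)).neg
  have m2 := hk.mul (contDiffOn_form hc hb)
  have n2 := (hk.mul (contDiffOn_form hc ha)).neg
  have dA := fun p (hp : p ∈ N) => ds_form_combination H m1 n1 hp
  have dB := fun p (hp : p ∈ N) => ds_form_combination H m2 n2 hp
  have key : ∀ p ∈ N, normCoef a b c d p * detK a b c d p =
      -(normMu a b c d p * form (ds a p) (b p)) ^ 2 := fun p hp => by
    obtain ⟨h1, h2⟩ := normMu_spec H hK hp
    have h3 := (H.neg p hp).ne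
    rw [normCoef, ← neg_eq_iff_eq_neg.2 h2]
    field_simp
  have key2 : ∀ p ∈ N, normCoef a b c d p ^ 2 * detK a b c d p = - normMu a b c d p :=
    fun p hp => by
    obtain ⟨h1, h2⟩ := normMu_spec H hK hp
    have h3 := (H.neg p hp).ne
    rw [normCoef, ← neg_eq_iff_eq_neg.2 h2]
    field_simp
  have hneg : ∀ p ∈ N, form (ds (normA a b c d) p) (normB a b c d p) =
      normMu a b c d p * form (ds a p) (b p) := fun p hp => by
    obtain ⟨g1, g2, g3⟩ := H.aux hp
    have k2 := key2 p hp
    rw [detK] at k2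
    change form (ds (fun q => _ • a q + _ • b q) p) _ = _
    rw [dA p hp, normB]
    simp only [form_smul_left, form_smul_right, form_add_left, form_add_right, H.aa p hp, H.ab p hp,
      H.bb p hp, form_comm (b p) (a p), g1, g2, g3]
    linear_combination -form (ds a p) (b p) * k2
  have dc := fun p (hp : p ∈ N) => form_ds_of_const H.isOpen H.sc H.sa hp H.ca
  have dcb := fun p (hp : p ∈ N) => form_ds_of_const H.isOpen H.sc H.sb hp H.cb
  have dd := fun p (hp : p ∈ N) => form_ds_of_const H.isOpen H.sd H.sa hp H.da
  have ddb := fun p (hp : p ∈ N) => form_ds_of_const H.isOpen H.sd H.sb hp H.db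
  refine ⟨⟨⟨H.isOpen, (m1.smul H.sa).add (n1.smul H.sb), (m2.smul H.sa).add (n2.smul H.sb), H.sc,
    H.sd, ?_, ?_, ?_, H.cc, H.cd, H.dd, ?_, ?_, ?_, ?_, ?_, ?_, ?_, ?_, ?_⟩, ?_, ?_, ?_, ?_⟩,
    hneg, ?_⟩
  · intro p hp
    simp only [normA, form_smul_left, form_smul_right, form_add_left, form_add_right, H.aa p hp,
      H.ab p hp, H.bb p hp, form_comm (b p) (a p)]
    ring
  · intro p hp
    simp only [normA, normB, form_smul_left, form_smul_right, form_add_left, form_add_right,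
      H.aa p hp, H.ab p hp, H.bb p hp, form_comm (b p) (a p)]
    ring
  · intro p hp
    simp only [normB, form_smul_left, form_smul_right, form_add_left, form_add_right, H.aa p hp,
      H.ab p hp, H.bb p hp, form_comm (b p) (a p)]
    ring
  · intro p hp
    simp only [normA, form_smul_right, form_add_right, H.ca p hp, H.cb p hp]; ring
  · intro p hp
    simp only [normB, form_smul_right, form_add_right, H.ca p hp, H.cb p hp]; ring
  · intro p hp
    simp only [normA, form_smul_right, form_add_right, H.da p hp, H.db p hp]; ring
  · intro p hp
    simp only [normB, form_smul_right, form_add_right, H.da p hp, H.db p hp]; ring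
  · intro p hp
    change form _ (ds (fun q => _ • a q + _ • b q) p) = _
    rw [dA p hp]
    simp only [form_smul_right, form_add_right, H.ca p hp, H.cb p hp, H.ca' p hp, H.cb' p hp]; ring
  · intro p hp
    change form _ (ds (fun q => _ • a q + _ • b q) p) = _
    rw [dB p hp]
    simp only [form_smul_right, form_add_right, H.ca p hp, H.cb p hp, H.ca' p hp, H.cb' p hp]; ring
  · intro p hp
    change form _ (ds (fun q => _ • a q + _ • b q) p) = _
    rw [dA p hp]
    simp only [form_smul_right, form_add_right, H.da p hp, H.db p hp, H.da' p hp, H.db' p hp]; ring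
  · intro p hp
    change form _ (ds (fun q => _ • a q + _ • b q) p) = _
    rw [dB p hp]
    simp only [form_smul_right, form_add_right, H.da p hp, H.db p hp, H.da' p hp, H.db' p hp]; ring
  · intro p hp
    rw [hneg p hp]
    exact mul_neg_of_pos_of_neg (normMu_spec H hK hp).1 (H.neg p hp)
  · intro p hp
    have k := key p hp
    rw [detK] at k
    rw [hneg p hp]
    have h1 := dc p hp
    have h2 := dcb p hp
    rw [H.ca' p hp, add_zero] at h1
    rw [H.cb' p hp, add_zero] at h2
    change form _ (ds (fun q => _ • a q + _ • b q) p) = _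
    rw [dA p hp]
    simp only [form_smul_right, form_add_right, h1, h2]
    linear_combination k
  · intro p hp
    have h1 := dc p hp
    have h2 := dcb p hp
    rw [H.ca' p hp, add_zero] at h1
    rw [H.cb' p hp, add_zero] at h2
    change form _ (ds (fun q => _ • a q + _ • b q) p) = _
    rw [dB p hp]
    simp only [form_smul_right, form_add_right, h1, h2]
    ring
  · intro p hp
    have h1 := dd p hp
    have h2 := ddb p hp
    rw [H.da' p hp, add_zero] at h1
    rw [H.db' p hp, add_zero] at h2
    change form _ (ds (fun q => _ • a q + _ • b q) p) = _
    rw [dA p hp]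
    simp only [form_smul_right, form_add_right, h1, h2]
    ring
  · intro p hp
    have k := key p hp
    rw [detK] at k
    rw [hneg p hp]
    have h1 := dd p hp
    have h2 := ddb p hp
    rw [H.da' p hp, add_zero] at h1
    rw [H.db' p hp, add_zero] at h2
    change form _ (ds (fun q => _ • a q + _ • b q) p) = _
    rw [dB p hp]
    simp only [form_smul_right, form_add_right, h1, h2]
    linear_combination -k
  · intro p hp
    have k2 := key2 p hp
    have h1 := (normMu_spec H hK hp).1
    have hmu := h1.ne'
    set k := normCoef a b c d p with hk'
    rw [detK] at k2
    apply le_antisymm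
    · rw [Submodule.span_le]
      rintro x (rfl | rfl)
      · exact Submodule.mem_span_pair.2 ⟨_, _, rfl⟩
      · exact Submodule.mem_span_pair.2 ⟨_, _, rfl⟩
    · rw [Submodule.span_le]
      rintro x (rfl | rfl)
      · refine Submodule.mem_span_pair.2 ⟨-(k * form (ds c p) (ds a p)) / normMu a b c d p,
          (k * form (ds d p) (ds a p)) / normMu a b c d p, ?_⟩
        ext i
        simp only [normA, normB, ← hk', Pi.add_apply, Pi.smul_apply, smul_eq_mul]
        field_simp
        linear_combination -(a p i) * k2
      · refine Submodule.mem_span_pair.2 ⟨-(k * form (ds c p) (ds b p)) / normMu a b c d p,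
          (k * form (ds d p) (ds b p)) / normMu a b c d p, ?_⟩
        ext i
        simp only [normA, normB, ← hk', Pi.add_apply, Pi.smul_apply, smul_eq_mul]
        field_simp
        linear_combination -(b p i) * k2

end Normalize

/-! ### From arbitrary frames to first order, and the derivative of the speed. -/

section Sec

variable {N : Set (ℝ × ℝ)} {a b e c d v : ℝ × ℝ → Fin 6 → ℝ} {p : ℝ × ℝ}

/-- The correction of `e` by `a, b` that makes it orthogonal to the derivatives of `a` and `b`. -/
noncomputable def sec (a b e : ℝ × ℝ → Fin 6 → ℝ) (p : ℝ × ℝ) : Fin 6 → ℝ :=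
  e p + (form (e p) (ds b p) / form (ds a p) (b p)) • a p -
    (form (e p) (ds a p) / form (ds a p) (b p)) • b p

theorem contDiffOn_sec (hN : IsOpen N) (ha : ContDiffOn ℝ ∞ a N) (hb : ContDiffOn ℝ ∞ b N)
    (he : ContDiffOn ℝ ∞ e N) (h0 : ∀ p ∈ N, form (ds a p) (b p) ≠ 0) :
    ContDiffOn ℝ ∞ (sec a b e) N := by
  have ha' := contDiffOn_ds hN ha
  have hb' := contDiffOn_ds hN hb
  have h1 := contDiffOn_form ha' hb
  exact (he.add (((contDiffOn_form he hb').div h1 h0).smul ha)).sub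
    (((contDiffOn_form he ha').div h1 h0).smul hb)

/-- Adding multiples of the isotropic vectors `a, b` to columns 2 and 3 does not disturb the
orthonormality relations. Because `⟨a', b⟩ ≠ 0`, the span of `a, b` pairs nondegenerately with `a',
b'`, so these multiples can be chosen to make the new vectors orthogonal to `a'` and `b'`. -/
theorem preAdapted_of_family {A : ℝ × ℝ → Mat} (hN : IsOpen N)
    (hA : ∀ i j, ContDiffOn ℝ ∞ (fun p => A p i j) N) (hO : ∀ p ∈ N, A p ∈ Oh)
    (hneg : ∀ p ∈ N, form (ds (fun q => (A q).col 0) p) ((A p).col 1) < 0) :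
    PreAdapted N (fun q => (A q).col 0) (fun q => (A q).col 1)
      (sec (fun q => (A q).col 0) (fun q => (A q).col 1) fun q => (A q).col 2)
      (sec (fun q => (A q).col 0) (fun q => (A q).col 1) fun q => (A q).col 3) := by
  have hcol := contDiffOn_col hA
  have hf := fun p hp i j => form_col (hO p hp) i j
  have hne := fun p hp => (hneg p hp).ne
  have e00 : ∀ p ∈ N, form ((A p).col 0) ((A p).col 0) = 0 := fun p hp => by simp [hf p hp, h]
  have e01 : ∀ p ∈ N, form ((A p).col 0) ((A p).col 1) = 0 := fun p hp => by simp [hf p hp, h]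
  have e11 : ∀ p ∈ N, form ((A p).col 1) ((A p).col 1) = 0 := fun p hp => by simp [hf p hp, h]
  have d0 : ∀ p ∈ N, form ((A p).col 0) (ds (fun q => (A q).col 0) p) = 0 := fun p hp => by
    have := form_ds_of_const hN (hcol 0) (hcol 0) hp e00
    rw [form_comm (ds _ _)] at this
    linarith
  have d1 : ∀ p ∈ N, form ((A p).col 1) (ds (fun q => (A q).col 1) p) = 0 := fun p hp => by
    have := form_ds_of_const hN (hcol 1) (hcol 1) hp e11
    rw [form_comm (ds _ _)] at this
    linarith
  have d01 : ∀ p ∈ N, form ((A p).col 0) (ds (fun q => (A q).col 1) p) =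
      - form (ds (fun q => (A q).col 0) p) ((A p).col 1) := fun p hp => by
    have := form_ds_of_const hN (hcol 0) (hcol 1) hp e01
    linarith
  have o0 : ∀ (j : Fin 6), ∀ p ∈ N, h j 0 = 0 → h j 1 = 0 →
      form (sec (fun q => (A q).col 0) (fun q => (A q).col 1) (fun q => (A q).col j) p)
        ((A p).col 0) = 0 := fun j p hp h1 h2 => by
    simp only [sec, form_add_left, form_sub_left, form_smul_left, e00 p hp, hf p hp j, h1, h2,
      form_comm ((A p).col 1) ((A p).col 0), e01 p hp]
    ring
  have o1 : ∀ (j : Fin 6), ∀ p ∈ N, h j 0 = 0 → h j 1 = 0 →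
      form (sec (fun q => (A q).col 0) (fun q => (A q).col 1) (fun q => (A q).col j) p)
        ((A p).col 1) = 0 := fun j p hp h1 h2 => by
    simp only [sec, form_add_left, form_sub_left, form_smul_left, e11 p hp, hf p hp j, h1, h2,
      e01 p hp]
    ring
  have o0' : ∀ (j : Fin 6), ∀ p ∈ N,
      form (sec (fun q => (A q).col 0) (fun q => (A q).col 1) (fun q => (A q).col j) p)
        (ds (fun q => (A q).col 0) p) = 0 := fun j p hp => by
    have := hne p hp
    simp only [sec, form_add_left, form_sub_left, form_smul_left, d0 p hp,
      form_comm ((A p).col 1) (ds _ _)]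
    field_simp
    ring
  have o1' : ∀ (j : Fin 6), ∀ p ∈ N,
      form (sec (fun q => (A q).col 0) (fun q => (A q).col 1) (fun q => (A q).col j) p)
        (ds (fun q => (A q).col 1) p) = 0 := fun j p hp => by
    have := hne p hp
    simp only [sec, form_add_left, form_sub_left, form_smul_left, d01 p hp, d1 p hp]
    field_simp
    ring
  have oo : ∀ (i j : Fin 6), ∀ p ∈ N, h i 0 = 0 → h i 1 = 0 → h j 0 = 0 → h j 1 = 0 →
      form (sec (fun q => (A q).col 0) (fun q => (A q).col 1) (fun q => (A q).col i) p)
        (sec (fun q => (A q).col 0) (fun q => (A q).col 1) (fun q => (A q).col j) p) = h i j :=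
    fun i j p hp h1 h2 h3 h4 => by
      have q0 := o0 j p hp h3 h4
      have q1 := o1 j p hp h3 h4
      rw [form_comm] at q0 q1
      rw [sec, form_sub_left, form_add_left, form_smul_left, form_smul_left, q0, q1, sec,
        form_sub_right, form_add_right, form_smul_right, form_smul_right, hf p hp, hf p hp, hf p hp,
        h1, h2]
      ring
  exact ⟨hN, hcol 0, hcol 1, contDiffOn_sec hN (hcol 0) (hcol 1) (hcol 2) hne,
    contDiffOn_sec hN (hcol 0) (hcol 1) (hcol 3) hne, e00, e01, e11,
    fun p hp => oo 2 2 p hp rfl rfl rfl rfl, fun p hp => oo 2 3 p hp rfl rfl rfl rfl,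
    fun p hp => oo 3 3 p hp rfl rfl rfl rfl, fun p hp => o0 2 p hp rfl rfl,
    fun p hp => o1 2 p hp rfl rfl, fun p hp => o0 3 p hp rfl rfl, fun p hp => o1 3 p hp rfl rfl,
    o0' 2, o1' 2, o0' 3, o1' 3, hneg⟩

/-- The correction coefficients vanish at `p`, so only the derivatives of their numerators survive;
the denominator there is `-1`. -/
theorem du_sec (hN : IsOpen N) (ha : ContDiffOn ℝ ∞ a N) (hb : ContDiffOn ℝ ∞ b N)
    (he : ContDiffOn ℝ ∞ e N) (hp : p ∈ N) (h1 : form (ds a p) (b p) = -1)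
    (h2 : form (e p) (ds a p) = 0) (h3 : form (e p) (ds b p) = 0) :
    du (sec a b e) p = du e p - (form (du e p) (ds b p) + form (e p) (du (ds b) p)) • a p +
      (form (du e p) (ds a p) + form (e p) (du (ds a) p)) • b p := by
  have ha' := contDiffOn_ds hN ha
  have hb' := contDiffOn_ds hN hb
  have da := hasDerivAt_du hN ha hp
  have db := hasDerivAt_du hN hb hp
  have de := hasDerivAt_du hN he hp
  have da' := hasDerivAt_du hN ha' hp
  have db' := hasDerivAt_du hN hb' hp
  have hn : form (ds a (p.1, p.2)) (b (p.1, p.2)) ≠ 0 := by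
    change form (ds a p) (b p) ≠ 0
    rw [h1]; norm_num
  have e1 := (de.add (((hasDerivAt_form de db').div (hasDerivAt_form da' db) hn).smul da)).sub
    (((hasDerivAt_form de da').div (hasDerivAt_form da' db) hn).smul db)
  refine e1.deriv.trans ?_
  simp only [Prod.mk.eta, Pi.div_apply, h1, h2, h3]
  ext i
  simp only [Pi.add_apply, Pi.sub_apply, Pi.smul_apply, smul_eq_mul]
  ring

/-- Orthogonality gives `⟨c_s, v_s⟩ = -⟨c, v_ss⟩`. The mixed derivative of the corrected section `c`
is thereby avoided. -/
theorem du_form_ds (hN : IsOpen N) (hc : ContDiffOn ℝ ∞ c N) (hv : ContDiffOn ℝ ∞ v N)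
    (hp : p ∈ N) (h0 : ∀ q ∈ N, form (c q) (ds v q) = 0) :
    du (fun q => form (ds c q) (ds v q)) p =
      -(form (du c p) (ds (ds v) p) + form (c p) (du (ds (ds v)) p)) := by
  have hv' := contDiffOn_ds hN hv
  rw [du_congr (w := fun q => -form (c q) (ds (ds v) q)) hN (fun q hq => ?_) hp]
  · exact (hasDerivAt_form (hasDerivAt_du hN hc hp)
      (hasDerivAt_du hN (contDiffOn_ds hN hv') hp)).neg.deriv
  · have := form_ds_of_const hN hc hv' hq h0
    linarith

/-- Instead of the cube root, the polynomial identity `σ³⟨a_s, b⟩ = det K` is differentiated, at a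
point where `σ = 1` and `K = diag(-1, 1)`. Only the diagonal entries of `K` contribute. -/
theorem PreAdapted.du_speed (H : PreAdapted N a b c d) (hK : ∀ p ∈ N, detK a b c d p < 0)
    (hp : p ∈ N) (h1 : form (ds a p) (b p) = -1) (k20 : form (ds c p) (ds a p) = -1)
    (k21 : form (ds c p) (ds b p) = 0) (k30 : form (ds d p) (ds a p) = 0)
    (k31 : form (ds d p) (ds b p) = 1) :
    3 * du (fun q => normMu a b c d q * -form (ds a q) (b q)) p =
      form (du c p) (ds (ds a) p) + form (c p) (du (ds (ds a)) p) -
      (form (du d p) (ds (ds b) p) + form (d p) (du (ds (ds b)) p)) +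
      form (du (ds a) p) (b p) + form (ds a p) (du b p) := by
  have hN := H.isOpen
  have ha := contDiffOn_ds H.isOpen H.sa
  have hb := contDiffOn_ds H.isOpen H.sb
  have hc := contDiffOn_ds H.isOpen H.sc
  have hd := contDiffOn_ds H.isOpen H.sd
  have hth := contDiffOn_form ha H.sb
  have hF := (contDiffOn_normMu H hK).mul hth.neg
  have g1 := hasDerivAt_du hN hF hp
  have g2 := hasDerivAt_form (hasDerivAt_du hN ha hp) (hasDerivAt_du hN H.sb hp)
  have g3 := ((hasDerivAt_du hN (contDiffOn_form hc ha) hp).mul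
    (hasDerivAt_du hN (contDiffOn_form hd hb) hp)).sub
    ((hasDerivAt_du hN (contDiffOn_form hc hb) hp).mul
    (hasDerivAt_du hN (contDiffOn_form hd ha) hp))
  have hmu : normMu a b c d p = 1 := by
    obtain ⟨m1, m2⟩ := normMu_spec H hK hp
    rw [detK, h1, k20, k21, k30, k31] at m2
    have : normMu a b c d p ^ 3 = 1 := by linarith
    exact (pow_eq_one_iff_of_nonneg m1.le (by norm_num)).1 this
  have heq : (fun u => (normMu a b c d (p.1, u) * -form (ds a (p.1, u)) (b (p.1, u))) ^ 3 *
      form (ds a (p.1, u)) (b (p.1, u))) =ᶠ[𝓝 p.2] fun u => form (ds c (p.1, u)) (ds a (p.1, u)) *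
        form (ds d (p.1, u)) (ds b (p.1, u)) - form (ds c (p.1, u)) (ds b (p.1, u)) *
        form (ds d (p.1, u)) (ds a (p.1, u)) :=
    (eventually_slice_snd hN hp).mono fun u hu => by
      have := (normMu_spec H hK hu).2
      rw [detK] at this
      linear_combination -this
  have g4 := ((g1.pow 3).mul g2).unique (g3.congr_of_eventuallyEq heq)
  rw [du_form_ds hN H.sc H.sa hp H.ca', du_form_ds hN H.sd H.sb hp H.db'] at g4
  simp only [Prod.mk.eta, Pi.pow_apply, h1, hmu, k20, k21, k30, k31] at g4
  generalize du (fun q => normMu a b c d q * -form (ds a q) (b q)) p = D at g4 ⊢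
  norm_num at g4
  linear_combination -g4

end Sec

/-! ### Deformations in the big cell and the infinitesimal first variation. -/

/-- The value of `θ` on a fourth order frame field along a curve parametrized by arclength. -/
def kmat (k₁ k₂ k₃ k₄ : ℝ) : Mat :=
  !![k₁, -k₂, 0, 1, k₄, 0;
     k₂, -k₁, 1, 0, 0, -k₄;
     0, 0, 0, -k₃, 1, 0;
     0, 0, k₃, 0, 0, 1;
     1, 0, 0, 0, k₁, k₂;
     0, -1, 0, 0, -k₂, -k₁]

theorem kmat_mulVec (k₁ k₂ k₃ k₄ a b c d e f : ℝ) :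
    kmat k₁ k₂ k₃ k₄ *ᵥ ![a, b, c, d, e, f] =
      ![k₁ * a - k₂ * b + d + k₄ * e, k₂ * a - k₁ * b + c - k₄ * f, -k₃ * d + e, k₃ * c + f,
        a + k₁ * e + k₂ * f, -b - k₂ * e - k₁ * f] := by
  ext i
  fin_cases i <;> simp [kmat, Matrix.mulVec, dotProduct, Fin.sum_univ_six] <;> ring

theorem IsFourthOrder.theta_eq_kmat {γ : ℝ → Lam} {I : Set ℝ} {A : ℝ → Mat}
    (H : IsFourthOrder γ I A) {t : ℝ} (ht : t ∈ I) (h1 : theta A t 4 0 = 1) :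
    theta A t = kmat (theta A t 0 0) (theta A t 1 0) (theta A t 3 2) (theta A t 0 4) := by
  obtain ⟨k1, k2, k3, k4, k5, k6, k7, k8, k9, k10, k11, k12, k13, k14, k15, k16, k17, k18, k19, k20,
    k21⟩ := lieAlg_entries (H.theta_mem ht)
  obtain ⟨z1, z2, z3, z4⟩ := H.zero t ht
  obtain ⟨e1, e2, e3, e4⟩ := H.toIsSecondOrder.entries ht
  have tr := H.trace_zero t ht
  have su := H.sum_zero ht
  ext i j
  fin_cases i <;> fin_cases j <;> simp [kmat, *] <;> linarith

/-- The big cell of lower block triangular matrices. -/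
noncomputable def chart (z : Fin 5 → ℝ) : Mat :=
  !![1, 0, 0, 0, 0, 0;
     0, 1, 0, 0, 0, 0;
     z 0, z 2, 1, 0, 0, 0;
     z 1, z 3, 0, 1, 0, 0;
     z 4, (z 2 ^ 2 + z 3 ^ 2) / 2, z 2, z 3, 1, 0;
     (z 0 ^ 2 + z 1 ^ 2) / 2, z 0 * z 2 + z 1 * z 3 - z 4, z 0, z 1, 0, 1]

/-- Five is the dimension of `Λ`; the remaining entries of the lower left block are forced by
isotropy of the first two columns. -/
theorem chart_mem (z : Fin 5 → ℝ) : chart z ∈ Oh := by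
  change (chart z)ᵀ * h * chart z = h
  rw [Matrix.mul_assoc]
  ext i j
  obtain ⟨h0, h1, h2, h3, h4, h5⟩ := h_mul_apply (chart z) j
  rw [Matrix.mul_apply, Fin.sum_univ_six, h0, h1, h2, h3, h4, h5]
  fin_cases i <;> fin_cases j <;> simp [chart, h] <;> ring

theorem chart_zero : chart 0 = 1 := by
  ext i j
  fin_cases i <;> fin_cases j <;> simp [chart]

theorem hasDerivAt_vec {f₀ f₁ f₂ f₃ f₄ f₅ : ℝ → ℝ} {d₀ d₁ d₂ d₃ d₄ d₅ t : ℝ}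
    (h₀ : HasDerivAt f₀ d₀ t) (h₁ : HasDerivAt f₁ d₁ t) (h₂ : HasDerivAt f₂ d₂ t)
    (h₃ : HasDerivAt f₃ d₃ t) (h₄ : HasDerivAt f₄ d₄ t) (h₅ : HasDerivAt f₅ d₅ t) :
    HasDerivAt (fun t => ![f₀ t, f₁ t, f₂ t, f₃ t, f₄ t, f₅ t]) ![d₀, d₁, d₂, d₃, d₄, d₅] t := by
  rw [hasDerivAt_pi]
  intro i
  fin_cases i <;> simpa

theorem MDeriv.mulVec {A : ℝ → Mat} {A' : Mat} {x : ℝ → Fin 6 → ℝ} {x' : Fin 6 → ℝ} {t : ℝ}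
    (hA : MDeriv A A' t) (hx : HasDerivAt x x' t) :
    HasDerivAt (fun s => A s *ᵥ x s) (A' *ᵥ x t + A t *ᵥ x') t := by
  rw [hasDerivAt_pi]
  intro i
  simp only [Matrix.mulVec, dotProduct, Pi.add_apply, ← Finset.sum_add_distrib]
  exact HasDerivAt.fun_sum fun k _ => (hA i k).mul (hasDerivAt_pi.1 hx k)

/-- A family of elements of the big cell relative to an arclength frame field of fourth order. -/
structure Deformation (γ : ℝ → Lam) (I : Set ℝ) (A : ℝ → Mat) (N : Set (ℝ × ℝ))
    (ξ : Fin 5 → ℝ × ℝ → ℝ) : Prop where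
  frame : IsFourthOrder γ I A
  arc : ∀ t ∈ I, theta A t 4 0 = 1
  isOpen : IsOpen N
  fst_mem : ∀ p ∈ N, p.1 ∈ I
  smooth : ∀ i, ContDiffOn ℝ ∞ (ξ i) N
  zero : ∀ i s, (s, (0 : ℝ)) ∈ N → ξ i (s, 0) = 0

/-- The frames `A(s) g(ξ(s, u))`. -/
noncomputable def deform (A : ℝ → Mat) (ξ : Fin 5 → ℝ × ℝ → ℝ) (p : ℝ × ℝ) : Mat :=
  A p.1 * chart fun i => ξ i p

/-- The infinitesimal variation. -/
noncomputable def infin (ξ : Fin 5 → ℝ × ℝ → ℝ) (i : Fin 5) (s : ℝ) : ℝ := du (ξ i) (s, 0)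

namespace Deformation

variable {γ : ℝ → Lam} {I : Set ℝ} {A : ℝ → Mat} {N : Set (ℝ × ℝ)} {ξ : Fin 5 → ℝ × ℝ → ℝ}
  (H : Deformation γ I A N ξ) {s : ℝ} (hs : (s, (0 : ℝ)) ∈ N)
include H

theorem mono {N' : Set (ℝ × ℝ)} (hN' : IsOpen N') (hsub : N' ⊆ N) : Deformation γ I A N' ξ :=
  ⟨H.frame, H.arc, hN', fun p hp => H.fst_mem p (hsub hp), fun i => (H.smooth i).mono hsub,
    fun i s hs => H.zero i s (hsub hs)⟩

theorem mem_Oh {p : ℝ × ℝ} (hp : p ∈ N) : deform A ξ p ∈ Oh :=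
  Oh.mul (H.frame.mem_Oh (H.fst_mem p hp)) (chart_mem _)

theorem smooth_deform (i j : Fin 6) : ContDiffOn ℝ ∞ (fun p => deform A ξ p i j) N := by
  have h1 : ∀ i j, ContDiffOn ℝ ∞ (fun p : ℝ × ℝ => A p.1 i j) N := fun i j =>
    (H.frame.smooth i j).comp contDiffOn_fst fun p hp => H.fst_mem p hp
  have h2 := H.smooth
  simp only [deform, Matrix.mul_apply]
  refine ContDiffOn.sum fun k _ => (h1 i k).mul ?_
  fin_cases k <;> fin_cases j <;> simp [chart] <;> fun_prop

theorem smooth_col (j : Fin 6) : ContDiffOn ℝ ∞ (fun p => (deform A ξ p).col j) N :=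
  contDiffOn_col H.smooth_deform j

theorem isOpen_slice : IsOpen {t : ℝ | (t, (0 : ℝ)) ∈ N} :=
  H.isOpen.preimage (by fun_prop : Continuous fun t : ℝ => (t, (0 : ℝ)))

theorem contDiffOn_infin (i : Fin 5) : ContDiffOn ℝ ∞ (infin ξ i) {t : ℝ | (t, (0 : ℝ)) ∈ N} :=
  contDiffOn_slice_fst (contDiffOn_du H.isOpen (H.smooth i)) fun _ h => h

include hs

theorem deform_zero : deform A ξ (s, 0) = A s := by
  have : (fun i => ξ i (s, 0)) = 0 := funext fun i => H.zero i s hs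
  rw [deform, this, chart_zero, mul_one]

theorem eventually_mem : ∀ᶠ t in 𝓝 s, (t, (0 : ℝ)) ∈ N := eventually_slice_fst H.isOpen hs

theorem hasDerivAt_infin (i : Fin 5) : HasDerivAt (infin ξ i) (deriv (infin ξ i) s) s :=
  (((H.contDiffOn_infin i).contDiffAt ((H.isOpen_slice).mem_nhds hs)).differentiableAt
    (by simp)).hasDerivAt

theorem hasDerivAt_deriv_infin (i : Fin 5) :
    HasDerivAt (deriv (infin ξ i)) (deriv (deriv (infin ξ i)) s) s :=
  ((((H.contDiffOn_infin i).deriv_of_isOpen (m := ∞) (H.isOpen_slice) (by simp)).contDiffAt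
    ((H.isOpen_slice).mem_nhds hs)).differentiableAt (by simp)).hasDerivAt

theorem hasDerivAt_theta (i j : Fin 6) :
    HasDerivAt (fun t => theta A t i j) (deriv (fun t => theta A t i j) s) s :=
  (((H.frame.contDiffOn_theta i j).contDiffAt (H.frame.isOpen.mem_nhds
    (H.fst_mem _ hs))).differentiableAt (by simp)).hasDerivAt

theorem theta_eq : theta A s = kmat (theta A s 0 0) (theta A s 1 0) (theta A s 3 2)
    (theta A s 0 4) :=
  H.frame.theta_eq_kmat (H.fst_mem _ hs) (H.arc _ (H.fst_mem _ hs))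

/-- The covariant derivative along the base curve. -/
theorem ds_eq_mulVec {v : ℝ × ℝ → Fin 6 → ℝ} {x : ℝ → Fin 6 → ℝ} {x' : Fin 6 → ℝ}
    (hv : ∀ t, (t, (0 : ℝ)) ∈ N → v (t, 0) = A t *ᵥ x t) (hx : HasDerivAt x x' s) :
    ds v (s, 0) = A s *ᵥ (x' + kmat (theta A s 0 0) (theta A s 1 0) (theta A s 3 2)
      (theta A s 0 4) *ᵥ x s) := by
  have h1 := (H.frame.mderiv (H.fst_mem _ hs)).mulVec hx
  have h2 := (h1.congr_of_eventuallyEq ((H.eventually_mem hs).mono fun t ht => hv t ht)).deriv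
  rw [← H.theta_eq hs, Matrix.mulVec_add, Matrix.mulVec_mulVec, add_comm]
  exact h2

theorem ds_col_zero : ds (fun p => (deform A ξ p).col 0) (s, 0) =
    A s *ᵥ ![theta A s 0 0, theta A s 1 0, 0, 0, 1, 0] := by
  rw [H.ds_eq_mulVec hs (x := fun _ => ![1, 0, 0, 0, 0, 0]) (fun t ht => ?_) (hasDerivAt_const _ _),
    kmat_mulVec]
  · congr 1; ext i; fin_cases i <;> simp
  · rw [H.deform_zero ht]; ext i; simp [Matrix.mulVec, dotProduct, Fin.sum_univ_six]

theorem ds_col_one : ds (fun p => (deform A ξ p).col 1) (s, 0) =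
    A s *ᵥ ![-theta A s 1 0, -theta A s 0 0, 0, 0, 0, -1] := by
  rw [H.ds_eq_mulVec hs (x := fun _ => ![0, 1, 0, 0, 0, 0]) (fun t ht => ?_) (hasDerivAt_const _ _),
    kmat_mulVec]
  · congr 1; ext i; fin_cases i <;> simp
  · rw [H.deform_zero ht]; ext i; simp [Matrix.mulVec, dotProduct, Fin.sum_univ_six]

theorem ds_ds_col_zero : ds (ds fun p => (deform A ξ p).col 0) (s, 0) =
    A s *ᵥ ![deriv (fun t => theta A t 0 0) s + theta A s 0 0 ^ 2 - theta A s 1 0 ^ 2 +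
      theta A s 0 4, deriv (fun t => theta A t 1 0) s, 1, 0, 2 * theta A s 0 0,
      -2 * theta A s 1 0] := by
  rw [H.ds_eq_mulVec hs (fun t ht => H.ds_col_zero ht) (hasDerivAt_vec (H.hasDerivAt_theta hs 0 0)
    (H.hasDerivAt_theta hs 1 0) (hasDerivAt_const _ _) (hasDerivAt_const _ _)
    (hasDerivAt_const _ _) (hasDerivAt_const _ _)), kmat_mulVec]
  congr 1; ext i; fin_cases i <;> simp <;> ring

theorem ds_ds_col_one : ds (ds fun p => (deform A ξ p).col 1) (s, 0) =
    A s *ᵥ ![-deriv (fun t => theta A t 1 0) s, -deriv (fun t => theta A t 0 0) s +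
      theta A s 0 0 ^ 2 - theta A s 1 0 ^ 2 + theta A s 0 4, 0, -1, -2 * theta A s 1 0,
      2 * theta A s 0 0] := by
  rw [H.ds_eq_mulVec hs (fun t ht => H.ds_col_one ht) (hasDerivAt_vec
    (H.hasDerivAt_theta hs 1 0).neg
    (H.hasDerivAt_theta hs 0 0).neg (hasDerivAt_const _ _) (hasDerivAt_const _ _)
    (hasDerivAt_const _ _) (hasDerivAt_const _ _)), kmat_mulVec]
  congr 1; ext i; fin_cases i <;> simp <;> ring

theorem du_xi (i : Fin 5) : HasDerivAt (fun u => ξ i (s, u)) (infin ξ i s) 0 :=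
  hasDerivAt_du H.isOpen (H.smooth i) hs

omit H hs in
theorem du_deform {j : Fin 6} {x : Fin 6 → ℝ}
    (hx : HasDerivAt (fun u => (chart fun i => ξ i (s, u)).col j) x 0) :
    du (fun p => (deform A ξ p).col j) (s, 0) = A s *ᵥ x := by
  have h1 := ((MDeriv.const (A s) (0 : ℝ)).mulVec hx).deriv
  rw [Matrix.zero_mulVec, zero_add] at h1
  rw [← h1]
  rfl

theorem du_col_zero : du (fun p => (deform A ξ p).col 0) (s, 0) =
    A s *ᵥ ![0, 0, infin ξ 0 s, infin ξ 1 s, infin ξ 4 s, 0] := by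
  have hz := fun i => H.zero i s hs
  have hd := H.du_xi hs
  refine du_deform (hasDerivAt_pi.2 fun i => ?_)
  fin_cases i
  · exact hasDerivAt_const _ _
  · exact hasDerivAt_const _ _
  · exact hd 0
  · exact hd 1
  · exact hd 4
  -- Quadratic chart entries do not contribute to first order, since `ξ` vanishes at `u = 0`.
  · exact ((((hd 0).pow 2).add ((hd 1).pow 2)).div_const 2).congr_deriv (by simp [hz])

theorem du_col_one : du (fun p => (deform A ξ p).col 1) (s, 0) =
    A s *ᵥ ![0, 0, infin ξ 2 s, infin ξ 3 s, 0, -infin ξ 4 s] := by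
  have hz := fun i => H.zero i s hs
  have hd := H.du_xi hs
  refine du_deform (hasDerivAt_pi.2 fun i => ?_)
  fin_cases i
  · exact hasDerivAt_const _ _
  · exact hasDerivAt_const _ _
  · exact hd 2
  · exact hd 3
  · exact ((((hd 2).pow 2).add ((hd 3).pow 2)).div_const 2).congr_deriv (by simp [hz])
  · exact ((((hd 0).mul (hd 2)).add ((hd 1).mul (hd 3))).sub (hd 4)).congr_deriv (by simp [hz])

theorem du_col_two : du (fun p => (deform A ξ p).col 2) (s, 0) =
    A s *ᵥ ![0, 0, 0, 0, infin ξ 2 s, infin ξ 0 s] := by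
  have hd := H.du_xi hs
  refine du_deform (hasDerivAt_pi.2 fun i => ?_)
  fin_cases i
  · exact hasDerivAt_const _ _
  · exact hasDerivAt_const _ _
  · exact hasDerivAt_const _ _
  · exact hasDerivAt_const _ _
  · exact hd 2
  · exact hd 0

theorem du_col_three : du (fun p => (deform A ξ p).col 3) (s, 0) =
    A s *ᵥ ![0, 0, 0, 0, infin ξ 3 s, infin ξ 1 s] := by
  have hd := H.du_xi hs
  refine du_deform (hasDerivAt_pi.2 fun i => ?_)
  fin_cases i
  · exact hasDerivAt_const _ _
  · exact hasDerivAt_const _ _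
  · exact hasDerivAt_const _ _
  · exact hasDerivAt_const _ _
  · exact hd 3
  · exact hd 1

/-- After exchanging the partial derivatives, the outer one is taken along the base curve, where it
is the ordinary derivative of the components plus the action of the curvature matrix. -/
theorem du_ds_col_zero : du (ds fun p => (deform A ξ p).col 0) (s, 0) =
    A s *ᵥ ![infin ξ 1 s + theta A s 0 4 * infin ξ 4 s, infin ξ 0 s,
      deriv (infin ξ 0) s - theta A s 3 2 * infin ξ 1 s + infin ξ 4 s,
      deriv (infin ξ 1) s + theta A s 3 2 * infin ξ 0 s,
      deriv (infin ξ 4) s + theta A s 0 0 * infin ξ 4 s, -theta A s 1 0 * infin ξ 4 s] := by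
  have hd := H.hasDerivAt_infin hs
  rw [du_ds_comm H.isOpen (H.smooth_col 0) hs, H.ds_eq_mulVec hs (fun t ht => H.du_col_zero ht)
    (hasDerivAt_vec (hasDerivAt_const _ _) (hasDerivAt_const _ _) (hd 0) (hd 1) (hd 4)
    (hasDerivAt_const _ _)), kmat_mulVec]
  congr 1; ext i; fin_cases i <;> simp <;> ring

theorem du_ds_col_one : du (ds fun p => (deform A ξ p).col 1) (s, 0) =
    A s *ᵥ ![infin ξ 3 s, infin ξ 2 s + theta A s 0 4 * infin ξ 4 s,
      deriv (infin ξ 2) s - theta A s 3 2 * infin ξ 3 s,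
      deriv (infin ξ 3) s + theta A s 3 2 * infin ξ 2 s - infin ξ 4 s,
      -theta A s 1 0 * infin ξ 4 s, -deriv (infin ξ 4) s + theta A s 0 0 * infin ξ 4 s] := by
  have hd := H.hasDerivAt_infin hs
  rw [du_ds_comm H.isOpen (H.smooth_col 1) hs, H.ds_eq_mulVec hs (fun t ht => H.du_col_one ht)
    (hasDerivAt_vec (hasDerivAt_const _ _) (hasDerivAt_const _ _) (hd 2) (hd 3)
    (hasDerivAt_const _ _) (hd 4).neg), kmat_mulVec]
  congr 1; ext i; fin_cases i <;> simp <;> ring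

end Deformation

/-- The boundary term of the first variation. -/
noncomputable def boundary (A : ℝ → Mat) (ξ : Fin 5 → ℝ × ℝ → ℝ) (s : ℝ) : ℝ :=
  deriv (infin ξ 0) s - 2 * theta A s 0 0 * infin ξ 0 s -
    2 * (theta A s 1 0 + theta A s 3 2) * (infin ξ 1 s + infin ξ 2 s) - deriv (infin ξ 3) s -
    2 * theta A s 0 0 * infin ξ 3 s + 3 * infin ξ 4 s

/-- The Euler–Lagrange operator of the first variation. -/
noncomputable def eulerLagrange (A : ℝ → Mat) (x : Fin 5 → ℝ) (s : ℝ) : ℝ :=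
  (theta A s 0 0 ^ 2 + deriv (fun t => theta A t 0 0) s - (theta A s 1 0 + theta A s 3 2) ^ 2 -
      theta A s 0 4) * x 0 +
    (2 * theta A s 0 0 * theta A s 3 2 + deriv (fun t => theta A t 1 0) s +
      deriv (fun t => theta A t 3 2) s) * x 1 +
    (-2 * theta A s 0 0 * theta A s 3 2 + deriv (fun t => theta A t 1 0) s +
      deriv (fun t => theta A t 3 2) s) * x 2 +
    (-theta A s 0 0 ^ 2 + deriv (fun t => theta A t 0 0) s + (theta A s 1 0 + theta A s 3 2) ^ 2 +
      theta A s 0 4) * x 3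

namespace Deformation

variable {γ : ℝ → Lam} {I : Set ℝ} {A : ℝ → Mat} {N : Set (ℝ × ℝ)} {ξ : Fin 5 → ℝ × ℝ → ℝ}
  (H : Deformation γ I A N ξ) {s : ℝ} (hs : (s, (0 : ℝ)) ∈ N)
include H hs

theorem col_eq : (deform A ξ (s, 0)).col 0 = A s *ᵥ ![1, 0, 0, 0, 0, 0] ∧
    (deform A ξ (s, 0)).col 1 = A s *ᵥ ![0, 1, 0, 0, 0, 0] ∧
    (deform A ξ (s, 0)).col 2 = A s *ᵥ ![0, 0, 1, 0, 0, 0] ∧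
    (deform A ξ (s, 0)).col 3 = A s *ᵥ ![0, 0, 0, 1, 0, 0] := by
  rw [H.deform_zero hs]
  refine ⟨?_, ?_, ?_, ?_⟩ <;> ext i <;> simp [Matrix.mulVec, dotProduct, Fin.sum_univ_six]

theorem base_orth : form (ds (fun p => (deform A ξ p).col 0) (s, 0))
      ((deform A ξ (s, 0)).col 1) = -1 ∧
    form ((deform A ξ (s, 0)).col 2) (ds (fun p => (deform A ξ p).col 0) (s, 0)) = 0 ∧
    form ((deform A ξ (s, 0)).col 2) (ds (fun p => (deform A ξ p).col 1) (s, 0)) = 0 ∧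
    form ((deform A ξ (s, 0)).col 3) (ds (fun p => (deform A ξ p).col 0) (s, 0)) = 0 ∧
    form ((deform A ξ (s, 0)).col 3) (ds (fun p => (deform A ξ p).col 1) (s, 0)) = 0 := by
  have hO := H.frame.mem_Oh (H.fst_mem _ hs)
  obtain ⟨c0, c1, c2, c3⟩ := H.col_eq hs
  rw [H.ds_col_zero hs, H.ds_col_one hs, c1, c2, c3]
  simp only [form_mulVec hO]
  simp [form_eq]

theorem sec_two : sec (fun p => (deform A ξ p).col 0) (fun p => (deform A ξ p).col 1)
    (fun p => (deform A ξ p).col 2) (s, 0) = A s *ᵥ ![0, 0, 1, 0, 0, 0] := by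
  obtain ⟨h1, h2, h3, h4, h5⟩ := H.base_orth hs
  rw [sec, h2, h3, (H.col_eq hs).2.2.1]; simp

theorem sec_three : sec (fun p => (deform A ξ p).col 0) (fun p => (deform A ξ p).col 1)
    (fun p => (deform A ξ p).col 3) (s, 0) = A s *ᵥ ![0, 0, 0, 1, 0, 0] := by
  obtain ⟨h1, h2, h3, h4, h5⟩ := H.base_orth hs
  rw [sec, h4, h5, (H.col_eq hs).2.2.2]; simp

theorem du_ds_ds_two : form (A s *ᵥ ![0, 0, 1, 0, 0, 0])
    (du (ds (ds fun p => (deform A ξ p).col 0)) (s, 0)) =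
      deriv (deriv (infin ξ 0)) s - deriv (fun t => theta A t 3 2) s * infin ξ 1 s -
      2 * theta A s 3 2 * deriv (infin ξ 1) s + 2 * deriv (infin ξ 4) s -
      theta A s 3 2 ^ 2 * infin ξ 0 s + theta A s 0 0 * infin ξ 4 s := by
  have hO := H.frame.mem_Oh (H.fst_mem _ hs)
  have hd := H.hasDerivAt_infin hs
  have hdd := H.hasDerivAt_deriv_infin hs
  have ht := H.hasDerivAt_theta hs
  have h1 := H.ds_eq_mulVec hs (fun t ht => H.du_ds_col_zero ht)
    (hasDerivAt_vec ((hd 1).add ((ht 0 4).mul (hd 4))) (hd 0)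
    (((hdd 0).sub ((ht 3 2).mul (hd 1))).add (hd 4)) ((hdd 1).add ((ht 3 2).mul (hd 0)))
    ((hdd 4).add ((ht 0 0).mul (hd 4))) ((ht 1 0).neg.mul (hd 4)))
  rw [du_ds_comm H.isOpen (contDiffOn_ds H.isOpen (H.smooth_col 0)) hs, h1, form_mulVec hO,
    kmat_mulVec]
  simp [form_eq]
  ring

theorem du_ds_ds_three : form (A s *ᵥ ![0, 0, 0, 1, 0, 0])
    (du (ds (ds fun p => (deform A ξ p).col 1)) (s, 0)) =
      deriv (deriv (infin ξ 3)) s + deriv (fun t => theta A t 3 2) s * infin ξ 2 s +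
      2 * theta A s 3 2 * deriv (infin ξ 2) s - 2 * deriv (infin ξ 4) s -
      theta A s 3 2 ^ 2 * infin ξ 3 s + theta A s 0 0 * infin ξ 4 s := by
  have hO := H.frame.mem_Oh (H.fst_mem _ hs)
  have hd := H.hasDerivAt_infin hs
  have hdd := H.hasDerivAt_deriv_infin hs
  have ht := H.hasDerivAt_theta hs
  have h1 := H.ds_eq_mulVec hs (fun t ht => H.du_ds_col_one ht)
    (hasDerivAt_vec (hd 3) ((hd 2).add ((ht 0 4).mul (hd 4)))
    ((hdd 2).sub ((ht 3 2).mul (hd 3))) (((hdd 3).add ((ht 3 2).mul (hd 2))).sub (hd 4))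
    ((ht 1 0).neg.mul (hd 4)) ((hdd 4).neg.add ((ht 0 0).mul (hd 4))))
  rw [du_ds_comm H.isOpen (contDiffOn_ds H.isOpen (H.smooth_col 1)) hs, h1, form_mulVec hO,
    kmat_mulVec]
  simp [form_eq]
  ring

theorem hasDerivAt_boundary : HasDerivAt (boundary A ξ)
    (deriv (deriv (infin ξ 0)) s -
      2 * (deriv (fun t => theta A t 0 0) s * infin ξ 0 s +
        theta A s 0 0 * deriv (infin ξ 0) s) -
      2 * ((deriv (fun t => theta A t 1 0) s + deriv (fun t => theta A t 3 2) s) *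
          (infin ξ 1 s + infin ξ 2 s) +
        (theta A s 1 0 + theta A s 3 2) * (deriv (infin ξ 1) s + deriv (infin ξ 2) s)) -
      deriv (deriv (infin ξ 3)) s -
      2 * (deriv (fun t => theta A t 0 0) s * infin ξ 3 s +
        theta A s 0 0 * deriv (infin ξ 3) s) + 3 * deriv (infin ξ 4) s) s := by
  have hd := H.hasDerivAt_infin hs
  have hdd := H.hasDerivAt_deriv_infin hs
  have ht := H.hasDerivAt_theta hs
  refine HasDerivAt.congr_deriv ((((((hdd 0).sub (((ht 0 0).const_mul 2).mul (hd 0))).sub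
    ((((ht 1 0).add (ht 3 2)).const_mul 2).mul ((hd 1).add (hd 2)))).sub (hdd 3)).sub
    (((ht 0 0).const_mul 2).mul (hd 3))).add ((hd 4).const_mul 3)) ?_
  simp only [Pi.add_apply]
  ring

end Deformation

section

variable {γ : ℝ → Lam} {I : Set ℝ} {A : ℝ → Mat} {N : Set (ℝ × ℝ)} {ξ : Fin 5 → ℝ × ℝ → ℝ}

/-- The speed of a deformation. -/
noncomputable def deformSpeed (A : ℝ → Mat) (ξ : Fin 5 → ℝ × ℝ → ℝ) (p : ℝ × ℝ) : ℝ :=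
  normMu (fun p => (deform A ξ p).col 0) (fun p => (deform A ξ p).col 1)
      (sec (fun p => (deform A ξ p).col 0) (fun p => (deform A ξ p).col 1)
        fun p => (deform A ξ p).col 2)
      (sec (fun p => (deform A ξ p).col 0) (fun p => (deform A ξ p).col 1)
        fun p => (deform A ξ p).col 3) p *
    -form (ds (fun p => (deform A ξ p).col 0) p) ((deform A ξ p).col 1)

/-- The second fundamental form of a deformation. -/
noncomputable def deformDet (A : ℝ → Mat) (ξ : Fin 5 → ℝ × ℝ → ℝ) (p : ℝ × ℝ) : ℝ :=
  detK (fun p => (deform A ξ p).col 0) (fun p => (deform A ξ p).col 1)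
      (sec (fun p => (deform A ξ p).col 0) (fun p => (deform A ξ p).col 1)
        fun p => (deform A ξ p).col 2)
      (sec (fun p => (deform A ξ p).col 0) (fun p => (deform A ξ p).col 1)
        fun p => (deform A ξ p).col 3) p

theorem form_two (a b c d e f : ℝ) : form ![0, 0, 1, 0, 0, 0] ![a, b, c, d, e, f] = c := by
  simp [form_eq]

theorem form_three (a b c d e f : ℝ) : form ![0, 0, 0, 1, 0, 0] ![a, b, c, d, e, f] = d := by
  simp [form_eq]

/-- Orthogonality turns `⟨c_s, a_s⟩` into `-⟨c, a_ss⟩`, and the middle components of `a_ss` and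
`b_ss` along the base curve are `(1, 0)` and `(0, -1)`. So `det K = -1` at `u = 0`, and the sign
condition persists nearby. -/
theorem Deformation.second_form (H : Deformation γ I A N ξ)
    (hneg : ∀ p ∈ N, form (ds (fun q => (deform A ξ q).col 0) p) ((deform A ξ p).col 1) < 0)
    {s : ℝ} (hs : (s, (0 : ℝ)) ∈ N) {c d : ℝ × ℝ → Fin 6 → ℝ}
    (hc : sec (fun q => (deform A ξ q).col 0) (fun q => (deform A ξ q).col 1)
      (fun q => (deform A ξ q).col 2) = c)
    (hd : sec (fun q => (deform A ξ q).col 0) (fun q => (deform A ξ q).col 1)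
      (fun q => (deform A ξ q).col 3) = d) :
    form (ds c (s, 0)) (ds (fun q => (deform A ξ q).col 0) (s, 0)) = -1 ∧
    form (ds c (s, 0)) (ds (fun q => (deform A ξ q).col 1) (s, 0)) = 0 ∧
    form (ds d (s, 0)) (ds (fun q => (deform A ξ q).col 0) (s, 0)) = 0 ∧
    form (ds d (s, 0)) (ds (fun q => (deform A ξ q).col 1) (s, 0)) = 1 := by
  have hO := H.frame.mem_Oh (H.fst_mem _ hs)
  have hP := preAdapted_of_family H.isOpen H.smooth_deform (fun _ hp => H.mem_Oh hp) hneg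
  have hc' := form_ds_of_const H.isOpen hP.sc (contDiffOn_ds H.isOpen hP.sa) hs hP.ca'
  have hcb' := form_ds_of_const H.isOpen hP.sc (contDiffOn_ds H.isOpen hP.sb) hs hP.cb'
  have hd' := form_ds_of_const H.isOpen hP.sd (contDiffOn_ds H.isOpen hP.sa) hs hP.da'
  have hdb' := form_ds_of_const H.isOpen hP.sd (contDiffOn_ds H.isOpen hP.sb) hs hP.db'
  rw [H.sec_two hs, H.ds_ds_col_zero hs, form_mulVec hO, form_two, hc] at hc'
  rw [H.sec_two hs, H.ds_ds_col_one hs, form_mulVec hO, form_two, hc] at hcb'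
  rw [H.sec_three hs, H.ds_ds_col_zero hs, form_mulVec hO, form_three, hd] at hd'
  rw [H.sec_three hs, H.ds_ds_col_one hs, form_mulVec hO, form_three, hd] at hdb'
  exact ⟨by linarith, by linarith, by linarith, by linarith⟩

/-- A deformation with nondegenerate speed and second fundamental form of the correct sign. -/
structure RegularDeformation (γ : ℝ → Lam) (I : Set ℝ) (A : ℝ → Mat) (N : Set (ℝ × ℝ))
    (ξ : Fin 5 → ℝ × ℝ → ℝ) : Prop extends Deformation γ I A N ξ where
  neg : ∀ p ∈ N, form (ds (fun q => (deform A ξ q).col 0) p) ((deform A ξ p).col 1) < 0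
  det_neg : ∀ p ∈ N, deformDet A ξ p < 0

namespace RegularDeformation

variable (H : RegularDeformation γ I A N ξ)
include H

theorem preAdapted : PreAdapted N (fun q => (deform A ξ q).col 0) (fun q => (deform A ξ q).col 1)
    (sec (fun q => (deform A ξ q).col 0) (fun q => (deform A ξ q).col 1)
      fun q => (deform A ξ q).col 2)
    (sec (fun q => (deform A ξ q).col 0) (fun q => (deform A ξ q).col 1)
      fun q => (deform A ξ q).col 3) :=
  preAdapted_of_family H.isOpen H.smooth_deform (fun _ hp => H.mem_Oh hp) H.neg

/-- This is the first variation before integration. The factor 3 comes from the cube in the speed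
formula. All derivatives of the infinitesimal variation are absorbed in `boundary`; the contact
component `ξ 4` occurs only there. -/
theorem du_speed {s : ℝ} (hs : (s, (0 : ℝ)) ∈ N) : HasDerivAt (boundary A ξ)
    (3 * du (deformSpeed A ξ) (s, 0) - eulerLagrange A (fun i => infin ξ i s) s) s := by
  have hD := H.toDeformation
  have hO := H.frame.mem_Oh (H.fst_mem _ hs)
  have hP := H.preAdapted
  obtain ⟨h1, h2, h3, h4, h5⟩ := hD.base_orth hs
  obtain ⟨k1, k2, k3, k4⟩ := hD.second_form H.neg hs rfl rfl
  have key := hP.du_speed H.det_neg hs h1 k1 k2 k3 k4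
  change 3 * du (deformSpeed A ξ) (s, 0) = _ at key
  have s2 := du_sec H.isOpen hP.sa hP.sb (hD.smooth_col 2) hs h1 h2 h3
  have s3 := du_sec H.isOpen hP.sa hP.sb (hD.smooth_col 3) hs h1 h4 h5
  obtain ⟨c0, c1, c2, c3⟩ := hD.col_eq hs
  rw [s2, s3, hD.sec_two hs, hD.sec_three hs, hD.du_ds_ds_two hs, hD.du_ds_ds_three hs] at key
  simp only [form_add_left, form_sub_left, form_smul_left, hD.ds_col_zero hs, hD.ds_col_one hs,
    hD.ds_ds_col_zero hs, hD.ds_ds_col_one hs, hD.du_col_zero hs, hD.du_col_one hs,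
    hD.du_col_two hs, hD.du_col_three hs, hD.du_ds_col_zero hs, hD.du_ds_col_one hs, c0, c1, c2, c3,
    form_mulVec hO] at key
  generalize du (deformSpeed A ξ) (s, 0) = D at key ⊢
  simp [form_eq] at key
  refine (hD.hasDerivAt_boundary hs).congr_deriv ?_
  rw [key, eulerLagrange]
  ring

end RegularDeformation

end

/-! ### Third order frames along the deformed curves and the first variation formula. -/

theorem mkFrame_base {A : Mat} (hA : A ∈ Oh) (k₁ k₂ : ℝ) :
    mkFrame (A *ᵥ ![1, 0, 0, 0, 0, 0]) (A *ᵥ ![0, 1, 0, 0, 0, 0]) (A *ᵥ ![0, 0, 1, 0, 0, 0])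
      (A *ᵥ ![0, 0, 0, 1, 0, 0]) (A *ᵥ ![k₁, k₂, 0, 0, 1, 0]) (A *ᵥ ![-k₂, -k₁, 0, 0, 0, -1]) =
      A := by
  have hcol : ∀ j, A.col j = A *ᵥ Pi.single j 1 := fun j => by simp
  obtain ⟨e0, e1, e2, e3, e4, e5⟩ := mkFrame_col (a := A *ᵥ ![1, 0, 0, 0, 0, 0])
    (b := A *ᵥ ![0, 1, 0, 0, 0, 0]) (c := A *ᵥ ![0, 0, 1, 0, 0, 0])
    (d := A *ᵥ ![0, 0, 0, 1, 0, 0]) (a' := A *ᵥ ![k₁, k₂, 0, 0, 1, 0])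
    (b' := A *ᵥ ![-k₂, -k₁, 0, 0, 0, -1])
  simp only [form_mulVec hA, ← Matrix.mulVec_smul, ← Matrix.mulVec_add, ← Matrix.mulVec_sub]
    at e4 e5
  have key : ∀ j, (mkFrame (A *ᵥ ![1, 0, 0, 0, 0, 0]) (A *ᵥ ![0, 1, 0, 0, 0, 0])
      (A *ᵥ ![0, 0, 1, 0, 0, 0]) (A *ᵥ ![0, 0, 0, 1, 0, 0]) (A *ᵥ ![k₁, k₂, 0, 0, 1, 0])
      (A *ᵥ ![-k₂, -k₁, 0, 0, 0, -1])).col j = A.col j := by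
    intro j
    rw [hcol]
    fin_cases j
    · refine e0.trans (congrArg _ ?_)
      ext i; fin_cases i <;> simp
    · refine e1.trans (congrArg _ ?_)
      ext i; fin_cases i <;> simp
    · refine e2.trans (congrArg _ ?_)
      ext i; fin_cases i <;> simp
    · refine e3.trans (congrArg _ ?_)
      ext i; fin_cases i <;> simp
    · refine e4.trans (congrArg _ ?_)
      ext i; fin_cases i <;> simp [form_eq]
    · refine e5.trans (congrArg _ ?_)
      ext i; fin_cases i <;> simp [form_eq]
  ext i j
  exact congrFun (key j) i

theorem ds_congr_slice {E : Type*} [NormedAddCommGroup E] [NormedSpace ℝ E] {v w : ℝ × ℝ → E}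
    {s : ℝ} (hvw : ∀ᶠ t in 𝓝 s, v (t, 0) = w (t, 0)) : ds v (s, 0) = ds w (s, 0) :=
  Filter.EventuallyEq.deriv_eq hvw

section

variable {γ : ℝ → Lam} {I : Set ℝ} {A : ℝ → Mat} {N : Set (ℝ × ℝ)} {ξ : Fin 5 → ℝ × ℝ → ℝ}

/-- The third order frames along the curves of a regular deformation. -/
noncomputable def deformFrame (A : ℝ → Mat) (ξ : Fin 5 → ℝ × ℝ → ℝ) : ℝ × ℝ → Mat :=
  frameFam
    (normA (fun q => (deform A ξ q).col 0) (fun q => (deform A ξ q).col 1)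
      (sec (fun q => (deform A ξ q).col 0) (fun q => (deform A ξ q).col 1)
        fun q => (deform A ξ q).col 2)
      (sec (fun q => (deform A ξ q).col 0) (fun q => (deform A ξ q).col 1)
        fun q => (deform A ξ q).col 3))
    (normB (fun q => (deform A ξ q).col 0) (fun q => (deform A ξ q).col 1)
      (sec (fun q => (deform A ξ q).col 0) (fun q => (deform A ξ q).col 1)
        fun q => (deform A ξ q).col 2)
      (sec (fun q => (deform A ξ q).col 0) (fun q => (deform A ξ q).col 1)
        fun q => (deform A ξ q).col 3))
    (sec (fun q => (deform A ξ q).col 0) (fun q => (deform A ξ q).col 1)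
      fun q => (deform A ξ q).col 2)
    (sec (fun q => (deform A ξ q).col 0) (fun q => (deform A ξ q).col 1)
      fun q => (deform A ξ q).col 3)

theorem Deformation.continuousOn_neg (H : Deformation γ I A N ξ) : ContinuousOn
    (fun p => form (ds (fun q => (deform A ξ q).col 0) p) ((deform A ξ p).col 1)) N :=
  (contDiffOn_form (contDiffOn_ds H.isOpen (H.smooth_col 0)) (H.smooth_col 1)).continuousOn

theorem Deformation.exists_regular (H : Deformation γ I A N ξ) {s : ℝ}
    (hs : (s, (0 : ℝ)) ∈ N) : ∃ N' ⊆ N, (s, (0 : ℝ)) ∈ N' ∧ RegularDeformation γ I A N' ξ := by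
  obtain ⟨N₁, hN₁, hsub₁, hs₁, hneg⟩ : ∃ N₁, IsOpen N₁ ∧ N₁ ⊆ N ∧ (s, (0 : ℝ)) ∈ N₁ ∧
      ∀ p ∈ N₁, form (ds (fun q => (deform A ξ q).col 0) p) ((deform A ξ p).col 1) < 0 := by
    refine ⟨_, H.continuousOn_neg.isOpen_inter_preimage H.isOpen (isOpen_Iio (a := 0)),
      Set.inter_subset_left, ⟨hs, ?_⟩, fun p hp => hp.2⟩
    change form _ _ < 0
    rw [(H.base_orth hs).1]
    norm_num
  have H₁ := H.mono hN₁ hsub₁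
  have hP := preAdapted_of_family H₁.isOpen H₁.smooth_deform (fun _ hp => H₁.mem_Oh hp) hneg
  have hop := (contDiffOn_detK hP).continuousOn.isOpen_inter_preimage hN₁ (isOpen_Iio (a := 0))
  refine ⟨_, Set.inter_subset_left.trans hsub₁, ⟨hs₁, ?_⟩,
    H₁.mono hop Set.inter_subset_left, fun p hp => hneg p hp.1, fun p hp => hp.2⟩
  obtain ⟨k1, k2, k3, k4⟩ := H₁.second_form hneg hs₁ rfl rfl
  change detK _ _ _ _ _ < 0
  rw [detK, k1, k2, k3, k4]
  norm_num

namespace RegularDeformation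

variable (H : RegularDeformation γ I A N ξ)
include H

theorem mono {N' : Set (ℝ × ℝ)} (hN' : IsOpen N') (hsub : N' ⊆ N) :
    RegularDeformation γ I A N' ξ :=
  ⟨H.toDeformation.mono hN' hsub, fun p hp => H.neg p (hsub hp),
    fun p hp => H.det_neg p (hsub hp)⟩

theorem contDiffOn_speed : ContDiffOn ℝ ∞ (deformSpeed A ξ) N :=
  (contDiffOn_normMu H.preAdapted H.det_neg).mul
    (contDiffOn_form (contDiffOn_ds H.isOpen H.preAdapted.sa) H.preAdapted.sb).neg

theorem smooth_frame (i j : Fin 6) : ContDiffOn ℝ ∞ (fun p => deformFrame A ξ p i j) N :=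
  (adapted_norm H.preAdapted H.det_neg).1.smooth i j

theorem frame_mem_Oh {p : ℝ × ℝ} (hp : p ∈ N) : deformFrame A ξ p ∈ Oh :=
  (adapted_norm H.preAdapted H.det_neg).1.mem_Oh hp

theorem theta_frame {p : ℝ × ℝ} (hp : p ∈ N) :
    theta (fun s => deformFrame A ξ (s, p.2)) p.1 4 0 = deformSpeed A ξ p := by
  obtain ⟨h1, h2, -⟩ := adapted_norm H.preAdapted H.det_neg
  rw [deformSpeed, mul_neg, ← h2 p hp]
  exact h1.theta_four_zero hp

theorem isThirdOrder {V : ℝ × ℝ → Lam} (hV : ∀ p ∈ N, (V p).plane = act (deform A ξ p) origin)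
    (hG : ∀ p ∈ N, deformFrame A ξ p ∈ G) {U : Set ℝ} (hU : IsOpen U) {u : ℝ}
    (hUN : ∀ s ∈ U, (s, u) ∈ N) :
    IsThirdOrder (fun s => V (s, u)) U (fun s => deformFrame A ξ (s, u)) := by
  obtain ⟨h1, -, h3⟩ := adapted_norm H.preAdapted H.det_neg
  refine h1.isThirdOrder (fun p hp => ?_) hG hU hUN
  rw [hV p hp, h3 p hp, act_origin]

/-- At `u = 0` the normalization is trivial, since `μ = 1` and `K = diag(-1, 1)`. The identity
anchors the constructed frames at a point known to lie in `G`. -/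
theorem frame_zero {s : ℝ} (hs : (s, (0 : ℝ)) ∈ N) : deformFrame A ξ (s, 0) = A s := by
  have hD := H.toDeformation
  have hcoef : ∀ t, (t, (0 : ℝ)) ∈ N → normA (fun q => (deform A ξ q).col 0)
      (fun q => (deform A ξ q).col 1)
      (sec (fun q => (deform A ξ q).col 0) (fun q => (deform A ξ q).col 1)
        fun q => (deform A ξ q).col 2)
      (sec (fun q => (deform A ξ q).col 0) (fun q => (deform A ξ q).col 1)
        fun q => (deform A ξ q).col 3) (t, 0) = (deform A ξ (t, 0)).col 0 ∧
      normB (fun q => (deform A ξ q).col 0)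
      (fun q => (deform A ξ q).col 1)
      (sec (fun q => (deform A ξ q).col 0) (fun q => (deform A ξ q).col 1)
        fun q => (deform A ξ q).col 2)
      (sec (fun q => (deform A ξ q).col 0) (fun q => (deform A ξ q).col 1)
        fun q => (deform A ξ q).col 3) (t, 0) = (deform A ξ (t, 0)).col 1 := fun t ht => by
    obtain ⟨k1, k2, k3, k4⟩ := hD.second_form H.neg ht rfl rfl
    obtain ⟨h1, -⟩ := hD.base_orth ht
    obtain ⟨m1, m2⟩ := normMu_spec H.preAdapted H.det_neg ht
    rw [detK, h1, k1, k2, k3, k4] at m2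
    have m3 : normMu _ _ _ _ (t, (0 : ℝ)) = 1 :=
      (pow_eq_one_iff_of_nonneg m1.le (by norm_num : (3 : ℕ) ≠ 0)).1 (by linarith)
    rw [normA, normB, normCoef, m3, h1, k1, k2, k3, k4]
    norm_num
  have hev := hD.eventually_mem hs
  rw [deformFrame, frameFam,
    ds_congr_slice (w := fun q => (deform A ξ q).col 0) (hev.mono fun t ht => (hcoef t ht).1),
    ds_congr_slice (w := fun q => (deform A ξ q).col 1) (hev.mono fun t ht => (hcoef t ht).2),
    (hcoef s hs).1, (hcoef s hs).2,
    hD.sec_two hs, hD.sec_three hs, hD.ds_col_zero hs, hD.ds_col_one hs, (hD.col_eq hs).1,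
    (hD.col_eq hs).2.1]
  exact mkFrame_base (H.frame.mem_Oh (H.fst_mem _ hs)) _ _

end RegularDeformation

theorem exists_box {N : Set (ℝ × ℝ)} (hN : IsOpen N) {s : ℝ} (hs : (s, (0 : ℝ)) ∈ N) :
    ∃ δ > 0, Metric.ball s δ ×ˢ Set.Ioo (-δ) δ ⊆ N := by
  obtain ⟨δ, hδ, hsub⟩ := Metric.isOpen_iff.1 hN _ hs
  refine ⟨δ, hδ, ?_⟩
  rwa [← ball_prod_same, Real.ball_eq_Ioo 0, zero_sub, zero_add] at hsub

/-- Near a point of the base curve, the curves of a deformation have third order frame fields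
with `p² + q² > 0`. -/
theorem Deformation.exists_thirdOrder (H : Deformation γ I A N ξ) {s : ℝ}
    (hs : (s, (0 : ℝ)) ∈ N) (hκ : theta A s 0 0 ≠ 0) {V : ℝ × ℝ → Lam}
    (hV : ∀ p ∈ N, (V p).plane = act (deform A ξ p) origin) :
    ∃ δ > 0, Metric.ball s δ ×ˢ Set.Ioo (-δ) δ ⊆ N ∧
      RegularDeformation γ I A (Metric.ball s δ ×ˢ Set.Ioo (-δ) δ) ξ ∧
      ∀ u ∈ Set.Ioo (-δ) δ, IsThirdOrder (fun t => V (t, u)) (Metric.ball s δ)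
          (fun t => deformFrame A ξ (t, u)) ∧
        ∀ t ∈ Metric.ball s δ, 0 < coefP (fun t => deformFrame A ξ (t, u)) t ^ 2 +
          coefQ (fun t => deformFrame A ξ (t, u)) t ^ 2 := by
  obtain ⟨N₁, hsub₁, hs₁, H₁⟩ := H.exists_regular hs
  obtain ⟨r, hr, hrN⟩ := exists_box H₁.isOpen hs₁
  set K := Metric.ball s r ×ˢ Set.Ioo (-r) r with hK
  have hKo : IsOpen K := Metric.isOpen_ball.prod isOpen_Ioo
  have hsK : (s, (0 : ℝ)) ∈ K := ⟨Metric.mem_ball_self hr, by simpa⟩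
  have H₂ := H₁.mono hKo hrN
  have hpre : IsPreconnected K :=
    ((convex_ball s r).prod (convex_Ioo (-r) r)).isPreconnected
  -- The box is connected and contains `(s, 0)`, where the frame is `A s`.
  have hG : ∀ p ∈ K, deformFrame A ξ p ∈ G := fun p hp =>
    mem_G_of_continuousOn hpre (fun i j => (H₂.smooth_frame i j).continuousOn)
      (fun x hx => H₂.frame_mem_Oh hx) hsK
      (by rw [H₂.frame_zero hsK]; exact H.frame.mem s (H.fst_mem _ hs)) hp
  have h3 : ∀ {ρ : ℝ}, ρ ≤ r → ∀ u ∈ Set.Ioo (-ρ) ρ, IsThirdOrder (fun t => V (t, u))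
      (Metric.ball s ρ) (fun t => deformFrame A ξ (t, u)) := fun hρ u hu =>
    H₂.isThirdOrder (fun p hp => hV p (hsub₁ (hrN hp))) hG Metric.isOpen_ball fun t ht =>
      ⟨Metric.ball_subset_ball hρ ht, by linarith [hu.1], by linarith [hu.2]⟩
  have hpos : ∀ p ∈ K, theta (fun s => deformFrame A ξ (s, p.2)) p.1 4 0 ≠ 0 := fun p hp =>
    ((h3 le_rfl p.2 hp.2).pos p.1 hp.1).ne'
  have hc : ContinuousOn (fun p : ℝ × ℝ => coefP (fun t => deformFrame A ξ (t, p.2)) p.1 ^ 2 +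
      coefQ (fun t => deformFrame A ξ (t, p.2)) p.1 ^ 2) K := by
    have hθ := fun i j => (contDiffOn_theta_slice hKo H₂.smooth_frame
      (fun p hp => H₂.frame_mem_Oh hp) i j).continuousOn
    exact (((((hθ 0 1).add (hθ 1 0)).div_const 2).div (hθ 4 0) hpos).pow 2).add
      (((hθ 1 1).div (hθ 4 0) hpos).pow 2)
  have hop := hc.isOpen_inter_preimage hKo (isOpen_Ioi (a := 0))
  have hmem : (s, (0 : ℝ)) ∈ K ∩ (fun p : ℝ × ℝ =>
      coefP (fun t => deformFrame A ξ (t, p.2)) p.1 ^ 2 +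
      coefQ (fun t => deformFrame A ξ (t, p.2)) p.1 ^ 2) ⁻¹' Set.Ioi 0 := by
    refine ⟨hsK, ?_⟩
    have hsI := H.fst_mem _ hs
    have hb : Metric.ball s r ⊆ I := fun t ht => H₂.fst_mem (t, 0) ⟨ht, by simpa⟩
    have hV0 : ∀ t ∈ Metric.ball s r, γ t = V (t, 0) := fun t ht => by
      have hN : (t, (0 : ℝ)) ∈ N := hsub₁ (hrN ⟨ht, by simpa⟩)
      apply Subtype.ext
      change (γ t).plane = (V (t, 0)).plane
      rw [hV _ hN, H.deform_zero hN]
      exact H.frame.proj t (hb ht)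
    have h30 := (h3 le_rfl 0 (by simpa)).congr_curve hV0
    change 0 < coefP (fun t => deformFrame A ξ (t, 0)) s ^ 2 +
      coefQ (fun t => deformFrame A ξ (t, 0)) s ^ 2
    rw [h30.coef_eq H.frame.toIsThirdOrder (Metric.mem_ball_self hr) hsI, H.frame.p_zero s hsI,
      coefQ, H.arc s hsI]
    have : theta A s 1 1 ≠ 0 := fun h0 => hκ (by linarith [H.frame.trace_zero s hsI])
    positivity
  obtain ⟨δ, hδ, hsub⟩ := exists_box hop hmem
  have hδr : Metric.ball s δ ×ˢ Set.Ioo (-δ) δ ⊆ K := hsub.trans Set.inter_subset_left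
  refine ⟨δ, hδ, (hδr.trans hrN).trans hsub₁, H₂.mono (Metric.isOpen_ball.prod isOpen_Ioo) hδr,
    fun u hu => ⟨?_, fun t ht => (hsub (Set.mk_mem_prod ht hu)).2⟩⟩
  exact H₂.isThirdOrder (fun p hp => hV p (hsub₁ (hrN hp))) hG Metric.isOpen_ball
    fun t ht => hδr ⟨ht, hu⟩

end

section

variable {γ : ℝ → Lam} {I : Set ℝ} {A : ℝ → Mat} {ξ : Fin 5 → ℝ × ℝ → ℝ}

theorem Deformation.continuousAt_eulerLagrange {N : Set (ℝ × ℝ)} (H : Deformation γ I A N ξ) {s : ℝ}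
    (hs : (s, (0 : ℝ)) ∈ N) :
    ContinuousAt (fun s => eulerLagrange A (fun i => infin ξ i s) s) s := by
  have h1 := fun i => (H.hasDerivAt_infin hs i).continuousAt
  have h2 := fun i j => (H.hasDerivAt_theta hs i j).continuousAt
  have h3 : ∀ i j, ContinuousAt (deriv fun t => theta A t i j) s := fun i j =>
    ((H.frame.contDiffOn_theta i j).deriv_of_isOpen (m := ∞) H.frame.isOpen
      (by simp)).continuousOn.continuousAt (H.frame.isOpen.mem_nhds (H.fst_mem _ hs))
  have h4 : ∀ i j, ContinuousAt (fun s => deriv (fun t => theta A t i j) s) s := h3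
  unfold eulerLagrange
  fun_prop

/-- The first variation formula. -/
theorem first_variation {V : ℝ × ℝ → Lam} {a b : ℝ} (hab : a ≤ b)
    (hH : ∀ s ∈ Set.Icc a b, ∃ N, (s, (0 : ℝ)) ∈ N ∧ Deformation γ I A N ξ ∧
      ∀ p ∈ N, (V p).plane = act (deform A ξ p) origin)
    (hκ : ∀ s ∈ Set.Icc a b, theta A s 0 0 ≠ 0) :
    HasDerivAt (fun u => ∫ s in a..b, lieSpeed (fun t => V (t, u)) s)
      ((boundary A ξ b - boundary A ξ a +
        ∫ s in a..b, eulerLagrange A (fun i => infin ξ i s) s) / 3) 0 := by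
  set F : ℝ × ℝ → ℝ := fun p => lieSpeed (fun t => V (t, p.2)) p.1 with hF
  -- Smoothness of `lieSpeed` in `(s, u)` is invisible from its definition by choice. It is obtained
  -- from `deformSpeed`, with which it coincides near every base point.
  have hloc : ∀ s ∈ Set.Icc a b, ∃ N, (s, (0 : ℝ)) ∈ N ∧ RegularDeformation γ I A N ξ ∧
      ∀ p ∈ N, F p = deformSpeed A ξ p := fun s hs => by
    obtain ⟨N, hsN, H, hV⟩ := hH s hs
    obtain ⟨δ, hδ, hsub, HR, h3⟩ := H.exists_thirdOrder hsN (hκ s hs) hV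
    refine ⟨_, Set.mk_mem_prod (Metric.mem_ball_self hδ) (by simpa), HR, fun p hp => ?_⟩
    rw [← HR.theta_frame hp]
    exact ((h3 p.2 hp.2).1.toIsSecondOrder).lieSpeed_eq hp.1
  have hsm : ∀ s ∈ Set.Icc a b, ∃ N, IsOpen N ∧ (s, (0 : ℝ)) ∈ N ∧ ContDiffOn ℝ ∞ F N :=
    fun s hs => by
    obtain ⟨N, hsN, H, hN⟩ := hloc s hs
    exact ⟨N, H.isOpen, hsN, H.contDiffOn_speed.congr hN⟩
  have hderiv : ∀ s ∈ Set.Icc a b, HasDerivAt (boundary A ξ)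
      (3 * du F (s, 0) - eulerLagrange A (fun i => infin ξ i s) s) s := fun s hs => by
    obtain ⟨N, hsN, H, hN⟩ := hloc s hs
    rw [du_congr H.isOpen hN hsN]
    exact H.du_speed hsN
  have hdu : ContinuousOn (fun s => du F (s, 0)) (Set.Icc a b) := fun s hs => by
    obtain ⟨N, hNo, hsN, hN⟩ := hsm s hs
    have h1 := (contDiffOn_du hNo hN).continuousOn.continuousAt (hNo.mem_nhds hsN)
    exact (ContinuousAt.comp (f := fun s : ℝ => (s, (0 : ℝ))) h1
      (by fun_prop)).continuousWithinAt
  have hE : ContinuousOn (fun s => eulerLagrange A (fun i => infin ξ i s) s) (Set.Icc a b) :=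
    fun s hs => by
    obtain ⟨N, hsN, H, -⟩ := hH s hs
    exact (H.continuousAt_eulerLagrange hsN).continuousWithinAt
  have i1 := hdu.intervalIntegrable_of_Icc (μ := MeasureTheory.volume) hab
  have i2 := hE.intervalIntegrable_of_Icc (μ := MeasureTheory.volume) hab
  have hint := intervalIntegral.integral_eq_sub_of_hasDerivAt (a := a) (b := b)
    (f := boundary A ξ) (fun s hs => hderiv s (by rwa [Set.uIcc_of_le hab] at hs))
    ((i1.const_mul 3).sub i2)
  rw [intervalIntegral.integral_sub (i1.const_mul 3) i2, intervalIntegral.integral_const_mul]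
    at hint
  refine (hasDerivAt_integral_of_smooth hab hsm).congr_deriv ?_
  linarith

end

/-! ### Bump variations and the Euler–Lagrange equations. -/

theorem IsGeneric.of_thirdOrder {J : Set ℝ} {γ : ℝ → Lam} (hγ : SmoothInto γ J)
    (H : ∀ t ∈ J, ∃ I A, t ∈ I ∧ IsThirdOrder γ I A ∧ 0 < coefP A t ^ 2 + coefQ A t ^ 2) :
    IsGeneric J γ := by
  refine ⟨⟨⟨hγ, fun I A hA t ht => ?_⟩, fun t ht => ?_⟩, H⟩
  · obtain ⟨I', B, ht', HB, -⟩ := H t ht.1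
    exact HB.toIsFrame.transversal_of hA ht' ht.2 (HB.pos t ht').ne'
  · obtain ⟨I', B, ht', HB, -⟩ := H t ht
    exact ⟨I', B, ht', HB.toIsFirstOrder, by rw [HB.P_eq_one t ht']; simp⟩

theorem finrank_act {B : Mat} (hB : B ∈ Oh) (W : Submodule ℝ (Fin 6 → ℝ)) :
    Module.finrank ℝ (act B W) = Module.finrank ℝ W :=
  (LinearEquiv.finrank_eq (Submodule.equivMapOfInjective B.mulVecLin
    (Matrix.mulVec_injective_iff_isUnit.2 (Oh.isUnit hB)) W)).symm

theorem finrank_origin : Module.finrank ℝ origin = 2 := by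
  have h1 : LinearIndependent ℝ ![(Pi.single 0 1 : Fin 6 → ℝ), Pi.single 1 1] := by
    rw [LinearIndependent.pair_iff]
    intro s t hst
    have e0 := congrFun hst 0
    have e1 := congrFun hst 1
    simp at e0 e1
    exact ⟨e0, e1⟩
  have h2 := finrank_span_eq_card h1
  rwa [Matrix.range_cons_cons_empty] at h2

theorem act_isLam {B : Mat} (hB : B ∈ Oh) : Module.finrank ℝ (act B origin) = 2 ∧
    ∀ x ∈ act B origin, ∀ y ∈ act B origin, form x y = 0 := by
  refine ⟨by rw [finrank_act hB, finrank_origin], ?_⟩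
  rintro _ ⟨x, hx, rfl⟩ _ ⟨y, hy, rfl⟩
  obtain ⟨x2, x3, x4, x5⟩ := mem_origin.1 hx
  obtain ⟨y2, y3, y4, y5⟩ := mem_origin.1 hy
  simp only [Matrix.mulVecLin_apply, form_mulVec hB]
  simp [form_eq, x2, x3, x4, x5, y2, y3, y4, y5]

/-- The point of `Λ` spanned by the first two columns of an element of the group. -/
noncomputable def pointOf {B : Mat} (hB : B ∈ Oh) : Lam := ⟨act B origin, act_isLam hB⟩

open Classical in
/-- The variation of `γ` defined by a deformation supported in `U`. -/
noncomputable def bumpVar (γ : ℝ → Lam) (A : ℝ → Mat) (U : Set ℝ) (ξ : Fin 5 → ℝ × ℝ → ℝ)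
    (p : ℝ × ℝ) : Lam :=
  if hp : p.1 ∈ U ∧ deform A ξ p ∈ Oh then pointOf hp.2 else γ p.1

section

variable {γ : ℝ → Lam} {I J U : Set ℝ} {A : ℝ → Mat} {ξ : Fin 5 → ℝ × ℝ → ℝ} {a b : ℝ}

theorem bumpVar_plane {p : ℝ × ℝ} (hp : p.1 ∈ U) (hO : deform A ξ p ∈ Oh) :
    (bumpVar γ A U ξ p).plane = act (deform A ξ p) origin := by
  rw [bumpVar, dif_pos ⟨hp, hO⟩]
  rfl

theorem bumpVar_eq (HA : IsFrame γ I A) (hU : U ⊆ I) {p : ℝ × ℝ} (hz : ∀ i, ξ i p = 0) :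
    bumpVar γ A U ξ p = γ p.1 := by
  by_cases hp : p.1 ∈ U ∧ deform A ξ p ∈ Oh
  · apply Subtype.ext
    have h0 : (fun i => ξ i p) = 0 := funext hz
    have h1 := bumpVar_plane (γ := γ) hp.1 hp.2
    have h2 := HA.proj p.1 (hU hp.1)
    rw [deform, h0, chart_zero, mul_one, ← h2] at h1
    exact h1
  · rw [bumpVar, dif_neg hp]

theorem SmoothInto.slice {V : ℝ × ℝ → Lam} {K : Set ℝ} (hJ : IsOpen J)
    (hV : SmoothInto V (J ×ˢ K)) {u : ℝ} (hu : u ∈ K) : SmoothInto (fun s => V (s, u)) J := by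
  intro s hs
  obtain ⟨N, hN, hsN, -, f, g, hf, hg, hfg⟩ := hV (s, u) ⟨hs, hu⟩
  refine ⟨{t | (t, u) ∈ N} ∩ J, (hN.preimage (by fun_prop : Continuous fun t : ℝ => (t, u))).inter
    hJ, ⟨hsN, hs⟩, Set.inter_subset_right, fun t => f (t, u), fun t => g (t, u),
    contDiffOn_slice_fst hf fun t ht => ht.1, contDiffOn_slice_fst hg fun t ht => ht.1,
    fun t ht => hfg _ ht.1⟩

/-- Genericity persists under small deformation near each base point, and compactness of `[a, b]`
makes `ε` uniform. Outside `[a, b]` the curve is `γ`, whose own frames can be used after restriction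
to the open complement. -/
theorem bumpVar_isVariation (hJ : IsOpen J) (hγ : IsGeneric J γ) (hab : a ≤ b)
    (HA : IsFourthOrder γ I A) (harc : ∀ t ∈ I, theta A t 4 0 = 1)
    (hκ : ∀ t ∈ I, theta A t 0 0 ≠ 0) (hU : IsOpen U) (hUI : U ⊆ I) (hUJ : U ⊆ J)
    (habU : Set.Icc a b ⊆ U) (hξ : ∀ i, ContDiff ℝ ∞ (ξ i)) (h0 : ∀ i s, ξ i (s, 0) = 0)
    (hsupp : ∀ i s u, s ∉ Set.Icc a b → ξ i (s, u) = 0) :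
    ∃ ε, IsVariation J γ a b ε (bumpVar γ A U ξ) := by
  have H : Deformation γ I A (U ×ˢ Set.univ) ξ := ⟨HA, harc, hU.prod isOpen_univ,
    fun p hp => hUI hp.1, fun i => (hξ i).contDiffOn, fun i s _ => h0 i s⟩
  have hV : ∀ p ∈ U ×ˢ (Set.univ : Set ℝ), (bumpVar γ A U ξ p).plane =
      act (deform A ξ p) origin := fun p hp => bumpVar_plane hp.1 (H.mem_Oh hp)
  have hout : ∀ s u, s ∉ Set.Icc a b → bumpVar γ A U ξ (s, u) = γ s := fun s u hs =>
    bumpVar_eq HA.toIsFrame hUI fun i => hsupp i s u hs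
  have hinit : ∀ s, bumpVar γ A U ξ (s, 0) = γ s := fun s =>
    bumpVar_eq HA.toIsFrame hUI fun i => h0 i s
  have hcomp : ∃ ε > 0, ∀ t ∈ Set.Icc a b, ∀ u ∈ Set.Ioo (-ε) ε, ∃ I' B, t ∈ I' ∧
      IsThirdOrder (fun s => bumpVar γ A U ξ (s, u)) I' B ∧
      0 < coefP B t ^ 2 + coefQ B t ^ 2 := by
    refine isCompact_Icc.induction_on (p := fun K => ∃ ε > 0, ∀ t ∈ K, ∀ u ∈ Set.Ioo (-ε) ε,
      ∃ I' B, t ∈ I' ∧ IsThirdOrder (fun s => bumpVar γ A U ξ (s, u)) I' B ∧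
      0 < coefP B t ^ 2 + coefQ B t ^ 2) ⟨1, one_pos, by simp⟩ ?_ ?_ ?_
    · rintro K K' hK ⟨ε, hε, h⟩
      exact ⟨ε, hε, fun t ht => h t (hK ht)⟩
    · rintro K K' ⟨ε, hε, h⟩ ⟨ε', hε', h'⟩
      refine ⟨min ε ε', lt_min hε hε', fun t ht u hu => ?_⟩
      rcases ht with ht | ht
      · exact h t ht u ⟨by linarith [hu.1, min_le_left ε ε'], hu.2.trans_le (min_le_left _ _)⟩
      · exact h' t ht u ⟨by linarith [hu.1, min_le_right ε ε'], hu.2.trans_le (min_le_right _ _)⟩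
    · intro s hs
      obtain ⟨δ, hδ, -, -, h3⟩ := H.exists_thirdOrder (s := s) ⟨habU hs, trivial⟩
        (hκ s (hUI (habU hs))) hV
      exact ⟨Metric.ball s δ, mem_nhdsWithin_of_mem_nhds (Metric.ball_mem_nhds s hδ), δ, hδ,
        fun t ht u hu => ⟨_, _, ht, (h3 u hu).1, (h3 u hu).2 t ht⟩⟩
  obtain ⟨ε, hε, hin⟩ := hcomp
  have hsm : SmoothInto (bumpVar γ A U ξ) (J ×ˢ Set.Ioo (-ε) ε) := by
    rintro ⟨s, u⟩ ⟨hs, hu⟩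
    by_cases hsU : s ∈ U
    · have hUo : IsOpen (U ×ˢ Set.Ioo (-ε) ε) := hU.prod isOpen_Ioo
      refine ⟨_, hUo, ⟨hsU, hu⟩, Set.prod_mono hUJ subset_rfl, _, _,
        (H.smooth_col 0).mono (Set.prod_mono subset_rfl (Set.subset_univ _)),
        (H.smooth_col 1).mono (Set.prod_mono subset_rfl (Set.subset_univ _)), fun q hq => ?_⟩
      rw [hV q ⟨hq.1, trivial⟩, act_origin]
    · obtain ⟨N, hN, hsN, hNJ, f, g, hf, hg, hfg⟩ := hγ.smooth s hs
      have hsab : s ∉ Set.Icc a b := fun h => hsU (habU h)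
      refine ⟨(N ∩ (Set.Icc a b)ᶜ) ×ˢ Set.Ioo (-ε) ε,
        (hN.inter isClosed_Icc.isOpen_compl).prod isOpen_Ioo, ⟨⟨hsN, hsab⟩, hu⟩,
        Set.prod_mono (Set.inter_subset_left.trans hNJ) subset_rfl, fun p => f p.1, fun p => g p.1,
        hf.comp contDiffOn_fst fun p hp => hp.1.1, hg.comp contDiffOn_fst fun p hp => hp.1.1,
        fun q hq => ?_⟩
      rw [← hfg _ hq.1.1, hout q.1 q.2 hq.1.2]
  refine ⟨ε, hab, habU.trans hUJ, hε, hsm, fun u hu => ?_, fun s _ => hinit s,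
    fun s hs u _ => hout s u hs.2⟩
  refine IsGeneric.of_thirdOrder (hsm.slice hJ hu) fun t ht => ?_
  by_cases htab : t ∈ Set.Icc a b
  · exact hin t htab u hu
  · obtain ⟨I', B, ht', HB, hpq⟩ := hγ.pq_pos t ht
    exact ⟨I' ∩ (Set.Icc a b)ᶜ, B, ⟨ht', htab⟩,
      (HB.mono (HB.isOpen.inter isClosed_Icc.isOpen_compl) Set.inter_subset_left).congr_curve
        fun s hs => hout s u hs.2, hpq⟩

end

section

variable {γ : ℝ → Lam} {I J : Set ℝ} {A : ℝ → Mat}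

theorem IsFrame.continuousOn_eulerLagrange (HA : IsFrame γ I A) (x : Fin 5 → ℝ) :
    ContinuousOn (eulerLagrange A x) I := by
  have h2 := fun i j => (HA.contDiffOn_theta i j).continuousOn
  have h3 : ∀ i j, ContinuousOn (deriv fun t => theta A t i j) I := fun i j =>
    ((HA.contDiffOn_theta i j).deriv_of_isOpen (m := ∞) HA.isOpen (by simp)).continuousOn
  have h4 : ∀ i j, ContinuousOn (fun s => deriv (fun t => theta A t i j) s) I := h3
  unfold eulerLagrange
  fun_prop

theorem eulerLagrange_smul (x : Fin 5 → ℝ) (c s : ℝ) :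
    eulerLagrange A (fun i => c * x i) s = c * eulerLagrange A x s := by
  unfold eulerLagrange
  ring

theorem infin_bump (g : ℝ → ℝ) (x : Fin 5 → ℝ) (i : Fin 5) :
    infin (fun i p => p.2 * (g p.1 * x i)) i = fun s => g s * x i := by
  ext s
  simp [infin, du]

theorem boundary_bump {g : ℝ → ℝ} (hg : ContDiff ℝ ∞ g) (x : Fin 5 → ℝ) {s : ℝ}
    (hs : s ∉ tsupport g) : boundary A (fun i p => p.2 * (g p.1 * x i)) s = 0 := by
  have h0 : g s = 0 := image_eq_zero_of_notMem_tsupport hs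
  have h1 : deriv g s = 0 := by
    by_contra h
    exact hs (support_deriv_subset h)
  have hd : DifferentiableAt ℝ g s := hg.contDiffAt.differentiableAt (by simp)
  simp only [boundary, infin_bump, deriv_mul_const hd, h0, h1]
  ring

/-- Deformations `ξ_i = u g(s) x_i` with a fixed vector `x` reduce the claim to the fundamental
lemma of the calculus of variations for one scalar function. -/
theorem IsCritical.eulerLagrange_eq_zero (hJ : IsOpen J) (hγ : IsGeneric J γ)
    (hcrit : IsCritical J γ) (HA : IsFourthOrder γ I A) (hIJ : I ⊆ J)
    (harc : ∀ t ∈ I, theta A t 4 0 = 1) (hκ : ∀ t ∈ I, theta A t 0 0 ≠ 0) (x : Fin 5 → ℝ)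
    {s₀ : ℝ} (hs₀ : s₀ ∈ I) : eulerLagrange A x s₀ = 0 := by
  obtain ⟨r, hr, hrI⟩ := Metric.isOpen_iff.1 HA.isOpen s₀ hs₀
  have hcont := (HA.toIsFrame.continuousOn_eulerLagrange x).mono hrI
  have hae := Metric.isOpen_ball.ae_eq_zero_of_integral_contDiff_smul_eq_zero
    (U := Metric.ball s₀ r) (f := eulerLagrange A x) (μ := MeasureTheory.volume)
    (hcont.locallyIntegrableOn Metric.isOpen_ball.measurableSet) fun g hg hgc hgs => by
    -- The interval is taken so that its endpoints lie outside the closed support of `g`; then `g`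
    -- and `g'` vanish there and the boundary terms drop out.
    obtain ⟨r', ⟨hr', hr'r⟩, hsub⟩ := exists_pos_lt_subset_ball hr (isClosed_tsupport g) hgs
    have hab : s₀ - r' ≤ s₀ + r' := by linarith
    have hicc : Set.Icc (s₀ - r') (s₀ + r') ⊆ Metric.ball s₀ r := by
      rw [← Real.closedBall_eq_Icc]
      exact Metric.closedBall_subset_ball hr'r
    rw [Real.ball_eq_Ioo] at hsub
    have hg0 : ∀ s, s ∉ Set.Ioo (s₀ - r') (s₀ + r') → g s = 0 := fun s hs =>
      image_eq_zero_of_notMem_tsupport fun h => hs (hsub h)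
    have hgi : ∀ s, s ∉ Set.Icc (s₀ - r') (s₀ + r') → g s = 0 := fun s hs =>
      hg0 s fun h => hs (Set.Ioo_subset_Icc_self h)
    set ξ : Fin 5 → ℝ × ℝ → ℝ := fun i p => p.2 * (g p.1 * x i) with hξ
    have hξs : ∀ i, ContDiff ℝ ∞ (ξ i) := fun i =>
      contDiff_snd.mul ((hg.comp contDiff_fst).mul contDiff_const)
    obtain ⟨ε, hvar⟩ := bumpVar_isVariation hJ hγ hab HA harc hκ Metric.isOpen_ball hrI
      (hrI.trans hIJ) hicc hξs (fun i s => by simp [hξ]) fun i s u hs => by simp [hξ, hgi s hs]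
    have h1 := hcrit _ _ _ _ hvar
    have H : Deformation γ I A (Metric.ball s₀ r ×ˢ Set.univ) ξ := ⟨HA, harc,
      Metric.isOpen_ball.prod isOpen_univ, fun p hp => hrI hp.1, fun i => (hξs i).contDiffOn,
      fun i s _ => by simp [hξ]⟩
    have h2 := first_variation (γ := γ) (V := bumpVar γ A (Metric.ball s₀ r) ξ) hab
      (fun s hs => ⟨_, Set.mk_mem_prod (hicc hs) (Set.mem_univ _), H, fun p hp =>
        bumpVar_plane hp.1 (H.mem_Oh hp)⟩) fun s hs => hκ s (hrI (hicc hs))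
    have h3 := h1.unique h2
    rw [boundary_bump hg x (fun h => (hsub h).1.false), boundary_bump hg x
      (fun h => (hsub h).2.false)] at h3
    simp only [hξ, infin_bump, eulerLagrange_smul] at h3
    rw [intervalIntegral.integral_of_le hab, MeasureTheory.setIntegral_eq_integral_of_forall_compl_eq_zero
      (fun s hs => by rw [hg0 s fun h => hs (Set.Ioo_subset_Ioc_self h), zero_mul])] at h3
    simp only [smul_eq_mul]
    linarith
  -- By continuity, vanishing almost everywhere becomes vanishing everywhere.
  have h4 : Set.EqOn (eulerLagrange A x) (fun _ => 0) (Metric.ball s₀ r) := by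
    refine MeasureTheory.Measure.eqOn_open_of_ae_eq (μ := MeasureTheory.volume) ?_
      Metric.isOpen_ball hcont continuousOn_const
    exact (MeasureTheory.ae_restrict_iff' Metric.isOpen_ball.measurableSet).2 hae
  exact h4 (Metric.mem_ball_self hr)

theorem IsGeneric.theta_zero_zero_ne (hγ : IsGeneric J γ) (HA : IsFourthOrder γ I A) {t : ℝ}
    (ht : t ∈ I) (htJ : t ∈ J) : theta A t 0 0 ≠ 0 := by
  intro h0
  obtain ⟨I', B, ht', HB, hpq⟩ := hγ.pq_pos t htJ
  rw [HB.coef_eq HA.toIsThirdOrder ht' ht, HA.p_zero t ht, coefQ] at hpq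
  have h1 := HA.trace_zero t ht
  rw [h0, zero_add] at h1
  simp [h1] at hpq

theorem IsArclengthParam.theta_eq_one (hs : IsArclengthParam J γ) (HA : IsFourthOrder γ I A)
    {t : ℝ} (ht : t ∈ I) (htJ : t ∈ J) : theta A t 4 0 = 1 := by
  rw [← HA.toIsSecondOrder.lieSpeed_eq ht, hs t htJ]

/-- The coefficients of `x₁` and `x₂` differ by `4κ₁κ₃`, so `κ₃ = 0` on all of `I` because `κ₁ ≠ 0`;
hence `κ₃' = 0`, and what is left is `κ₂' = 0`. The sum of the coefficients of `x₀` and `x₃` gives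
`κ₁' = 0`, their difference gives `κ₄`. -/
theorem IsCritical.curvatures_aux (hJ : IsOpen J) (hγ : IsGeneric J γ)
    (hs : IsArclengthParam J γ) (hcrit : IsCritical J γ) (HA : IsFourthOrder γ I A) (hIJ : I ⊆ J)
    {t : ℝ} (ht : t ∈ I) :
    deriv (fun s => theta A s 0 0) t = 0 ∧ deriv (fun s => theta A s 1 0) t = 0 ∧
      theta A t 3 2 = 0 ∧ theta A t 0 4 = theta A t 0 0 ^ 2 - theta A t 1 0 ^ 2 := by
  have key := fun (x : Fin 5 → ℝ) s (hsI : s ∈ I) =>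
    hcrit.eulerLagrange_eq_zero hJ hγ HA hIJ (fun t ht => hs.theta_eq_one HA ht (hIJ ht))
      (fun t ht => hγ.theta_zero_zero_ne HA ht (hIJ ht)) x hsI
  have h0 := fun s hs => key ![1, 0, 0, 0, 0] s hs
  have h1 := fun s hs => key ![0, 1, 0, 0, 0] s hs
  have h2 := fun s hs => key ![0, 0, 1, 0, 0] s hs
  have h3 := fun s hs => key ![0, 0, 0, 1, 0] s hs
  simp [eulerLagrange] at h0 h1 h2 h3
  have hk3 : ∀ s ∈ I, theta A s 3 2 = 0 := fun s hsI => by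
    have : theta A s 0 0 * theta A s 3 2 = 0 := by linarith [h1 s hsI, h2 s hsI]
    exact (mul_eq_zero.1 this).resolve_left (hγ.theta_zero_zero_ne HA hsI (hIJ hsI))
  have hk3' : deriv (fun s => theta A s 3 2) t = 0 := by
    have : (fun s => theta A s 3 2) =ᶠ[𝓝 t] fun _ => 0 :=
      Filter.Eventually.mono (HA.isOpen.mem_nhds ht) hk3
    rw [this.deriv_eq, deriv_const]
  have e0 := h0 t ht
  have e1 := h1 t ht
  have e3 := h3 t ht
  rw [hk3 t ht] at e0 e1 e3
  rw [hk3'] at e1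
  exact ⟨by linarith, by linarith, hk3 t ht, by linarith⟩

theorem IsCritical.curvatures (hJ : IsOpen J) (hJc : IsConnected J) (hγ : IsGeneric J γ)
    (hs : IsArclengthParam J γ) (hcrit : IsCritical J γ) {κ₁ κ₂ κ₃ κ₄ : ℝ → ℝ}
    (hκ : IsLieCurvatures J γ κ₁ κ₂ κ₃ κ₄) :
    ∃ c₁ c₂ c₃ c₄ : ℝ, (∀ s ∈ J, κ₁ s = c₁ ∧ κ₂ s = c₂ ∧ κ₃ s = c₃ ∧ κ₄ s = c₄) ∧
      c₁ ≠ 0 ∧ c₃ = 0 ∧ c₄ = c₁ ^ 2 - c₂ ^ 2 := by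
  have hloc : ∀ t ∈ J, HasDerivAt κ₁ 0 t ∧ HasDerivAt κ₂ 0 t ∧ κ₁ t ≠ 0 ∧ κ₃ t = 0 ∧
      κ₄ t = κ₁ t ^ 2 - κ₂ t ^ 2 := fun t ht => by
    obtain ⟨I, A, htI, hIJ, HA, hA⟩ := hκ t ht
    have hA' : ∀ s ∈ I, theta A s 0 0 = κ₁ s ∧ theta A s 1 0 = κ₂ s ∧ theta A s 3 2 = κ₃ s ∧
        theta A s 0 4 = κ₄ s := fun s hsI => by
      have := hA s hsI
      rwa [hs.theta_eq_one HA hsI (hIJ hsI), mul_one, mul_one, mul_one, mul_one] at this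
    obtain ⟨d1, d2, h3, h4⟩ := hcrit.curvatures_aux hJ hγ hs HA hIJ htI
    have hne := hγ.theta_zero_zero_ne HA htI ht
    obtain ⟨a1, a2, a3, a4⟩ := hA' t htI
    have hd := fun i j => (((HA.contDiffOn_theta i j).contDiffAt
      (HA.isOpen.mem_nhds htI)).differentiableAt (by simp)).hasDerivAt
    have g1 := hd 0 0
    have g2 := hd 1 0
    rw [d1] at g1
    rw [d2] at g2
    refine ⟨g1.congr_of_eventuallyEq (Filter.Eventually.mono (HA.isOpen.mem_nhds htI)
      fun s hs => (hA' s hs).1.symm), g2.congr_of_eventuallyEq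
      (Filter.Eventually.mono (HA.isOpen.mem_nhds htI) fun s hs => (hA' s hs).2.1.symm), ?_, ?_, ?_⟩
    · rwa [← a1]
    · rw [← a3, h3]
    · rw [← a1, ← a2, ← a4, h4]
  obtain ⟨t₀, ht₀⟩ := hJc.nonempty
  have hconst : ∀ f : ℝ → ℝ, (∀ t ∈ J, HasDerivAt f 0 t) → ∀ t ∈ J, f t = f t₀ := fun f hf t ht =>
    hJ.is_const_of_deriv_eq_zero hJc.isPreconnected
      (fun t ht => (hf t ht).differentiableAt.differentiableWithinAt)
      (fun t ht => (hf t ht).deriv) ht ht₀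
  have k1 := hconst κ₁ fun t ht => (hloc t ht).1
  have k2 := hconst κ₂ fun t ht => (hloc t ht).2.1
  refine ⟨κ₁ t₀, κ₂ t₀, 0, κ₁ t₀ ^ 2 - κ₂ t₀ ^ 2, fun t ht => ⟨k1 t ht, k2 t ht, (hloc t ht).2.2.2.1,
    ?_⟩, (hloc t₀ ht₀).2.2.1, rfl, rfl⟩
  rw [(hloc t ht).2.2.2.2, k1 t ht, k2 t ht]

end

/-! ### One-parameter groups and the global frame. -/

section Exp

attribute [local instance] Matrix.linftyOpNormedRing Matrix.linftyOpNormedAlgebra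

/-- A matrix norm is used only locally, to differentiate the exponential; the entrywise conclusion
does not depend on it. -/
theorem mderiv_exp (Y : Mat) (t : ℝ) :
    MDeriv (fun s => NormedSpace.exp (s • Y)) (NormedSpace.exp (t • Y) * Y) t := by
  have h1 := hasDerivAt_exp_smul_const (𝕂 := ℝ) Y t
  intro i j
  exact (((Matrix.entryLinearMap ℝ ℝ i j).toContinuousLinearMap).hasFDerivAt.comp_hasDerivAt t h1)

end Exp

theorem MDeriv.const_of_zero {f : ℝ → Mat} {S : Set ℝ} (hS : IsOpen S) (hc : IsPreconnected S)
    (hf : ∀ t ∈ S, MDeriv f 0 t) {s t : ℝ} (hs : s ∈ S) (ht : t ∈ S) : f s = f t := by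
  ext i j
  exact hS.is_const_of_deriv_eq_zero (f := fun t => f t i j) hc
    (fun t ht => (hf t ht i j).differentiableAt.differentiableWithinAt)
    (fun t ht => (hf t ht i j).deriv) hs ht

theorem exp_zero_smul (Y : Mat) : NormedSpace.exp ((0 : ℝ) • Y) = 1 := by
  rw [zero_smul, NormedSpace.exp_zero]

theorem exp_mem_Oh {Y : Mat} (hY : Y ∈ lieAlg) (t : ℝ) : NormedSpace.exp (t • Y) ∈ Oh := by
  have hd : ∀ t, MDeriv (fun s => (NormedSpace.exp (s • Y))ᵀ * h * NormedSpace.exp (s • Y)) 0 t :=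
    fun t => by
    have h1 := ((mderiv_exp Y t).transpose.mul (MDeriv.const h t)).mul (mderiv_exp Y t)
    have hcomm : NormedSpace.exp (t • Y) * Y = Y * NormedSpace.exp (t • Y) :=
      (((Commute.refl Y).smul_left t).exp_left).eq
    have hY' : Yᵀ * h + h * Y = 0 := hY
    rw [hcomm, Matrix.transpose_mul] at h1
    have e : ((NormedSpace.exp (t • Y))ᵀ * Yᵀ * h + (NormedSpace.exp (t • Y))ᵀ * 0) *
        NormedSpace.exp (t • Y) + (NormedSpace.exp (t • Y))ᵀ * h * (Y * NormedSpace.exp (t • Y)) =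
        (NormedSpace.exp (t • Y))ᵀ * (Yᵀ * h + h * Y) * NormedSpace.exp (t • Y) := by
      noncomm_ring
    rwa [e, hY', mul_zero, zero_mul] at h1
  have h2 := MDeriv.const_of_zero isOpen_univ isPreconnected_univ (fun t _ => hd t)
    (Set.mem_univ t) (Set.mem_univ 0)
  change (NormedSpace.exp (t • Y))ᵀ * h * NormedSpace.exp (t • Y) = h
  rw [h2, exp_zero_smul]
  simp

/-- The derivative of an entry is a linear combination of entries, so regularity bootstraps by
induction. -/
theorem contDiff_exp (Y : Mat) (i j : Fin 6) :
    ContDiff ℝ ∞ (fun s : ℝ => NormedSpace.exp (s • Y) i j) := by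
  rw [contDiff_infty]
  intro n
  induction n generalizing i j with
  | zero =>
    exact contDiff_zero.2 (continuous_iff_continuousAt.2 fun t => (mderiv_exp Y t i j).continuousAt)
  | succ n ih =>
    rw [Nat.cast_succ, contDiff_succ_iff_deriv]
    refine ⟨fun t => (mderiv_exp Y t i j).differentiableAt, by simp, ?_⟩
    rw [funext fun t => (mderiv_exp Y t i j).deriv]
    simp only [Matrix.mul_apply]
    exact ContDiff.sum fun k _ => (ih i k).mul contDiff_const

theorem exp_mul_neg (Y : Mat) (t : ℝ) :
    NormedSpace.exp (t • -Y) * NormedSpace.exp (t • Y) = 1 := by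
  have hd : ∀ t, MDeriv (fun s => NormedSpace.exp (s • -Y) * NormedSpace.exp (s • Y)) 0 t :=
    fun t => by
    have h1 := (mderiv_exp (-Y) t).mul (mderiv_exp Y t)
    have hcomm : NormedSpace.exp (t • Y) * Y = Y * NormedSpace.exp (t • Y) :=
      (((Commute.refl Y).smul_left t).exp_left).eq
    rw [hcomm] at h1
    have e : NormedSpace.exp (t • -Y) * -Y * NormedSpace.exp (t • Y) +
      NormedSpace.exp (t • -Y) * (Y * NormedSpace.exp (t • Y)) = 0 := by noncomm_ring
    rwa [e] at h1
  have h2 := MDeriv.const_of_zero isOpen_univ isPreconnected_univ (fun t _ => hd t)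
    (Set.mem_univ t) (Set.mem_univ 0)
  rw [h2, exp_zero_smul, exp_zero_smul, mul_one]

section

variable {γ : ℝ → Lam} {I J : Set ℝ} {A : ℝ → Mat}

theorem X_eq_kmat (u v : ℝ) : X u v = kmat u v 0 (u ^ 2 - v ^ 2) := by
  ext i j
  fin_cases i <;> fin_cases j <;> simp [X, kmat]

theorem X_mem (u v : ℝ) : X u v ∈ lieAlg := by
  change (X u v)ᵀ * h + h * X u v = 0
  ext i j
  fin_cases i <;> fin_cases j <;>
    simp [X, h, Matrix.add_apply, Matrix.mul_apply, Fin.sum_univ_six]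

theorem theta_exp (C Y : Mat) (hY : Y ∈ lieAlg) (hC : C ∈ Oh) (t : ℝ) :
    theta (fun s => C * NormedSpace.exp (s • Y)) t = Y := by
  have h1 := (MDeriv.const C t).mul (mderiv_exp Y t)
  have hO := Oh.mul hC (exp_mem_Oh hY t)
  rw [theta_eq_of_mderiv h1 hO, zero_mul, zero_add, ← mul_assoc C, ← mul_assoc, Oh.inv_mul hO,
    one_mul]

theorem isFourthOrder_exp {u v : ℝ} {C : Mat} (hI : IsOpen I)
    (hG : ∀ t ∈ I, C * NormedSpace.exp (t • X u v) ∈ G) (hC : C ∈ Oh)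
    (hγ : ∀ t ∈ I, (γ t).plane = act (C * NormedSpace.exp (t • X u v)) origin) :
    IsFourthOrder γ I (fun t => C * NormedSpace.exp (t • X u v)) := by
  have hθ := theta_exp C _ (X_mem u v) hC
  refine ⟨⟨⟨⟨⟨hI, fun i j => ?_, hG, hγ⟩, fun t _ => ?_, fun t _ => ?_⟩, fun t _ => ?_⟩,
    fun t _ => ?_⟩, fun t _ => ?_⟩
  · simp only [Matrix.mul_apply]
    exact ContDiffOn.sum fun k _ => contDiffOn_const.mul (contDiff_exp _ k j).contDiffOn
  · rw [hθ]; simp [X]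
  · rw [hθ]; simp [X]
  · rw [frameP, hθ]
    ext i j
    fin_cases i <;> fin_cases j <;> simp [X]
  · rw [hθ]; simp [X]
  · rw [coefP, hθ]; simp [X]

/-- With `A' = A X` for a constant `X`, the product `A exp(-tX)` has zero derivative; its constant
value is `C`. -/
theorem IsFourthOrder.eq_exp (HA : IsFourthOrder γ I A) (hI : IsPreconnected I) {u v : ℝ}
    (hθ : ∀ t ∈ I, theta A t = X u v) {t₀ : ℝ} (ht₀ : t₀ ∈ I) :
    ∃ C ∈ Oh, ∀ t ∈ I, A t = C * NormedSpace.exp (t • X u v) := by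
  have hd : ∀ t ∈ I, MDeriv (fun s => A s * NormedSpace.exp (s • -X u v)) 0 t := fun t ht => by
    have h1 := (HA.toIsFrame.mderiv ht).mul (mderiv_exp (-X u v) t)
    have hcomm : NormedSpace.exp (t • -X u v) * X u v = X u v * NormedSpace.exp (t • -X u v) :=
      ((((Commute.refl (X u v)).neg_left).smul_left t).exp_left).eq
    have e : A t * theta A t * NormedSpace.exp (t • -X u v) +
        A t * (NormedSpace.exp (t • -X u v) * -X u v) = 0 := by
      rw [hθ t ht, mul_neg, hcomm]
      noncomm_ring
    rwa [e] at h1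
  have hX' : -X u v ∈ lieAlg := by
    have h1 : (X u v)ᵀ * h + h * X u v = 0 := X_mem u v
    change (-X u v)ᵀ * h + h * -X u v = 0
    rw [Matrix.transpose_neg, neg_mul, mul_neg, ← neg_add, h1, neg_zero]
  refine ⟨A t₀ * NormedSpace.exp (t₀ • -X u v), Oh.mul (HA.mem_Oh ht₀) (exp_mem_Oh hX' t₀),
    fun t ht => ?_⟩
  rw [← MDeriv.const_of_zero HA.isOpen hI hd ht ht₀, mul_assoc, exp_mul_neg, mul_one]

/-- A curve with the constant curvatures of a critical curve is an orbit of a one-parameter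
group. -/
theorem exists_global_frame (hJ : IsOpen J) (hJc : IsConnected J) {u v : ℝ} (hu : u ≠ 0)
    (hloc : ∀ t ∈ J, ∃ I A, t ∈ I ∧ I ⊆ J ∧ IsFourthOrder γ I A ∧
      ∀ s ∈ I, theta A s = X u v) :
    ∃ C ∈ G, IsFourthOrder γ J (fun t => C * NormedSpace.exp (t • X u v)) := by
  let Good : Mat → ℝ → Prop := fun C t => ∃ I, t ∈ I ∧ I ⊆ J ∧ C ∈ Oh ∧
    IsFourthOrder γ I (fun t => C * NormedSpace.exp (t • X u v))
  have hex : ∀ t ∈ J, ∃ C, Good C t := fun t ht => by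
    obtain ⟨I, A, htI, hIJ, HA, hθ⟩ := hloc t ht
    obtain ⟨r, hr, hrI⟩ := Metric.isOpen_iff.1 HA.isOpen t htI
    have HA' := HA.mono Metric.isOpen_ball hrI
    obtain ⟨C, hC, hAC⟩ := HA'.eq_exp (convex_ball t r).isPreconnected
      (fun s hs => hθ s (hrI hs)) (Metric.mem_ball_self hr)
    refine ⟨C, Metric.ball t r, Metric.mem_ball_self hr, hrI.trans hIJ, hC,
      isFourthOrder_exp Metric.isOpen_ball (fun s hs => ?_) hC fun s hs => ?_⟩
    · rw [← hAC s hs]; exact HA'.mem s hs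
    · rw [← hAC s hs]; exact HA'.proj s hs
  have huniq : ∀ {C C' t}, Good C t → Good C' t → C' = C ∨ C' = -C := fun {C C' t} hC hC' => by
    obtain ⟨I, ht, -, hO, H⟩ := hC
    obtain ⟨I', ht', -, hO', H'⟩ := hC'
    have hpos : 0 < theta (fun t => C * NormedSpace.exp (t • X u v)) t 0 0 *
        theta (fun t => C' * NormedSpace.exp (t • X u v)) t 0 0 := by
      rw [theta_exp C _ (X_mem u v) hO, theta_exp C' _ (X_mem u v) hO']
      simpa [X] using hu
    have hun := Oh.isUnit (exp_mem_Oh (X_mem u v) t)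
    rcases H.eq_or_neg H' ht ht' hpos with h | h
    · exact Or.inl (hun.mul_left_injective h)
    · rw [← neg_mul] at h
      exact Or.inr (hun.mul_left_injective h)
  have hopen : ∀ {C t}, Good C t → ∀ᶠ s in 𝓝 t, Good C s := fun {C t} hC => by
    obtain ⟨I, ht, hIJ, hO, H⟩ := hC
    exact Filter.Eventually.mono (H.isOpen.mem_nhds ht) fun s hs => ⟨I, hs, hIJ, hO, H⟩
  obtain ⟨t₀, ht₀⟩ := hJc.nonempty
  obtain ⟨C, hC⟩ := hex t₀ ht₀
  have hiff : ∀ {C D t}, Good C t → ((Good D t ∨ Good (-D) t) ↔ (D = C ∨ D = -C)) :=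
    fun {C D t} hC => by
    constructor
    · rintro (h | h)
      · exact huniq hC h
      · rcases huniq hC h with h' | h'
        · exact Or.inr (neg_eq_iff_eq_neg.1 h')
        · exact Or.inl (neg_injective h')
    · rintro (rfl | rfl)
      · exact Or.inl hC
      · right; rwa [neg_neg]
  have hall : ∀ t ∈ J, Good C t ∨ Good (-C) t := fun t ht => by
    -- The constants of local frames are determined only up to sign, so the property propagated
    -- along `J` is that `C` or `-C` works. By `hiff` it has the same truth value at all points near
    -- a given one.
    have := hJc.isPreconnected.induction₂
      (fun x y => (Good C x ∨ Good (-C) x) ↔ (Good C y ∨ Good (-C) y))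
      (fun x hx => by
        obtain ⟨D, hD⟩ := hex x hx
        exact nhdsWithin_le_nhds ((hopen hD).mono fun y hy => (hiff hD).trans (hiff hy).symm))
      (fun x y z _ _ _ h1 h2 => h1.trans h2) (fun x y _ _ h => h.symm) ht₀ ht
    exact this.1 (Or.inl hC)
  obtain ⟨I, ht₀I, -, hO, H⟩ := hC
  -- The whole orbit is connected and meets `G` at `t₀`. Taking all real `t` also gives `C ∈ G` at
  -- `t = 0`, even if `0` is not in `J`.
  have hG : ∀ t, C * NormedSpace.exp (t • X u v) ∈ G := fun t => by
    refine mem_G_of_continuousOn isPreconnected_univ (f := fun t => C * NormedSpace.exp (t • X u v))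
      (fun i j => ?_) (fun s _ => Oh.mul hO (exp_mem_Oh (X_mem u v) s)) (Set.mem_univ t₀)
      (H.mem t₀ ht₀I) (Set.mem_univ t)
    simp only [Matrix.mul_apply]
    exact continuousOn_finsetSum _ fun k _ =>
      continuousOn_const.mul (contDiff_exp _ k j).continuous.continuousOn
  refine ⟨C, ?_, isFourthOrder_exp hJ (fun t _ => hG t) hO fun t ht => ?_⟩
  · have := hG 0
    rwa [exp_zero_smul, mul_one] at this
  · rcases hall t ht with ⟨I', ht', -, -, H'⟩ | ⟨I', ht', -, -, H'⟩
    · exact H'.proj t ht'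
    · rw [H'.proj t ht']
      simp only [neg_mul, act_neg]

end

/-! ### Coordinates of an arbitrary variation, and sufficiency. -/

theorem chart_injective {z w : Fin 5 → ℝ} (H : act (chart z) origin = act (chart w) origin) :
    z = w := by
  rw [act_origin, act_origin] at H
  have h0 : (chart z).col 0 ∈ Submodule.span ℝ {(chart w).col 0, (chart w).col 1} := by
    rw [← H]; exact Submodule.subset_span (by simp)
  have h1 : (chart z).col 1 ∈ Submodule.span ℝ {(chart w).col 0, (chart w).col 1} := by
    rw [← H]; exact Submodule.subset_span (by simp)
  obtain ⟨a, b, hab⟩ := Submodule.mem_span_pair.1 h0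
  obtain ⟨c, d, hcd⟩ := Submodule.mem_span_pair.1 h1
  have a0 : a = 1 := by simpa [chart] using congrFun hab 0
  have b0 : b = 0 := by simpa [chart] using congrFun hab 1
  have c0 : c = 0 := by simpa [chart] using congrFun hcd 0
  have d0 : d = 1 := by simpa [chart] using congrFun hcd 1
  subst a0 b0 c0 d0
  ext i
  fin_cases i
  · simpa [chart, eq_comm] using congrFun hab 2
  · simpa [chart, eq_comm] using congrFun hab 3
  · simpa [chart, eq_comm] using congrFun hcd 2
  · simpa [chart, eq_comm] using congrFun hcd 3
  · simpa [chart, eq_comm] using congrFun hab 4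

/-- The first two columns of an element of the big cell. -/
theorem chart_cols {x y : Fin 6 → ℝ} (x0 : x 0 = 1) (x1 : x 1 = 0) (y0 : y 0 = 0) (y1 : y 1 = 1)
    (hxx : form x x = 0) (hxy : form x y = 0) (hyy : form y y = 0) :
    (chart ![x 2, x 3, y 2, y 3, x 4]).col 0 = x ∧ (chart ![x 2, x 3, y 2, y 3, x 4]).col 1 = y := by
  rw [form_eq] at hxx hxy hyy
  rw [x0, x1] at hxx hxy
  rw [y0, y1] at hyy hxy
  constructor
  · ext i
    fin_cases i <;> simp [chart, x0, x1]
    linarith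
  · ext i
    fin_cases i <;> simp [chart, y0, y1] <;> linarith

theorem span_pair_smul {x y x' y' : Fin 6 → ℝ} {a b c d : ℝ} (hx : x' = a • x + b • y)
    (hy : y' = c • x + d • y) (hD : a * d - b * c ≠ 0) :
    Submodule.span ℝ {x', y'} = Submodule.span ℝ {x, y} := by
  apply le_antisymm
  · rw [Submodule.span_le]
    rintro _ (rfl | rfl)
    · exact Submodule.mem_span_pair.2 ⟨a, b, hx.symm⟩
    · exact Submodule.mem_span_pair.2 ⟨c, d, hy.symm⟩
  · rw [Submodule.span_le]
    rintro _ (rfl | rfl)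
    · refine Submodule.mem_span_pair.2 ⟨d / (a * d - b * c), -b / (a * d - b * c), ?_⟩
      rw [hx, hy]
      ext i
      simp only [Pi.add_apply, Pi.smul_apply, smul_eq_mul]
      set E := a * d - b * c with hE
      field_simp
      rw [hE]
      ring
    · refine Submodule.mem_span_pair.2 ⟨-c / (a * d - b * c), a / (a * d - b * c), ?_⟩
      rw [hx, hy]
      ext i
      simp only [Pi.add_apply, Pi.smul_apply, smul_eq_mul]
      set E := a * d - b * c with hE
      field_simp
      rw [hE]
      ring

section

variable {γ : ℝ → Lam} {I J : Set ℝ} {A : ℝ → Mat} {V : ℝ × ℝ → Lam}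

/-- Smooth coordinates of a variation in the big cells around the base curve. -/
theorem exists_local_coord (HA : IsFrame γ J A) {K : Set (ℝ × ℝ)} (hKJ : ∀ p ∈ K, p.1 ∈ J)
    (hV : SmoothInto V K) {s : ℝ} (hs : (s, (0 : ℝ)) ∈ K) (h0 : V (s, 0) = γ s) :
    ∃ N, IsOpen N ∧ (s, (0 : ℝ)) ∈ N ∧ N ⊆ K ∧ ∃ z : ℝ × ℝ → Fin 5 → ℝ,
      (∀ i, ContDiffOn ℝ ∞ (fun p => z p i) N) ∧
      ∀ p ∈ N, (V p).plane = act (A p.1 * chart (z p)) origin := by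
  obtain ⟨N, hN, hsN, hNK, f, g, hf, hg, hfg⟩ := hV _ hs
  have hO : ∀ p ∈ N, A p.1 ∈ Oh := fun p hp => HA.mem_Oh (hKJ p (hNK hp))
  -- The spanning fields are expressed in the moving frame, so that the base curve becomes the
  -- constant plane `origin`.
  set f' : ℝ × ℝ → Fin 6 → ℝ := fun p => (h * (A p.1)ᵀ * h) *ᵥ f p with hf'
  set g' : ℝ × ℝ → Fin 6 → ℝ := fun p => (h * (A p.1)ᵀ * h) *ᵥ g p with hg'
  have hAf : ∀ p ∈ N, A p.1 *ᵥ f' p = f p := fun p hp => by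
    rw [hf', Matrix.mulVec_mulVec, Oh.mul_inv (hO p hp), Matrix.one_mulVec]
  have hAg : ∀ p ∈ N, A p.1 *ᵥ g' p = g p := fun p hp => by
    rw [hg', Matrix.mulVec_mulVec, Oh.mul_inv (hO p hp), Matrix.one_mulVec]
  have hsm : ∀ i j, ContDiffOn ℝ ∞ (fun p : ℝ × ℝ => A p.1 i j) N := fun i j =>
    (HA.smooth i j).comp contDiffOn_fst fun p hp => hKJ p (hNK hp)
  have hmul : ∀ {v : ℝ × ℝ → Fin 6 → ℝ}, ContDiffOn ℝ ∞ v N → ∀ i,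
      ContDiffOn ℝ ∞ (fun p => ((h * (A p.1)ᵀ * h) *ᵥ v p) i) N := fun {v} hv i => by
    have hv' := contDiffOn_pi.1 hv
    simp only [Matrix.mulVec, dotProduct, Matrix.mul_apply, Matrix.transpose_apply]
    refine ContDiffOn.sum fun k _ => (ContDiffOn.sum fun l _ => (ContDiffOn.sum fun m _ => ?_).mul
      contDiffOn_const).mul (hv' k)
    exact contDiffOn_const.mul (hsm _ _)
  have sf := hmul hf
  have sg := hmul hg
  change ∀ i, ContDiffOn ℝ ∞ (fun p => f' p i) N at sf
  change ∀ i, ContDiffOn ℝ ∞ (fun p => g' p i) N at sg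
  have hplane : ∀ p ∈ N, (V p).plane = (Submodule.span ℝ {f' p, g' p}).map (A p.1).mulVecLin :=
    fun p hp => by
    rw [hfg p hp, Submodule.map_span, Set.image_pair]
    simp only [Matrix.mulVecLin_apply, hAf p hp, hAg p hp]
  have hiso : ∀ p ∈ N, ∀ x ∈ Submodule.span ℝ {f' p, g' p},
      ∀ y ∈ Submodule.span ℝ {f' p, g' p}, form x y = 0 := fun p hp x hx y hy => by
    rw [← form_mulVec (hO p hp)]
    have := (V p).2.2
    change ∀ x ∈ (V p).plane, ∀ y ∈ (V p).plane, form x y = 0 at this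
    rw [hplane p hp] at this
    exact this _ (Submodule.mem_map_of_mem hx) _ (Submodule.mem_map_of_mem hy)
  have hbase : Submodule.span ℝ {f' (s, 0), g' (s, 0)} = origin := by
    apply act_inj (hO _ hsN)
    have h1 := hplane _ hsN
    rw [h0, HA.proj s (hKJ _ hs)] at h1
    exact h1.symm
  -- The big cell is where this leading minor is nonzero; it is nonzero over the base curve because
  -- the plane there is `origin`.
  set D : ℝ × ℝ → ℝ := fun p => f' p 0 * g' p 1 - f' p 1 * g' p 0 with hD
  have hDs : ContDiffOn ℝ ∞ D N := ((sf 0).mul (sg 1)).sub ((sf 1).mul (sg 0))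
  have hD0 : D (s, 0) ≠ 0 := by
    have e0 : (Pi.single 0 1 : Fin 6 → ℝ) ∈ Submodule.span ℝ {f' (s, 0), g' (s, 0)} := by
      rw [hbase, mem_origin]; simp
    have e1 : (Pi.single 1 1 : Fin 6 → ℝ) ∈ Submodule.span ℝ {f' (s, 0), g' (s, 0)} := by
      rw [hbase, mem_origin]; simp
    obtain ⟨a, b, hab⟩ := Submodule.mem_span_pair.1 e0
    obtain ⟨c, d, hcd⟩ := Submodule.mem_span_pair.1 e1
    have q1 := congrFun hab 0
    have q2 := congrFun hab 1
    have q3 := congrFun hcd 0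
    have q4 := congrFun hcd 1
    simp at q1 q2 q3 q4
    intro hz
    have : (a * d - b * c) * D (s, 0) = 1 := by
      simp only [hD]
      linear_combination (c * f' (s, 0) 1 + d * g' (s, 0) 1) * q1 + q4 -
        (c * f' (s, 0) 0 + d * g' (s, 0) 0) * q2
    rw [hz, mul_zero] at this
    exact zero_ne_one this
  have hop := hDs.continuousOn.isOpen_inter_preimage hN (isOpen_compl_singleton (x := (0 : ℝ)))
  set N' := N ∩ D ⁻¹' {0}ᶜ with hN'
  have hsub : N' ⊆ N := Set.inter_subset_left
  have hne : ∀ p ∈ N', D p ≠ 0 := fun p hp => hp.2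
  -- Cramer's rule gives the basis whose first two coordinates are `(1, 0)` and `(0, 1)`, as in the
  -- first two columns of `chart`.
  set x : ℝ × ℝ → Fin 6 → ℝ := fun p => (g' p 1 / D p) • f' p + (-f' p 1 / D p) • g' p with hx
  set y : ℝ × ℝ → Fin 6 → ℝ := fun p => (-g' p 0 / D p) • f' p + (f' p 0 / D p) • g' p with hy
  have hsx : ∀ i, ContDiffOn ℝ ∞ (fun p => x p i) N' := fun i =>
    ((((sg 1).mono hsub).div (hDs.mono hsub) hne).mul ((sf i).mono hsub)).add
      ((((sf 1).mono hsub).neg.div (hDs.mono hsub) hne).mul ((sg i).mono hsub))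
  have hsy : ∀ i, ContDiffOn ℝ ∞ (fun p => y p i) N' := fun i =>
    ((((sg 0).mono hsub).neg.div (hDs.mono hsub) hne).mul ((sf i).mono hsub)).add
      ((((sf 0).mono hsub).div (hDs.mono hsub) hne).mul ((sg i).mono hsub))
  refine ⟨N', hop, ⟨hsN, hD0⟩, hsub.trans hNK, fun p => ![x p 2, x p 3, y p 2, y p 3, x p 4],
    fun i => ?_, fun p hp => ?_⟩
  · fin_cases i
    · exact hsx 2
    · exact hsx 3
    · exact hsy 2
    · exact hsy 3
    · exact hsx 4
  · have hDp := hne p hp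
    have hspan : Submodule.span ℝ {x p, y p} = Submodule.span ℝ {f' p, g' p} := by
      refine span_pair_smul rfl rfl ?_
      have : g' p 1 / D p * (f' p 0 / D p) - -f' p 1 / D p * (-g' p 0 / D p) = 1 / D p := by
        field_simp
        simp only [hD]
        ring
      rw [this]
      exact one_div_ne_zero hDp
    have hxm : x p ∈ Submodule.span ℝ {f' p, g' p} := by
      rw [← hspan]; exact Submodule.subset_span (by simp)
    have hym : y p ∈ Submodule.span ℝ {f' p, g' p} := by
      rw [← hspan]; exact Submodule.subset_span (by simp)
    have hiso' := hiso p (hsub hp)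
    obtain ⟨c0, c1⟩ := chart_cols (x := x p) (y := y p)
      (by simp only [hx, Pi.add_apply, Pi.smul_apply, smul_eq_mul]; field_simp; simp only [hD]; ring)
      (by simp only [hx, Pi.add_apply, Pi.smul_apply, smul_eq_mul]; field_simp; ring)
      (by simp only [hy, Pi.add_apply, Pi.smul_apply, smul_eq_mul]; field_simp; ring)
      (by simp only [hy, Pi.add_apply, Pi.smul_apply, smul_eq_mul]; field_simp; simp only [hD]; ring)
      (hiso' _ hxm _ hxm) (hiso' _ hxm _ hym) (hiso' _ hym _ hym)
    rw [act_mul, act_origin (chart _), c0, c1, hspan, hplane p (hsub hp)]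
    rfl

open Classical in
/-- The coordinates of a variation in the big cells around the base curve. -/
noncomputable def coord (A : ℝ → Mat) (V : ℝ × ℝ → Lam) (i : Fin 5) (p : ℝ × ℝ) : ℝ :=
  if hz : ∃ z, (V p).plane = act (A p.1 * chart z) origin then hz.choose i else 0

/-- Injectivity of the chart makes the pointwise choice in `coord` agree with any local smooth
coordinates, so a single `ξ` serves along the whole curve. -/
theorem coord_eq {p : ℝ × ℝ} (hA : A p.1 ∈ Oh) {z : Fin 5 → ℝ}
    (hz : (V p).plane = act (A p.1 * chart z) origin) : (fun i => coord A V i p) = z := by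
  have hex : ∃ z, (V p).plane = act (A p.1 * chart z) origin := ⟨z, hz⟩
  have h1 := hex.choose_spec
  have h2 : (fun i => coord A V i p) = hex.choose := by
    ext i
    rw [coord, dif_pos hex]
  rw [h2]
  apply chart_injective
  apply act_inj hA
  rw [← act_mul, ← act_mul, ← h1, hz]

theorem coord_eq_zero (HA : IsFrame γ J A) {p : ℝ × ℝ} (hp : p.1 ∈ J) (hV : V p = γ p.1)
    (i : Fin 5) : coord A V i p = 0 :=
  congrFun (coord_eq (A := A) (V := V) (z := 0) (HA.mem_Oh hp)
    (by rw [hV, chart_zero, mul_one]; exact HA.proj _ hp)) i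

theorem boundary_eq_zero {ξ : Fin 5 → ℝ × ℝ → ℝ} {s : ℝ}
    (hs : ∀ᶠ t in 𝓝 s, ∀ i, ∀ᶠ u in 𝓝 (0 : ℝ), ξ i (t, u) = 0) : boundary A ξ s = 0 := by
  have h1 : ∀ i, infin ξ i =ᶠ[𝓝 s] fun _ => 0 := fun i => hs.mono fun t ht => by
    rw [infin, du, Filter.EventuallyEq.deriv_eq (ht i), deriv_const]
  simp [boundary, (h1 _).self_of_nhds, (h1 _).deriv_eq]

/-- Orbits with the curvatures of the theorem are critical. -/
theorem isCritical_of_frame (hJ : IsOpen J) (HA : IsFourthOrder γ J A) {u v : ℝ} (hu : u ≠ 0)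
    (hθ : ∀ t ∈ J, theta A t = X u v) : IsCritical J γ := by
  intro a b ε V hV
  have hεm : (0 : ℝ) ∈ Set.Ioo (-ε) ε := ⟨by linarith [hV.eps_pos], hV.eps_pos⟩
  have hloc : ∀ s ∈ J, ∃ N, (s, (0 : ℝ)) ∈ N ∧ Deformation γ J A N (coord A V) ∧
      ∀ p ∈ N, (V p).plane = act (deform A (coord A V) p) origin := fun s hs => by
    obtain ⟨N, hN, hsN, hsub, z, hz, hVz⟩ := exists_local_coord HA.toIsFrame
      (fun p hp => hp.1) hV.smooth ⟨hs, hεm⟩ (hV.initial s hs)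
    have hc : ∀ p ∈ N, (fun i => coord A V i p) = z p := fun p hp =>
      coord_eq (HA.mem_Oh (hsub hp).1) (hVz p hp)
    refine ⟨N, hsN, ⟨HA, fun t ht => by rw [hθ t ht]; simp [X], hN, fun p hp => (hsub hp).1,
      fun i => (hz i).congr fun p hp => congrFun (hc p hp) i, fun i t ht => ?_⟩, fun p hp => ?_⟩
    · exact coord_eq_zero HA.toIsFrame (hsub ht).1 (hV.initial t (hsub ht).1) i
    · rw [deform, hc p hp, hVz p hp]
  have hbd : ∀ s ∈ J \ Set.Icc a b, boundary A (coord A V) s = 0 := fun s hs => by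
    refine boundary_eq_zero (Filter.Eventually.mono
      ((hJ.sdiff isClosed_Icc).mem_nhds hs) fun t ht i => ?_)
    exact Filter.Eventually.mono (isOpen_Ioo.mem_nhds hεm) fun w hw =>
      coord_eq_zero HA.toIsFrame ht.1 (hV.support t ht w hw) i
  have hcont : ∀ s ∈ J, ContinuousAt (boundary A (coord A V)) s := fun s hs => by
    obtain ⟨N, hsN, H, -⟩ := hloc s hs
    exact (H.hasDerivAt_boundary hsN).continuousAt
  have haJ : a ∈ J := hV.subset ⟨le_rfl, hV.le⟩
  have hbJ : b ∈ J := hV.subset ⟨hV.le, le_rfl⟩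
  -- The endpoint belongs to the interval where the variation may be nontrivial. Its boundary term
  -- vanishes as a one-sided limit from outside `[a, b]`; such points exist because `J` is open.
  have ha : boundary A (coord A V) a = 0 := by
    have h1 : boundary A (coord A V) =ᶠ[𝓝[<] a] fun _ => 0 := by
      filter_upwards [self_mem_nhdsWithin, nhdsWithin_le_nhds (hJ.mem_nhds haJ)] with t ht htJ
      exact hbd t ⟨htJ, fun h => absurd h.1 (not_le.2 ht)⟩
    exact tendsto_nhds_unique ((hcont a haJ).tendsto.mono_left nhdsWithin_le_nhds)
      (tendsto_const_nhds.congr' h1.symm)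
  have hb : boundary A (coord A V) b = 0 := by
    have h1 : boundary A (coord A V) =ᶠ[𝓝[>] b] fun _ => 0 := by
      filter_upwards [self_mem_nhdsWithin, nhdsWithin_le_nhds (hJ.mem_nhds hbJ)] with t ht htJ
      exact hbd t ⟨htJ, fun h => absurd h.2 (not_le.2 ht)⟩
    exact tendsto_nhds_unique ((hcont b hbJ).tendsto.mono_left nhdsWithin_le_nhds)
      (tendsto_const_nhds.congr' h1.symm)
  -- All derivatives vanish since `θ` is constant, and the entries of `X u v` satisfy the remaining
  -- algebraic relations.
  have hE : ∀ s ∈ J, ∀ x, eulerLagrange A x s = 0 := fun s hs x => by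
    have hd : ∀ i j, deriv (fun t => theta A t i j) s = 0 := fun i j => by
      have : (fun t => theta A t i j) =ᶠ[𝓝 s] fun _ => X u v i j :=
        Filter.Eventually.mono (hJ.mem_nhds hs) fun t ht => by simp only [hθ t ht]
      rw [this.deriv_eq, deriv_const]
    simp only [eulerLagrange, hd, hθ s hs]
    simp [X]
  refine (first_variation (γ := γ) (ξ := coord A V) hV.le (fun s hs => hloc s (hV.subset hs))
    fun s hs => ?_).congr_deriv ?_
  · rw [hθ s (hV.subset hs)]
    simpa [X] using hu
  · rw [ha, hb, intervalIntegral.integral_congr (g := fun _ => 0) fun s hs => hE s (hV.subset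
      (by rwa [Set.uIcc_of_le hV.le] at hs)) _]
    simp

end

end LieSphere

theorem theoremB (J : Set ℝ) (hJ : IsOpen J) (hJc : IsConnected J) (γ : ℝ → LieSphere.Lam)
    (hγ : LieSphere.IsGeneric J γ) (hs : LieSphere.IsArclengthParam J γ) :
    (∃ κ₁ κ₂ κ₃ κ₄ : ℝ → ℝ, LieSphere.IsLieCurvatures J γ κ₁ κ₂ κ₃ κ₄) ∧
    (∀ κ₁ κ₂ κ₃ κ₄ : ℝ → ℝ, LieSphere.IsLieCurvatures J γ κ₁ κ₂ κ₃ κ₄ →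
      (LieSphere.IsCritical J γ ↔
        ∃ c₁ c₂ c₃ c₄ : ℝ,
          (∀ s ∈ J, κ₁ s = c₁ ∧ κ₂ s = c₂ ∧ κ₃ s = c₃ ∧ κ₄ s = c₄) ∧
          c₁ ≠ 0 ∧ c₃ = 0 ∧ c₄ = c₁ ^ 2 - c₂ ^ 2)) ∧
    (LieSphere.IsCritical J γ →
      ∃ u v : ℝ, u ≠ 0 ∧ LieSphere.X u v ∈ LieSphere.lieAlg ∧
        ∃ A ∈ LieSphere.G, ∀ s ∈ J,
          (γ s).plane =
            LieSphere.act (A * NormedSpace.exp (s • LieSphere.X u v)) LieSphere.origin) := by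
  -- Used twice: the global frame is the input of the sufficiency proof, and it also exhibits a
  -- critical curve as an orbit, with `u = κ₁` and `v = κ₂`.
  have hframe : ∀ κ₁ κ₂ κ₃ κ₄ : ℝ → ℝ, LieSphere.IsLieCurvatures J γ κ₁ κ₂ κ₃ κ₄ →
      ∀ c₁ c₂ c₃ c₄ : ℝ, (∀ s ∈ J, κ₁ s = c₁ ∧ κ₂ s = c₂ ∧ κ₃ s = c₃ ∧ κ₄ s = c₄) →
      c₁ ≠ 0 → c₃ = 0 → c₄ = c₁ ^ 2 - c₂ ^ 2 → ∃ C ∈ LieSphere.G,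
        LieSphere.IsFourthOrder γ J (fun t => C * NormedSpace.exp (t • LieSphere.X c₁ c₂)) := by
    intro κ₁ κ₂ κ₃ κ₄ hκ c₁ c₂ c₃ c₄ hc h1 h3 h4
    refine LieSphere.exists_global_frame hJ hJc h1 fun t ht => ?_
    obtain ⟨I, A, htI, hIJ, HA, hA⟩ := hκ t ht
    refine ⟨I, A, htI, hIJ, HA, fun s hsI => ?_⟩
    have harc := hs.theta_eq_one HA hsI (hIJ hsI)
    obtain ⟨a1, a2, a3, a4⟩ := hA s hsI
    obtain ⟨b1, b2, b3, b4⟩ := hc s (hIJ hsI)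
    rw [harc, mul_one] at a1 a2 a3 a4
    rw [HA.theta_eq_kmat hsI harc, LieSphere.X_eq_kmat, a1, a2, a3, a4, b1, b2, b3, b4, h3, h4]
  have hex := hγ.exists_isLieCurvatures hJ
  refine ⟨hex, fun κ₁ κ₂ κ₃ κ₄ hκ => ⟨fun hcrit => hcrit.curvatures hJ hJc hγ hs hκ, ?_⟩,
    fun hcrit => ?_⟩
  · rintro ⟨c₁, c₂, c₃, c₄, hc, h1, h3, h4⟩
    obtain ⟨C, hC, H⟩ := hframe κ₁ κ₂ κ₃ κ₄ hκ c₁ c₂ c₃ c₄ hc h1 h3 h4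
    exact LieSphere.isCritical_of_frame hJ H h1 fun t _ =>
      LieSphere.theta_exp C _ (LieSphere.X_mem c₁ c₂) (LieSphere.G_subset hC) t
  · obtain ⟨κ₁, κ₂, κ₃, κ₄, hκ⟩ := hex
    obtain ⟨c₁, c₂, c₃, c₄, hc, h1, h3, h4⟩ := hcrit.curvatures hJ hJc hγ hs hκ
    obtain ⟨C, hC, H⟩ := hframe κ₁ κ₂ κ₃ κ₄ hκ c₁ c₂ c₃ c₄ hc h1 h3 h4
    exact ⟨c₁, c₂, h1, LieSphere.X_mem c₁ c₂, C, hC, H.proj⟩
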